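/- Let $R$ be a $\mathbb{Z}$-graded commutative dga over $\mathbb{C}$ with a nilpotent ideal $I$, and let $\mathfrak g$ be a curved $L_\infty$ algebra over $(R,I)$ on a free graded $R$-module of finite rank with homogeneous basis $x_1,\dots,x_r$: a degree one, square-zero derivation $d$ of $\mathcal{O}(B\mathfrak g)=C^*(\mathfrak g)=\widehat{\mathrm{Sym}}(\mathfrak g^\vee[-1])=R[[\xi_1,\dots,\xi_r]]$, $|\xi_i|=1-|x_i|$, extending the differential of $R$ and preserving, modulo $I$, the ideal generated by the $\xi_i$; the brackets $\ell_n$ are its Taylor components. Let $\Omega^{-*}(B\mathfrak g)=R[[\xi_i,d\xi_i]]$, with $|d\xi_i|=|\xi_i|-1$. Let $T_{B\mathfrak g}=C^*(\mathfrak g,\mathfrak g[1])$ be the tangent module with the connection given by the trivialization $C^\#(\mathfrak g)\otimes\mathfrak g[1]$, let $\mathrm{At}$ be the Atiyah class of this connection (its graded commutator with the differential), and let $ch_k(T_{B\mathfrak g})=\frac{1}{k!(-2\pi i)^k}\mathrm{Tr}(\mathrm{At}^k)\in\Omega^{-*}(B\mathfrak g)$, with $\mathrm{Tr}$ the graded trace.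 For a power series $f=\sum_k f_kx^k$ the associated additive characteristic class is $\sum_k f_k\,k!\,ch_k$ (that is, $\sum_a f(x_a)$ over Chern roots $x_a$). Let $\log(e^{-c_1/2}\mathrm{Td})$ and $\log\hat A$ be the additive classes associated with $\log\frac{x}{1-e^{-x}}-\frac x2$ and $\log\frac{x/2}{\sinh(x/2)}$. Consider one-dimensional Chern–Simons theory on the circle $S^1=\mathbb{R}/\ell\mathbb{Z}$ with values in $\mathfrak g\oplus\mathfrak g^\vee[-2]$: the fields are $(\alpha,\beta)\in\Omega^*(S^1)\otimes(\mathfrak g[1]\oplus\mathfrak g^\vee[-1])$ and the interaction is $I_{CS}=\sum_n\frac1{n!}\int_{S^1}\langle\beta,\ell_n(\alpha^{\otimes n})\rangle$. Let $P_\epsilon^L=\int_\epsilon^L(d^*\otimes1)K_t\,dt$ be the heat-kernel propagator, and let $$I^{(1)}[L]=\lim_{\epsilon\to0}\sum_\gamma\frac1{|\mathrm{Aut}\,\gamma|}W_\gamma(P_\epsilon^L,I_{CS}),\qquad I^{(1)}[\infty]=\lim_{L\to\infty}I^{(1)}[L],$$ where the sum is over connected stable graphs with one loop (all genus-zero vertices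 have valence at least $3$). Let $\mathcal H=\mathbb{C}[dz]\otimes(\mathfrak g[1]\oplus\mathfrak g^\vee[-1])$, $dz=\frac{1}{2\pi i\,\ell}dx$, be the harmonic fields, so that $\widehat{\mathrm{Sym}}(\mathcal H^\vee)=\Omega^{-*}(T^*B\mathfrak g)\supset\Omega^{-*}(B\mathfrak g)$. Then on $\mathcal H$ these limits exist (coefficientwise, in the weak topology), $I^{(1)}[\infty]|_{\mathcal H}$ lies in $\Omega^{-*}(B\mathfrak g)$, and $$I^{(1)}[\infty]\big|_{\mathcal H}=\sum_{k\ge1}\frac{2(2k-1)!}{(2\pi i)^{2k}}\,\zeta(2k)\,ch_{2k}(T_{B\mathfrak g})=\log\big(e^{-c_1(T_{B\mathfrak g})/2}\,\mathrm{Td}(T_{B\mathfrak g})\big)=\log\hat A(T_{B\mathfrak g})\in\Omega^{-*}(B\mathfrak g).$$ -/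

import Mathlib

/-!
One-dimensional Chern-Simons theory on the circle with values in `g ⊕ g^∨[-2]`, for a curved
`L∞` algebra `g` over a commutative dga `R`: graded-commutative formal power series, the
Chevalley-Eilenberg algebra, the Atiyah class and the Chern character of `T_{Bg}`, the heat-kernel
propagator, one-loop Feynman weights and their scale-infinity limit.
-/

namespace ChernSimons

noncomputable section

/-! ### Commutative differential graded algebras -/

section Base

variable {R : Type*} [Ring R] [Algebra ℂ R]

/-- The parity automorphism `r ↦ (-1)^{|r|} r` of a `ℤ`-graded algebra. -/
def parityHom (gr : ℤ → Submodule ℂ R) [GradedAlgebra gr] : R →ₐ[ℂ] R :=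
  (DirectSum.toAlgebra ℂ (fun i => gr i)
    (fun i => (((Int.negOnePow i : ℤˣ) : ℤ) : ℂ) • (gr i).subtype)
    (by
      change (((Int.negOnePow 0 : ℤˣ) : ℤ) : ℂ) • (1 : R) = 1
      simp)
    (by
      intro i j a b
      change (((Int.negOnePow (i + j) : ℤˣ) : ℤ) : ℂ) • ((a : R) * (b : R)) =
        ((((Int.negOnePow i : ℤˣ) : ℤ) : ℂ) • (a : R)) *
          ((((Int.negOnePow j : ℤˣ) : ℤ) : ℂ) • (b : R))
      rw [Int.negOnePow_add, smul_mul_smul_comm]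
      push_cast
      rfl)).comp (DirectSum.decomposeAlgEquiv gr).toAlgHom

/-- The structure of a (graded-)commutative dga over `ℂ` on a graded algebra: graded
commutativity and a square-zero derivation of degree `+1`. -/
structure CDGA (gr : ℤ → Submodule ℂ R) [GradedAlgebra gr] where
  comm : ∀ (i j : ℤ) (a b : R), a ∈ gr i → b ∈ gr j →
    a * b = (((Int.negOnePow (i * j) : ℤˣ) : ℤ) : ℂ) • (b * a)
  d : R →ₗ[ℂ] R
  d_mem : ∀ (i : ℤ) (a : R), a ∈ gr i → d a ∈ gr (i + 1)
  leibniz : ∀ a b : R, d (a * b) = d a * b + parityHom gr a * d b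
  d_sq : ∀ a : R, d (d a) = 0

end Base

/-! ### Graded-commutative formal power series -/

/-- Exponents of the monomials in variables of degrees `deg`: an odd variable occurs at most
once. -/
def Admissible {σ : Type*} (deg : σ → ℤ) (m : σ →₀ ℕ) : Prop :=
  ∀ s, Odd (deg s) → m s ≤ 1

/-- The completed graded-commutative symmetric algebra over `R` on free variables `ξ_s` of degree
`deg s`.  The element with coefficients `F_m` is the formal sum `∑ F_m ξ^m`, where `ξ^m` is the
product of the `ξ_s^{m_s}` in increasing order of `s`. -/
@[ext]
structure GSeries {R : Type*} [Ring R] [Algebra ℂ R] (gr : ℤ → Submodule ℂ R) {σ : Type*}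
    (deg : σ → ℤ) where
  coeff : (σ →₀ ℕ) → R
  coeff_eq_zero : ∀ m, ¬ Admissible deg m → coeff m = 0

section Signs

variable {σ : Type*} [Fintype σ]

/-- The number of odd letters of the monomial `ξ^m`. -/
def oddCount (deg : σ → ℤ) (m : σ →₀ ℕ) : ℕ :=
  ∑ s, if Odd (deg s) then m s else 0

/-- The number of transpositions of odd letters needed to reorder `ξ^m ξ^n` into `ξ^(m+n)`. -/
def koszul [LinearOrder σ] (deg : σ → ℤ) (m n : σ →₀ ℕ) : ℕ :=
  ∑ s, ∑ t, if t < s ∧ Odd (deg s) ∧ Odd (deg t) then m s * n t else 0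

theorem oddCount_zero (deg : σ → ℤ) : oddCount deg 0 = 0 := by
  simp [oddCount]

theorem oddCount_add (deg : σ → ℤ) (m n : σ →₀ ℕ) :
    oddCount deg (m + n) = oddCount deg m + oddCount deg n := by
  unfold oddCount
  rw [← Finset.sum_add_distrib]
  refine Finset.sum_congr rfl fun s _ => ?_
  split_ifs <;> simp

variable [LinearOrder σ]

theorem koszul_zero_left (deg : σ → ℤ) (n : σ →₀ ℕ) : koszul deg 0 n = 0 := by
  simp [koszul]

theorem koszul_zero_right (deg : σ → ℤ) (m : σ →₀ ℕ) : koszul deg m 0 = 0 := by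
  simp [koszul]

theorem koszul_add_left (deg : σ → ℤ) (m m' n : σ →₀ ℕ) :
    koszul deg (m + m') n = koszul deg m n + koszul deg m' n := by
  unfold koszul
  rw [← Finset.sum_add_distrib]
  refine Finset.sum_congr rfl fun s _ => ?_
  rw [← Finset.sum_add_distrib]
  refine Finset.sum_congr rfl fun t _ => ?_
  split_ifs
  · simp [add_mul]
  · simp

theorem koszul_add_right (deg : σ → ℤ) (m n n' : σ →₀ ℕ) :
    koszul deg m (n + n') = koszul deg m n + koszul deg m n' := by
  unfold koszul
  rw [← Finset.sum_add_distrib]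
  refine Finset.sum_congr rfl fun s _ => ?_
  rw [← Finset.sum_add_distrib]
  refine Finset.sum_congr rfl fun t _ => ?_
  split_ifs
  · simp [mul_add]
  · simp

end Signs

theorem Admissible.of_add_left {σ : Type*} {deg : σ → ℤ} {m n : σ →₀ ℕ}
    (h : Admissible deg (m + n)) : Admissible deg m := fun s hs => by
  have := h s hs
  simp only [Finsupp.add_apply] at this
  omega

theorem Admissible.of_add_right {σ : Type*} {deg : σ → ℤ} {m n : σ →₀ ℕ}
    (h : Admissible deg (m + n)) : Admissible deg n := fun s hs => by
  have := h s hs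
  simp only [Finsupp.add_apply] at this
  omega

theorem admissible_zero {σ : Type*} (deg : σ → ℤ) : Admissible deg 0 := fun _ _ => by simp

namespace GSeries

variable {R : Type*} [Ring R] [Algebra ℂ R] {gr : ℤ → Submodule ℂ R} {σ : Type*} {deg : σ → ℤ}

open Classical in
/-- The series with the given coefficients on admissible exponents. -/
def ofFun (gr : ℤ → Submodule ℂ R) (deg : σ → ℤ) (f : (σ →₀ ℕ) → R) : GSeries gr deg where
  coeff m := if Admissible deg m then f m else 0
  coeff_eq_zero _ hm := if_neg hm

theorem coeff_ofFun (f : (σ →₀ ℕ) → R) {m : σ →₀ ℕ} (hm : Admissible deg m) :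
    (ofFun gr deg f).coeff m = f m := if_pos hm

theorem ext_adm {F G : GSeries gr deg} (h : ∀ m, Admissible deg m → F.coeff m = G.coeff m) :
    F = G := by
  ext m
  by_cases hm : Admissible deg m
  · exact h m hm
  · rw [F.coeff_eq_zero m hm, G.coeff_eq_zero m hm]

instance : Zero (GSeries gr deg) := ⟨⟨fun _ => 0, fun _ _ => rfl⟩⟩

instance : Add (GSeries gr deg) :=
  ⟨fun F G => ⟨fun m => F.coeff m + G.coeff m, fun m hm => by
    rw [F.coeff_eq_zero m hm, G.coeff_eq_zero m hm, add_zero]⟩⟩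

instance : Neg (GSeries gr deg) :=
  ⟨fun F => ⟨fun m => - F.coeff m, fun m hm => by rw [F.coeff_eq_zero m hm, neg_zero]⟩⟩

instance : SMul ℂ (GSeries gr deg) :=
  ⟨fun c F => ⟨fun m => c • F.coeff m, fun m hm => by rw [F.coeff_eq_zero m hm, smul_zero]⟩⟩

theorem coeff_zero (m : σ →₀ ℕ) : (0 : GSeries gr deg).coeff m = 0 := rfl
theorem coeff_add (F G : GSeries gr deg) (m : σ →₀ ℕ) :
    (F + G).coeff m = F.coeff m + G.coeff m := rfl
theorem coeff_neg (F : GSeries gr deg) (m : σ →₀ ℕ) : (-F).coeff m = - F.coeff m := rfl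
theorem coeff_smul (c : ℂ) (F : GSeries gr deg) (m : σ →₀ ℕ) :
    (c • F).coeff m = c • F.coeff m := rfl

instance : AddCommGroup (GSeries gr deg) where
  add_assoc F G H := by ext m; simp only [coeff_add, add_assoc]
  zero_add F := by ext m; simp only [coeff_add, coeff_zero, zero_add]
  add_zero F := by ext m; simp only [coeff_add, coeff_zero, add_zero]
  add_comm F G := by ext m; simp only [coeff_add, add_comm]
  neg_add_cancel F := by ext m; simp only [coeff_add, coeff_neg, coeff_zero, neg_add_cancel]
  nsmul := nsmulRec
  zsmul := zsmulRec

instance : Module ℂ (GSeries gr deg) where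
  one_smul F := by ext m; simp only [coeff_smul, one_smul]
  mul_smul a b F := by ext m; simp only [coeff_smul, mul_smul]
  smul_zero a := by ext m; simp only [coeff_smul, coeff_zero, smul_zero]
  smul_add a F G := by ext m; simp only [coeff_smul, coeff_add, smul_add]
  add_smul a b F := by ext m; simp only [coeff_smul, coeff_add, add_smul]
  zero_smul F := by ext m; simp only [coeff_smul, coeff_zero, zero_smul]

/-- The constant series. -/
def C (gr : ℤ → Submodule ℂ R) (deg : σ → ℤ) [DecidableEq σ] (r : R) : GSeries gr deg :=
  ofFun gr deg fun m => if m = 0 then r else 0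

/-- The variable `ξ_s`. -/
def X (gr : ℤ → Submodule ℂ R) (deg : σ → ℤ) [DecidableEq σ] (s : σ) : GSeries gr deg :=
  ofFun gr deg fun m => if m = Finsupp.single s 1 then 1 else 0

/-- The series has (cohomological) degree `k`. -/
def IsHomogeneous [Fintype σ] (k : ℤ) (F : GSeries gr deg) : Prop :=
  ∀ m : σ →₀ ℕ, F.coeff m ∈ gr (k - ∑ s, (m s : ℤ) * deg s)

/-- The part of a series of polynomial degree at least three in the variables. -/
def cubicAndHigher [Fintype σ] (F : GSeries gr deg) : GSeries gr deg :=
  ofFun gr deg fun m => if 3 ≤ ∑ s, m s then F.coeff m else 0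

/-- Apply a map to all coefficients (written to the left of the monomials). -/
def mapCoeff (f : R → R) (F : GSeries gr deg) : GSeries gr deg :=
  ofFun gr deg fun m => f (F.coeff m)

/-- The coefficientwise sum of a family of series that is locally finite, i.e. each monomial
occurs in only finitely many of them. -/
def formalSum {κ : Type*} (F : κ → GSeries gr deg) : GSeries gr deg :=
  ofFun gr deg fun m => ∑ᶠ k, (F k).coeff m

variable [GradedAlgebra gr] [Fintype σ] [LinearOrder σ]

/-- The parity automorphism `F ↦ (-1)^{|F|} F`. -/
def parity (F : GSeries gr deg) : GSeries gr deg :=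
  ofFun gr deg fun m => (-1 : ℂ) ^ oddCount deg m • parityHom gr (F.coeff m)

/-- The product, with Koszul signs: `(a ξ^m)(b ξ^n) = ± a b ξ^(m+n)`. -/
instance : Mul (GSeries gr deg) :=
  ⟨fun F G => ofFun gr deg fun p => ∑ q ∈ Finset.HasAntidiagonal.antidiagonal p,
    (-1 : ℂ) ^ koszul deg q.1 q.2 •
      (F.coeff q.1 * (parityHom gr ^ oddCount deg q.1) (G.coeff q.2))⟩

instance : One (GSeries gr deg) := ⟨C gr deg 1⟩

theorem coeff_mul (F G : GSeries gr deg) {p : σ →₀ ℕ} (hp : Admissible deg p) :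
    (F * G).coeff p = ∑ q ∈ Finset.HasAntidiagonal.antidiagonal p,
      (-1 : ℂ) ^ koszul deg q.1 q.2 •
        (F.coeff q.1 * (parityHom gr ^ oddCount deg q.1) (G.coeff q.2)) :=
  coeff_ofFun _ hp

theorem coeff_one {p : σ →₀ ℕ} (hp : Admissible deg p) :
    (1 : GSeries gr deg).coeff p = if p = 0 then 1 else 0 :=
  coeff_ofFun _ hp

protected theorem mul_assoc (F G H : GSeries gr deg) : F * G * H = F * (G * H) := by
  refine ext_adm fun p hp => ?_
  rw [coeff_mul _ _ hp, coeff_mul _ _ hp]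
  have hL : ∀ q ∈ Finset.HasAntidiagonal.antidiagonal p,
      (-1 : ℂ) ^ koszul deg q.1 q.2 •
        ((F * G).coeff q.1 * (parityHom gr ^ oddCount deg q.1) (H.coeff q.2)) =
      ∑ u ∈ Finset.HasAntidiagonal.antidiagonal q.1,
        (-1 : ℂ) ^ (koszul deg u.1 u.2 + koszul deg u.1 q.2 + koszul deg u.2 q.2) •
          (F.coeff u.1 * (parityHom gr ^ oddCount deg u.1) (G.coeff u.2) *
            (parityHom gr ^ (oddCount deg u.1 + oddCount deg u.2)) (H.coeff q.2)) := by
    intro q hq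
    have hq' := Finset.HasAntidiagonal.mem_antidiagonal.1 hq
    have hadm : Admissible deg q.1 := (hq' ▸ hp : Admissible deg (q.1 + q.2)).of_add_left
    rw [coeff_mul _ _ hadm, Finset.sum_mul, Finset.smul_sum]
    refine Finset.sum_congr rfl fun u hu => ?_
    rw [← Finset.HasAntidiagonal.mem_antidiagonal.1 hu, koszul_add_left, oddCount_add, smul_mul_assoc, smul_smul,
      ← pow_add]
    congr 2
    ring
  have hR : ∀ q ∈ Finset.HasAntidiagonal.antidiagonal p,
      (-1 : ℂ) ^ koszul deg q.1 q.2 •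
        (F.coeff q.1 * (parityHom gr ^ oddCount deg q.1) ((G * H).coeff q.2)) =
      ∑ u ∈ Finset.HasAntidiagonal.antidiagonal q.2,
        (-1 : ℂ) ^ (koszul deg q.1 u.1 + koszul deg q.1 u.2 + koszul deg u.1 u.2) •
          (F.coeff q.1 * (parityHom gr ^ oddCount deg q.1) (G.coeff u.1) *
            (parityHom gr ^ (oddCount deg q.1 + oddCount deg u.1)) (H.coeff u.2)) := by
    intro q hq
    have hq' := Finset.HasAntidiagonal.mem_antidiagonal.1 hq
    have hadm : Admissible deg q.2 := (hq' ▸ hp : Admissible deg (q.1 + q.2)).of_add_right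
    rw [coeff_mul _ _ hadm, map_sum, Finset.mul_sum, Finset.smul_sum]
    refine Finset.sum_congr rfl fun u hu => ?_
    rw [← Finset.HasAntidiagonal.mem_antidiagonal.1 hu, koszul_add_right, map_smul, map_mul, mul_smul_comm,
      smul_smul, ← pow_add, pow_add (parityHom gr), AlgHom.mul_apply, mul_assoc]
  rw [Finset.sum_congr rfl hL, Finset.sum_congr rfl hR, Finset.sum_sigma', Finset.sum_sigma']
  refine Finset.sum_nbij' (fun x => ⟨(x.2.1, x.2.2 + x.1.2), (x.2.2, x.1.2)⟩)
    (fun x => ⟨(x.1.1 + x.2.1, x.2.2), (x.1.1, x.2.1)⟩) ?_ ?_ ?_ ?_ ?_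
  · rintro ⟨⟨a, b⟩, ⟨c, e⟩⟩ h
    simp only [Finset.mem_sigma, Finset.HasAntidiagonal.mem_antidiagonal] at h ⊢
    exact ⟨by rw [← h.1, ← h.2, add_assoc], trivial⟩
  · rintro ⟨⟨a, b⟩, ⟨c, e⟩⟩ h
    simp only [Finset.mem_sigma, Finset.HasAntidiagonal.mem_antidiagonal] at h ⊢
    exact ⟨by rw [← h.1, ← h.2, add_assoc], trivial⟩
  · rintro ⟨⟨a, b⟩, ⟨c, e⟩⟩ h
    simp only [Finset.mem_sigma, Finset.HasAntidiagonal.mem_antidiagonal] at h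
    obtain ⟨_, rfl⟩ := h
    rfl
  · rintro ⟨⟨a, b⟩, ⟨c, e⟩⟩ h
    simp only [Finset.mem_sigma, Finset.HasAntidiagonal.mem_antidiagonal] at h
    obtain ⟨_, rfl⟩ := h
    rfl
  · rintro ⟨⟨a, b⟩, ⟨c, e⟩⟩ _
    rfl

instance : Ring (GSeries gr deg) where
  __ := (inferInstance : AddCommGroup (GSeries gr deg))
  mul_assoc := GSeries.mul_assoc
  one_mul F := by
    refine ext_adm fun p hp => ?_
    rw [coeff_mul _ _ hp, Finset.sum_eq_single (0, p)]
    · simp [coeff_one (admissible_zero deg), koszul_zero_left, oddCount_zero]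
    · rintro ⟨a, b⟩ hab hne
      have hab' := Finset.HasAntidiagonal.mem_antidiagonal.1 hab
      have ha : a ≠ 0 := by
        rintro rfl
        exact hne (by simpa using hab')
      have hadm : Admissible deg a := (hab' ▸ hp : Admissible deg (a + b)).of_add_left
      simp [coeff_one hadm, ha]
    · intro h
      exact absurd (Finset.HasAntidiagonal.mem_antidiagonal.2 (zero_add p)) h
  mul_one F := by
    refine ext_adm fun p hp => ?_
    rw [coeff_mul _ _ hp, Finset.sum_eq_single (p, 0)]
    · simp [coeff_one (admissible_zero deg), koszul_zero_right]
    · rintro ⟨a, b⟩ hab hne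
      have hab' := Finset.HasAntidiagonal.mem_antidiagonal.1 hab
      have hb : b ≠ 0 := by
        rintro rfl
        exact hne (by simpa using hab')
      have hadm : Admissible deg b := (hab' ▸ hp : Admissible deg (a + b)).of_add_right
      simp [coeff_one hadm, hb]
    · intro h
      exact absurd (Finset.HasAntidiagonal.mem_antidiagonal.2 (add_zero p)) h
  zero_mul F := by
    refine ext_adm fun p hp => ?_
    simp [coeff_mul _ _ hp, coeff_zero]
  mul_zero F := by
    refine ext_adm fun p hp => ?_
    simp [coeff_mul _ _ hp, coeff_zero]
  left_distrib F G H := by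
    refine ext_adm fun p hp => ?_
    simp only [coeff_mul _ _ hp, coeff_add, map_add, mul_add, smul_add, Finset.sum_add_distrib]
  right_distrib F G H := by
    refine ext_adm fun p hp => ?_
    simp only [coeff_mul _ _ hp, coeff_add, add_mul, smul_add, Finset.sum_add_distrib]

/-- The left partial derivative `∂/∂ξ_s`. -/
def pderiv (s : σ) (F : GSeries gr deg) : GSeries gr deg :=
  ofFun gr deg fun m =>
    if Odd (deg s) then
      (-1 : ℂ) ^ (∑ t, if t < s ∧ Odd (deg t) then m t else 0) •
        parityHom gr (F.coeff (m + Finsupp.single s 1))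
    else ((m s : ℂ) + 1) • F.coeff (m + Finsupp.single s 1)

/-- The substitution `ξ_s ↦ φ s` into a series, for values `φ s` of the same parity as `ξ_s` and
without constant term: `∑ F_m ξ^m ↦ ∑ F_m φ^m`. -/
def eval {τ : Type*} [Fintype τ] [LinearOrder τ] {deg' : τ → ℤ} (φ : σ → GSeries gr deg')
    (F : GSeries gr deg) : GSeries gr deg' :=
  formalSum fun m : σ →₀ ℕ =>
    C gr deg' (F.coeff m) * ((Finset.univ.sort (· ≤ ·)).map fun s => φ s ^ m s).prod

end GSeries

/-! ### Differential forms in negative degrees -/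

section Forms

/-- Degrees of the coordinates of the algebra `Ω^{-*}` of forms on the space with coordinates `ξ_s`
of degree `deg s`: the pair `(0, s)` stands for `ξ_s` and `(1, s)` for `dξ_s`, whose degree is
`deg s - 1`. -/
def formDeg {σ : Type*} (deg : σ → ℤ) (p : Fin 2 ×ₗ σ) : ℤ :=
  deg (ofLex p).2 - ((ofLex p).1 : ℕ)

variable {R : Type*} [Ring R] [Algebra ℂ R] {gr : ℤ → Submodule ℂ R} [GradedAlgebra gr]
  {σ : Type*} [Fintype σ] [LinearOrder σ] {deg : σ → ℤ}

/-- Functions as forms of degree zero. -/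
def toForm (F : GSeries gr deg) : GSeries gr (formDeg deg) :=
  F.eval fun s => GSeries.X gr (formDeg deg) (toLex (0, s))

/-- The universal (`R`-linear) de Rham differential `∑_s dξ_s ∂/∂ξ_s` on `Ω^{-*}`, an odd
derivation of degree `-1`. -/
def deRham (F : GSeries gr (formDeg deg)) : GSeries gr (formDeg deg) :=
  ∑ s, GSeries.X gr (formDeg deg) (toLex (1, s)) * F.pderiv (toLex (0, s))

end Forms

/-! ### Curved `L∞` algebras, the tangent module and its Atiyah class -/

section LInfinity

variable {R : Type*} [Ring R] [Algebra ℂ R] {gr : ℤ → Submodule ℂ R} [GradedAlgebra gr] {r : ℕ}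

/-- The degrees of the generators `ξ_i` of `C^#(g) = Sym^(g^∨[-1])`, dual to a homogeneous basis
`x_i` of `g` with `|x_i| = deg i`. -/
def ceDeg (deg : Fin r → ℤ) (i : Fin r) : ℤ := 1 - deg i

/-- A curved `L∞` algebra over `(R, I)` on the free graded `R`-module `g` with a homogeneous basis
of degrees `deg`: a square-zero derivation of degree one of the completed symmetric algebra of
`g^∨[-1]`, which extends the differential of `R` and, modulo `I`, preserves the ideal generated by
`g^∨[-1]`. The brackets of `g` are its Taylor coefficients. -/
structure CurvedLInfinity (B : CDGA gr) (I : TwoSidedIdeal R) (deg : Fin r → ℤ) where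
  d : GSeries gr (ceDeg deg) →ₗ[ℂ] GSeries gr (ceDeg deg)
  d_homogeneous : ∀ (k : ℤ) (F : GSeries gr (ceDeg deg)),
    F.IsHomogeneous k → (d F).IsHomogeneous (k + 1)
  leibniz : ∀ F G, d (F * G) = d F * G + F.parity * d G
  d_const : ∀ a : R, d (GSeries.C gr (ceDeg deg) a) = GSeries.C gr (ceDeg deg) (B.d a)
  d_sq : ∀ F, d (d F) = 0
  d_augmentation : ∀ F, F.coeff 0 = 0 → (d F).coeff 0 ∈ I

variable {B : CDGA gr} {I : TwoSidedIdeal R} {deg : Fin r → ℤ}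

namespace CurvedLInfinity

/-- The function `d ξ_i`; its part of polynomial degree `n` is the `i`-th component of
`ℓ_n(α, …, α) / n!` on the universal element `α = ∑ ξ_i x_i`. -/
def q (g : CurvedLInfinity B I deg) (i : Fin r) : GSeries gr (ceDeg deg) :=
  g.d (GSeries.X gr (ceDeg deg) i)

/-- The differential (Lie derivative along `d`) on `Ω^{-*}(Bg)`; it extends `d` and anticommutes
with the de Rham differential. -/
def dForm (g : CurvedLInfinity B I deg) (F : GSeries gr (formDeg (ceDeg deg))) :
    GSeries gr (formDeg (ceDeg deg)) :=
  F.mapCoeff B.d + ∑ i, (toForm (g.q i) * F.pderiv (toLex (0, i)) -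
    deRham (toForm (g.q i)) * F.pderiv (toLex (1, i)))

/-- The components `A_{ji}` of `[d, ∂_j] = ∑_i A_{ji} ∂_i`. -/
def tangentMatrix (g : CurvedLInfinity B I deg) (j i : Fin r) : GSeries gr (ceDeg deg) :=
  -((((Int.negOnePow (ceDeg deg j) : ℤˣ) : ℤ) : ℂ) • (g.q i).pderiv j)

/-- The differential `[d, -]` of the dg module `T_{Bg} = C^*(g, g[1])` of vector fields
`∑ f_i ∂_i` on `Bg`, where `∂_i = ∂/∂ξ_i` is the basis of `g[1]`. -/
def dTangent (g : CurvedLInfinity B I deg) (f : Fin r → GSeries gr (ceDeg deg)) :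
    Fin r → GSeries gr (ceDeg deg) :=
  fun i => g.d (f i) + ∑ j, (f j).parity * g.tangentMatrix j i

/-- The differential of the module `Ω^{-*}(Bg) ⊗ T_{Bg}`. -/
def dFormTangent (g : CurvedLInfinity B I deg) (f : Fin r → GSeries gr (formDeg (ceDeg deg))) :
    Fin r → GSeries gr (formDeg (ceDeg deg)) :=
  fun i => g.dForm (f i) + ∑ j, (f j).parity * toForm (g.tangentMatrix j i)

/-- The connection on `T_{Bg}` given by the trivialization `C^#(g) ⊗ g[1]`. -/
def connection (f : Fin r → GSeries gr (ceDeg deg)) :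
    Fin r → GSeries gr (formDeg (ceDeg deg)) :=
  fun i => deRham (toForm (f i))

/-- The Atiyah class, the graded commutator of the connection with the differentials. In
`Ω^{-*}` both operators are odd, whence the plus sign. -/
def atiyah (g : CurvedLInfinity B I deg) (f : Fin r → GSeries gr (ceDeg deg)) :
    Fin r → GSeries gr (formDeg (ceDeg deg)) :=
  fun i => connection (g.dTangent f) i + g.dFormTangent (connection f) i

/-- The matrix of the Atiyah class in the basis `∂_j`: row `j` is the image of `∂_j`, so that
matrix products are compositions. -/
def atiyahMatrix (g : CurvedLInfinity B I deg) :
    Matrix (Fin r) (Fin r) (GSeries gr (formDeg (ceDeg deg))) :=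
  fun j i => g.atiyah (fun k => if k = j then 1 else 0) i

/-- The graded trace of an endomorphism of `Ω^{-*}(Bg) ⊗ g[1]`; the basis vector `∂_i` of `g[1]`
has the parity of `ceDeg deg i`. -/
def superTrace (M : Matrix (Fin r) (Fin r) (GSeries gr (formDeg (ceDeg deg)))) :
    GSeries gr (formDeg (ceDeg deg)) :=
  ∑ i, (((Int.negOnePow (ceDeg deg i) : ℤˣ) : ℤ) : ℂ) • M i i

/-- `ch_k(T_{Bg}) = Tr(At^k) / (k! (-2πi)^k)`, in `Ω^{-*}(Bg)`. -/
def ch (g : CurvedLInfinity B I deg) (k : ℕ) : GSeries gr (formDeg (ceDeg deg)) :=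
  (1 / ((k.factorial : ℂ) * (-(2 * (Real.pi : ℂ) * Complex.I)) ^ k)) •
    superTrace (g.atiyahMatrix ^ k)

/-- The additive characteristic class of `T_{Bg}` attached to a power series `f`, i.e. the class
which on a sum of line bundles with first Chern classes `x_a` is `∑_a f(x_a)`. Since
`ch_k = ∑_a x_a^k / k!`, it is `∑_k f_k k! ch_k`. -/
def additiveClass (g : CurvedLInfinity B I deg) (f : PowerSeries ℂ) :
    GSeries gr (formDeg (ceDeg deg)) :=
  GSeries.formalSum fun k : ℕ => (PowerSeries.coeff k f * (k.factorial : ℂ)) • g.ch k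

end CurvedLInfinity

end LInfinity

/-! ### The power series of the Todd class and of the A-hat class -/

/-- The formal logarithm of a power series with constant term `1`. -/
def logSeries (f : PowerSeries ℂ) : PowerSeries ℂ := (PowerSeries.log ℂ).subst (f - 1)

/-- `Q(x) = x / (1 - e^{-x})`, the inverse of `∑ (-1)^n x^n / (n+1)!`. -/
def toddSeries : PowerSeries ℂ :=
  (PowerSeries.mk fun n => (-1 : ℂ) ^ n / ((n + 1).factorial : ℂ))⁻¹

/-- `P(x) = (x/2) / sinh(x/2)`, the inverse of `∑_{n even} (x/2)^n / (n+1)!`. -/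
def aHatSeries : PowerSeries ℂ :=
  (PowerSeries.mk fun n => if Even n then (1 / 2 : ℂ) ^ n / ((n + 1).factorial : ℂ) else 0)⁻¹

/-- The characteristic class `log (e^{-c_1/2} Td)` of `T_{Bg}`, that of `log Q(x) - x/2`. -/
def CurvedLInfinity.logTdClass {R : Type*} [Ring R] [Algebra ℂ R] {gr : ℤ → Submodule ℂ R}
    [GradedAlgebra gr] {r : ℕ} {B : CDGA gr} {I : TwoSidedIdeal R} {deg : Fin r → ℤ}
    (g : CurvedLInfinity B I deg) : GSeries gr (formDeg (ceDeg deg)) :=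
  g.additiveClass (logSeries toddSeries - PowerSeries.C (1 / 2 : ℂ) * PowerSeries.X)

/-- The characteristic class `log Â` of `T_{Bg}`, that of `log P(x)`. -/
def CurvedLInfinity.logAHatClass {R : Type*} [Ring R] [Algebra ℂ R] {gr : ℤ → Submodule ℂ R}
    [GradedAlgebra gr] {r : ℕ} {B : CDGA gr} {I : TwoSidedIdeal R} {deg : Fin r → ℤ}
    (g : CurvedLInfinity B I deg) : GSeries gr (formDeg (ceDeg deg)) :=
  g.additiveClass (logSeries aHatSeries)

/-! ### The propagator on the circle of length `len` -/

/-- The kernel `k_t(x - y)` of the heat operator of `-d²/dx²` on functions on `ℝ / len ℤ`, with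
respect to `dy`, expanded in the eigenfunctions `e^{2πikx/len}`. -/
def heatKernel (len t x : ℝ) : ℂ :=
  (1 / (len : ℂ)) * ∑' k : ℤ, Complex.exp (-((t * (2 * Real.pi * k / len) ^ 2 : ℝ) : ℂ)) *
    Complex.exp (2 * Real.pi * Complex.I * k * x / len)

/-- The analytic factor of the propagator `P_ε^L = ∫_ε^L (d^* ⊗ 1) K_t dt`. As
`K_t = k_t(x - y) (dx ⊗ 1 - 1 ⊗ dy) ⊗ Cas`, it is a function (0-form in `x` and in `y`) of
`x - y`. -/
def propagator (len ε L x : ℝ) : ℂ :=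
  ∫ t in ε..L, deriv (fun y : ℝ => heatKernel len t y) x

/-! ### The Chern-Simons interaction and its one-loop Feynman weights -/

section Feynman

variable {R : Type*} [Ring R] [Algebra ℂ R] {gr : ℤ → Submodule ℂ R} [GradedAlgebra gr] {r : ℕ}

/-- Degrees of the coordinates on `(g ⊕ g^∨[-2])[1] = g[1] ⊕ g^∨[-1]`: the pair `(0, i)` stands
for the coordinate `α_i` on `g[1]` and `(1, i)` for the dual coordinate `β_i` on `g^∨[-1]`. -/
def cotDeg (deg : Fin r → ℤ) (p : Fin 2 ×ₗ Fin r) : ℤ :=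
  if (ofLex p).1 = 0 then 1 - deg (ofLex p).2 else deg (ofLex p).2 - 1

/-- Coordinates of the value `φ⁰ + dx φ¹` of a field `φ ∈ Ω^*(S¹) ⊗ (g[1] ⊕ g^∨[-1])` at one point
of the circle; the first index is the form degree. Since `dx` has degree one the degrees are those
of `Ω^{-*}(T^*Bg)`. -/
abbrev fieldDeg (deg : Fin r → ℤ) : Fin 2 ×ₗ (Fin 2 ×ₗ Fin r) → ℤ := formDeg (cotDeg deg)

/-- Degrees of the coordinates of the values of a field at `n` points. -/
def multiDeg (deg : Fin r → ℤ) (n : ℕ) (p : Fin n ×ₗ (Fin 2 ×ₗ (Fin 2 ×ₗ Fin r))) : ℤ :=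
  fieldDeg deg (ofLex p).2

variable {B : CDGA gr} {I : TwoSidedIdeal R} {deg : Fin r → ℤ}

/-- The function `∑_n ⟨β, ℓ_n(α, …, α)⟩ / n! = ∑_i β_i (dξ_i)(α)` on `g[1] ⊕ g^∨[-1]`. -/
def CurvedLInfinity.hamiltonian (g : CurvedLInfinity B I deg) : GSeries gr (cotDeg deg) :=
  ∑ i, GSeries.X gr (cotDeg deg) (toLex (1, i)) *
    (g.q i).eval fun j => GSeries.X gr (cotDeg deg) (toLex (0, j))

/-- The Lagrangian density of the interaction `I_CS(φ) = ∫_{S¹} ∑_n ⟨β, ℓ_n(α, …, α)⟩ / n!`: the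
coefficient of `dx` in the value of the Hamiltonian on `φ⁰ + dx φ¹`, which is `∑_a φ¹_a ∂_a`
applied to it. Only the cubic and higher part enters, as genus zero vertices of stable graphs have
valence at least three. -/
def CurvedLInfinity.lagrangian (g : CurvedLInfinity B I deg) : GSeries gr (fieldDeg deg) :=
  (deRham (toForm g.hamiltonian)).cubicAndHigher

/-- The contraction of the Casimir `Id_g ∈ g[1] ⊗ g^∨[-1]` with the `α`-input of the vertex `v`
and the `β`-input of the vertex `w`. The propagator is a 0-form, so only the 0-form components of
the fields are involved. -/
def casimir {n : ℕ} (v w : Fin n) (F : GSeries gr (multiDeg deg n)) :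
    GSeries gr (multiDeg deg n) :=
  ∑ i : Fin r, (F.pderiv (toLex (w, toLex (0, toLex (1, i))))).pderiv
    (toLex (v, toLex (0, toLex (0, i))))

/-- A graph with `n` labelled vertices and `n` labelled directed edges; the edge `e` joins the
`α`-input of the vertex `(γ e).1` to the `β`-input of the vertex `(γ e).2`. A connected graph of
this kind has exactly one loop. -/
abbrev LabelledGraph (n : ℕ) : Type := Fin n → Fin n × Fin n

/-- Connectedness (and non-emptiness) of the graph. -/
def LabelledGraph.IsConnected {n : ℕ} (γ : LabelledGraph n) : Prop :=
  (SimpleGraph.fromRel fun v w => ∃ e, γ e = (v, w)).Connected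

/-- The tensor contraction prescribed by a graph: put the Lagrangian at each vertex, contract with
the Casimir along each edge. The result is a function of the values of the external field at the
vertices: its Taylor expansion distributes the tails. -/
def CurvedLInfinity.contraction (g : CurvedLInfinity B I deg) {n : ℕ} (γ : LabelledGraph n) :
    GSeries gr (multiDeg deg n) :=
  (List.ofFn γ).foldr (fun e F => casimir e.1 e.2 F)
    (List.ofFn fun v : Fin n =>
      g.lagrangian.eval fun s => GSeries.X gr (multiDeg deg n) (toLex (v, s))).prod

variable {τ : Type*} [Fintype τ] [LinearOrder τ] {deg' : τ → ℤ}

/-- The integrand, at positions `x_v` of the vertices, of the weight of a graph on a field `Φ`. The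
field is a family with parameters: its components are functions on the circle with values in
a graded-commutative power series algebra over `R`, such that the total degree is zero. -/
def CurvedLInfinity.weightIntegrand (g : CurvedLInfinity B I deg) (len ε L : ℝ) {n : ℕ}
    (γ : LabelledGraph n) (Φ : Fin 2 ×ₗ (Fin 2 ×ₗ Fin r) → ℝ → GSeries gr deg')
    (x : Fin n → ℝ) : GSeries gr deg' :=
  (∏ e, propagator len ε L (x (γ e).1 - x (γ e).2)) •
    (g.contraction γ).eval fun p => Φ (ofLex p).2 (x (ofLex p).1)

/-- The weight `W_γ(P_ε^L, I_CS)(Φ)`. It is integrated weakly: `m` is a monomial in the parameters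
of the field and `l` a linear functional on `R`, and the number is the image under `l` of the
coefficient of `m` in the weight. -/
def CurvedLInfinity.weight (g : CurvedLInfinity B I deg) (len ε L : ℝ) {n : ℕ}
    (γ : LabelledGraph n) (Φ : Fin 2 ×ₗ (Fin 2 ×ₗ Fin r) → ℝ → GSeries gr deg')
    (m : τ →₀ ℕ) (l : R →ₗ[ℂ] ℂ) : ℂ :=
  ∫ x in Set.pi Set.univ fun _ : Fin n => Set.Ioc (0 : ℝ) len,
    l ((g.weightIntegrand len ε L γ Φ x).coeff m)

open Classical in
/-- The sum `∑_γ W_γ(P_ε^L, I_CS)(Φ) / |Aut γ|` over all connected one-loop graphs. An isomorphism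
class of directed graphs with `n` vertices and `n` edges has `n! n! / |Aut γ|` labellings, so
it is the sum over labelled graphs divided by `n! n!`; the two orientations of an edge are
the two summands of `Cas = Id_g + Id_{g^∨}`, and the permutations of tails at a vertex are accounted
for by the factorials in the Taylor expansion of the interaction. For every monomial `m` only
finitely many `n` contribute. -/
def CurvedLInfinity.oneLoop (g : CurvedLInfinity B I deg) (len ε L : ℝ)
    (Φ : Fin 2 ×ₗ (Fin 2 ×ₗ Fin r) → ℝ → GSeries gr deg')
    (m : τ →₀ ℕ) (l : R →ₗ[ℂ] ℂ) : ℂ :=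
  ∑' n : ℕ, (1 / ((n.factorial : ℂ) * (n.factorial : ℂ))) *
    ∑ γ ∈ Finset.univ.filter fun γ : LabelledGraph n => γ.IsConnected,
      g.weight len ε L γ Φ m l

/-- `W` is the value `I^{(1)}[∞](Φ)`: for every `L` the limit `I^{(1)}[L](Φ)` as `ε → 0` of the
one-loop sum exists, and it tends to `W` as `L → ∞`, in the weak topology. -/
def CurvedLInfinity.IsOneLoopInfinity (g : CurvedLInfinity B I deg) (len : ℝ)
    (Φ : Fin 2 ×ₗ (Fin 2 ×ₗ Fin r) → ℝ → GSeries gr deg') (W : GSeries gr deg') : Prop :=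
  ∀ (m : τ →₀ ℕ) (l : R →ₗ[ℂ] ℂ), ∃ J : ℝ → ℂ,
    (∀ L : ℝ, 0 < L → Filter.Tendsto (fun ε => g.oneLoop len ε L Φ m l)
      (nhdsWithin 0 (Set.Ioi 0)) (nhds (J L))) ∧
    Filter.Tendsto J Filter.atTop (nhds (l (W.coeff m)))

/-- The universal harmonic field `φ⁰ + dz φ¹ ∈ ℂ[dz] ⊗ (g[1] ⊕ g^∨[-1])`, with
`dz = dx / (2πi len)`. Its coordinates `φ⁰`, `φ¹` are those of `Ω^{-*}(T^*Bg)`: a functional is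
restricted to the harmonic fields by evaluating it on this field. -/
def harmonicField (gr : ℤ → Submodule ℂ R) [GradedAlgebra gr] (deg : Fin r → ℤ) (len : ℝ)
    (s : Fin 2 ×ₗ (Fin 2 ×ₗ Fin r)) (_x : ℝ) : GSeries gr (fieldDeg deg) :=
  if (ofLex s).1 = 0 then GSeries.X gr (fieldDeg deg) s
  else (1 / (2 * (Real.pi : ℂ) * Complex.I * len)) • GSeries.X gr (fieldDeg deg) s

/-- The inclusion `Ω^{-*}(Bg) ⊆ Ω^{-*}(T^*Bg)`, as forms in the `α_i` and `dα_i` only. -/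
def pullbackForm (F : GSeries gr (formDeg (ceDeg deg))) : GSeries gr (fieldDeg deg) :=
  F.eval fun p => GSeries.X gr (fieldDeg deg) (toLex ((ofLex p).1, toLex (0, (ofLex p).2)))

end Feynman

end

end ChernSimons

/-! The Lagrangian is linear in the coordinates `β`, `dβ`, while every edge of a graph consumes one
`β`-input at its head. The graphs have as many edges as vertices, so a non-zero contraction forces
every vertex to be the head of exactly one edge (`contraction_eq_zero`). Harmonic fields are
constant on the circle, hence a weight is an integral of propagators times an algebraic contraction
(`weight_harmonicField`). If some vertex is not the tail of any edge, its position enters a single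
propagator, whose mean over the circle is zero (`integral_prod_edges_eq_zero`). Thus only directed
cycles survive. For n ≥ 2 there are n!(n-1)! labelled ones with n vertices, so division by n!²
leaves 1/n.

Algebra: the mixed second derivative of the Lagrangian in `α_i` and `β_k` is, up to sign, the
pulled-back entry (i, k) of the Atiyah matrix (`lagrangian_pderiv_pderiv`). Truncation to cubic
terms does not affect it, because it is linear in the differentials. Around a cycle the Casimirs
multiply these matrices and close the product to a graded trace, so a cycle gives (-1/(2πi len))^n
Tr(At^n), the scalar coming from dz = dx/(2πi len).

Analysis: the propagator is a convolution kernel with Fourier coefficients c_k = i(e^{-ελ_k} -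
e^{-Lλ_k})/(2πk), with c_0 = 0. The cyclic integral is therefore the trace of an operator power, ∑_k
(len c_k)^n. It vanishes for odd n because c_{-k} = -c_k. For n ≥ 2 its terms are bounded by a
multiple of |k|^{-n} independently of ε and L, so dominated convergence applies and for even n the
limit is 2ζ(n)(len i/2π)^n. Together with 1/n and the normalization of ch_n this gives the
coefficient 2(n-1)!ζ(n)/(2πi)^n.

A monomial contains a definite number of differentials and Tr(At^n) contains exactly n, so for each
coefficient a single n matters and the sum over graphs raises no question of convergence.

Characteristic classes: Q(1 - e^{-x}) = x yields x(log Q)' = 1 + x - Q. Since Q generates the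
Bernoulli numbers, Euler's formula for ζ(2k) identifies the coefficients; the A-hat form follows
from Q = P e^{x/2}.

The identities for graded power series are reduced to constants and left multiplication by variables
through `ext_of_generators`, which is where the Koszul signs are checked. -/

namespace ChernSimons

noncomputable section

/-! ### Signs and the parity automorphism -/

/-- The parity of an integer, as a natural number. -/
def pr (k : ℤ) : ℕ := if Odd k then 1 else 0

theorem pr_odd {k : ℤ} (h : Odd k) : pr k = 1 := if_pos h
theorem pr_not_odd {k : ℤ} (h : ¬ Odd k) : pr k = 0 := if_neg h

/-- Working with a natural exponent lets `pr` serve both as a power of -1 and as a power of the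
parity automorphism. -/
theorem negOnePow_eq_pr (k : ℤ) : (((Int.negOnePow k : ℤˣ) : ℤ) : ℂ) = (-1 : ℂ) ^ pr k := by
  by_cases h : Odd k
  · simp [pr_odd h, Int.negOnePow_odd k h]
  · simp [pr_not_odd h, Int.negOnePow_even k (Int.not_odd_iff_even.1 h)]

theorem neg_one_pow_pr_add (k l : ℤ) : (-1 : ℂ) ^ pr (k + l) = (-1 : ℂ) ^ (pr k + pr l) := by
  rw [← negOnePow_eq_pr, pow_add, ← negOnePow_eq_pr, ← negOnePow_eq_pr, Int.negOnePow_add]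
  push_cast
  rfl

theorem neg_one_pow_pr_sub (k l : ℤ) : (-1 : ℂ) ^ pr (k - l) = (-1 : ℂ) ^ (pr k + pr l) := by
  rw [← negOnePow_eq_pr, pow_add, ← negOnePow_eq_pr, ← negOnePow_eq_pr, Int.negOnePow_sub]
  push_cast
  rfl

theorem neg_one_pow_pr_mul (k l : ℤ) : (-1 : ℂ) ^ pr (k * l) = (-1 : ℂ) ^ (pr k * pr l) := by
  by_cases hk : Odd k <;> by_cases hl : Odd l <;> simp [pr, hk, hl, Int.odd_mul]

section Parity

variable {R : Type*} [Ring R] [Algebra ℂ R] {gr : ℤ → Submodule ℂ R} [GradedAlgebra gr]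

theorem parityHom_of_mem {i : ℤ} {a : R} (ha : a ∈ gr i) :
    parityHom gr a = (-1 : ℂ) ^ pr i • a := by
  rw [← negOnePow_eq_pr]
  unfold parityHom
  have h : DirectSum.decomposeAlgEquiv gr a = DirectSum.of (fun i => gr i) i ⟨a, ha⟩ :=
    DirectSum.decompose_of_mem gr ha
  simp only [AlgHom.comp_apply, AlgEquiv.coe_toAlgHom, h]
  refine (DirectSum.toSemiring_of (A := fun i => gr i) (fun i => LinearMap.toAddMonoidHom
    ((((Int.negOnePow i : ℤˣ) : ℤ) : ℂ) • (gr i).subtype)) ?_ ?_ i ⟨a, ha⟩)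
  · change (((Int.negOnePow 0 : ℤˣ) : ℤ) : ℂ) • (1 : R) = 1
    simp
  · intro i j a b
    change (((Int.negOnePow (i + j) : ℤˣ) : ℤ) : ℂ) • ((a : R) * (b : R)) =
      ((((Int.negOnePow i : ℤˣ) : ℤ) : ℂ) • (a : R)) *
        ((((Int.negOnePow j : ℤˣ) : ℤ) : ℂ) • (b : R))
    rw [Int.negOnePow_add, smul_mul_smul_comm]
    push_cast
    rfl

theorem parityHom_parityHom (a : R) : parityHom gr (parityHom gr a) = a := by
  induction a using DirectSum.Decomposition.inductionOn gr with
  | zero => simp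
  | @homogeneous i a =>
    rw [parityHom_of_mem a.2, map_smul, parityHom_of_mem a.2, smul_smul, ← pow_add, ← two_mul]
    simp
  | add a b ha hb => rw [map_add, map_add, ha, hb]

/-- The parity automorphism is an involution, so its powers depend only on the parity of the
exponent, which the sign records. -/
theorem parityHom_pow_eq {i j : ℕ} (h : (-1 : ℂ) ^ i = (-1 : ℂ) ^ j) :
    parityHom gr ^ i = parityHom gr ^ j := by
  have key : ∀ k : ℕ, parityHom gr ^ (2 * k) = 1 := fun k => by
    rw [pow_mul, pow_two]
    have : parityHom gr * parityHom gr = 1 := AlgHom.ext fun a => parityHom_parityHom a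
    rw [this, one_pow]
  rcases Nat.even_or_odd' i with ⟨k, rfl | rfl⟩ <;> rcases Nat.even_or_odd' j with ⟨l, rfl | rfl⟩
  · rw [key, key]
  · norm_num [pow_succ, pow_mul] at h
  · norm_num [pow_succ, pow_mul] at h
  · rw [pow_succ, pow_succ, key, key]

/-- Graded commutativity. -/
class GradedComm (gr : ℤ → Submodule ℂ R) : Prop where
  comm : ∀ (i j : ℤ) (a b : R), a ∈ gr i → b ∈ gr j →
    a * b = (((Int.negOnePow (i * j) : ℤˣ) : ℤ) : ℂ) • (b * a)

/-- The sign is absorbed in the parity automorphism applied to `b`, so that `b` need not be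
homogeneous. -/
theorem GradedComm.mem_mul [GradedComm gr] {i : ℤ} {a : R} (ha : a ∈ gr i) (b : R) :
    a * b = (parityHom gr ^ pr i) b * a := by
  induction b using DirectSum.Decomposition.inductionOn gr with
  | zero => simp
  | @homogeneous j b =>
    rw [GradedComm.comm i j a b ha b.2, negOnePow_eq_pr, neg_one_pow_pr_mul]
    by_cases hi : Odd i
    · rw [pr_odd hi, pow_one, parityHom_of_mem b.2, one_mul, smul_mul_assoc]
    · simp [pr_not_odd hi]
  | add b c hb hc => rw [mul_add, hb, hc, map_add, add_mul]

/-- An element of definite parity need not be homogeneous. The rule holds for every a' + (-1)^i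
parity(a'): on a homogeneous a' this expression is either zero or 2a'. For `a` itself it equals 2a,
and 2 is invertible. -/
theorem GradedComm.mul_of_parity [GradedComm gr] {i : ℕ} {a : R}
    (ha : parityHom gr a = (-1 : ℂ) ^ i • a) (b : R) :
    a * b = (parityHom gr ^ i) b * a := by
  have h : ∀ a' : R, (a' + (-1 : ℂ) ^ i • parityHom gr a') * b =
      (parityHom gr ^ i) b * (a' + (-1 : ℂ) ^ i • parityHom gr a') := by
    intro a'
    induction a' using DirectSum.Decomposition.inductionOn gr with
    | zero => simp
    | @homogeneous j c =>
      rw [parityHom_of_mem c.2, smul_smul, ← pow_add]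
      by_cases hij : (-1 : ℂ) ^ i = (-1 : ℂ) ^ pr j
      · have := GradedComm.mem_mul c.2 b
        rw [parityHom_pow_eq hij, add_mul, mul_add, smul_mul_assoc, mul_smul_comm, this]
      · have : (-1 : ℂ) ^ (i + pr j) = -1 := by
          rw [pow_add]
          rcases neg_one_pow_eq_or ℂ i with h1 | h1 <;>
            rcases neg_one_pow_eq_or ℂ (pr j) with h2 | h2 <;> simp_all
        rw [this]
        simp
    | add c e hc he =>
      have : c + e + (-1 : ℂ) ^ i • parityHom gr (c + e) =
          (c + (-1 : ℂ) ^ i • parityHom gr c) + (e + (-1 : ℂ) ^ i • parityHom gr e) := by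
        rw [map_add, smul_add]; abel
      rw [this, add_mul, hc, he, ← mul_add]
  have h2 := h a
  rw [ha, smul_smul, ← pow_add, ← two_mul, pow_mul] at h2
  simp only [even_two, Even.neg_pow, one_pow, one_smul] at h2
  rw [← two_smul ℂ a, smul_mul_assoc, mul_smul_comm] at h2
  exact smul_right_injective R (two_ne_zero (α := ℂ)) h2

end Parity

/-! ### Signs of monomials -/

section MonomialSigns

variable {σ : Type*} [Fintype σ]

/-- The size of a monomial. -/
def msize (m : σ →₀ ℕ) : ℕ := ∑ s, m s

theorem msize_add (m n : σ →₀ ℕ) : msize (m + n) = msize m + msize n := by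
  simp [msize, Finset.sum_add_distrib]

theorem msize_single (s : σ) (k : ℕ) : msize (Finsupp.single s k) = k := by
  classical
  simp [msize, Finsupp.single_apply]

theorem msize_zero : msize (0 : σ →₀ ℕ) = 0 := by simp [msize]

theorem eq_zero_of_msize {m : σ →₀ ℕ} (h : msize m = 0) : m = 0 := by
  ext s
  exact (Finset.sum_eq_zero_iff.1 h) s (Finset.mem_univ s)

theorem oddCount_single (deg : σ → ℤ) (s : σ) : oddCount deg (Finsupp.single s 1) = pr (deg s) := by
  classical
  unfold oddCount
  rw [Finset.sum_eq_single s]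
  · simp [pr]
  · intro b _ hb
    simp [hb.symm]
  · simp

variable [LinearOrder σ]

/-- The number of odd letters of `ξ^m` preceding `ξ_s`. -/
def below (deg : σ → ℤ) (s : σ) (m : σ →₀ ℕ) : ℕ :=
  ∑ t, if t < s ∧ Odd (deg t) then m t else 0

theorem below_add (deg : σ → ℤ) (s : σ) (m n : σ →₀ ℕ) :
    below deg s (m + n) = below deg s m + below deg s n := by
  unfold below
  rw [← Finset.sum_add_distrib]
  refine Finset.sum_congr rfl fun s _ => ?_
  split_ifs <;> simp

theorem below_single (deg : σ → ℤ) (s t : σ) :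
    below deg s (Finsupp.single t 1) = if t < s then pr (deg t) else 0 := by
  unfold below
  rw [Finset.sum_eq_single t]
  · by_cases h1 : t < s <;> by_cases h2 : Odd (deg t) <;> simp [pr, h1, h2]
  · intro b _ hb
    simp [hb.symm]
  · simp

theorem koszul_single_left (deg : σ → ℤ) (s : σ) (m : σ →₀ ℕ) :
    koszul deg (Finsupp.single s 1) m = pr (deg s) * below deg s m := by
  unfold koszul below
  rw [Finset.sum_eq_single s]
  · rw [Finset.mul_sum]
    refine Finset.sum_congr rfl fun t _ => ?_
    by_cases h1 : t < s <;> by_cases h2 : Odd (deg t) <;> by_cases h3 : Odd (deg s) <;>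
      simp [pr, h1, h2, h3]
  · intro b _ hb
    simp [hb.symm]
  · simp

/-- Pairs of distinct odd letters are counted once on each side. The diagonal pairs on the right
contribute m_s n_s, which vanishes because an odd letter occurs at most once in `m + n`; this is
where admissibility enters. -/
theorem koszul_swap (deg : σ → ℤ) {m n : σ →₀ ℕ} (h : Admissible deg (m + n)) :
    koszul deg m n + koszul deg n m = oddCount deg m * oddCount deg n := by
  unfold koszul oddCount
  rw [Finset.sum_comm (f := fun s t => if t < s ∧ Odd (deg s) ∧ Odd (deg t) then n s * m t else 0),
    ← Finset.sum_add_distrib, Finset.sum_mul_sum]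
  refine Finset.sum_congr rfl fun s _ => ?_
  rw [← Finset.sum_add_distrib]
  refine Finset.sum_congr rfl fun t _ => ?_
  by_cases h1 : Odd (deg s) <;> by_cases h2 : Odd (deg t) <;> simp only [h1, h2, and_true,
    and_false, if_true, if_false, mul_zero, zero_mul, add_zero]
  rcases lt_trichotomy s t with hst | rfl | hst
  · simp [hst, hst.not_gt, mul_comm]
  · have := h s h1
    simp only [Finsupp.add_apply] at this
    have : m s = 0 ∨ n s = 0 := by omega
    rcases this with h | h <;> simp [h]
  · simp [hst, hst.not_gt]

end MonomialSigns

end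

end ChernSimons

/-! ### Graded-commutative power series: supercommutativity, filtration, generation by monomials -/

namespace ChernSimons

set_option linter.unusedSectionVars false

noncomputable section

namespace GSeries

variable {R : Type*} [Ring R] [Algebra ℂ R] {gr : ℤ → Submodule ℂ R} {σ : Type*} {deg : σ → ℤ}

/-! ### Coefficients -/

/-- The coefficient of a monomial as a linear map. -/
def coeffHom (m : σ →₀ ℕ) : GSeries gr deg →ₗ[ℂ] R where
  toFun F := F.coeff m
  map_add' F G := coeff_add F G m
  map_smul' c F := coeff_smul c F m

theorem coeff_sum {ι : Type*} (S : Finset ι) (F : ι → GSeries gr deg) (m : σ →₀ ℕ) :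
    (∑ i ∈ S, F i).coeff m = ∑ i ∈ S, (F i).coeff m :=
  map_sum (coeffHom (gr := gr) (deg := deg) m) F S

theorem coeff_sub (F G : GSeries gr deg) (m : σ →₀ ℕ) :
    (F - G).coeff m = F.coeff m - G.coeff m :=
  map_sub (coeffHom (gr := gr) (deg := deg) m) F G

theorem admissible_single (deg : σ → ℤ) (s : σ) : Admissible deg (Finsupp.single s 1) :=
  fun t _ => by
    classical
    rw [Finsupp.single_apply]
    split_ifs <;> simp

section

variable [DecidableEq σ]

theorem coeff_C_zero (a : R) : (C gr deg a).coeff 0 = a := by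
  rw [C, coeff_ofFun _ (admissible_zero deg), if_pos rfl]

theorem coeff_C_of_ne (a : R) {m : σ →₀ ℕ} (hm : m ≠ 0) : (C gr deg a).coeff m = 0 := by
  by_cases h : Admissible deg m
  · rw [C, coeff_ofFun _ h, if_neg hm]
  · exact coeff_eq_zero _ _ h

theorem coeff_X_single (s : σ) : (X gr deg s).coeff (Finsupp.single s 1) = 1 := by
  rw [X, coeff_ofFun _ (admissible_single deg s), if_pos rfl]

theorem coeff_X_of_ne {s : σ} {m : σ →₀ ℕ} (hm : m ≠ Finsupp.single s 1) :
    (X gr deg s).coeff m = 0 := by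
  by_cases h : Admissible deg m
  · rw [X, coeff_ofFun _ h, if_neg hm]
  · exact coeff_eq_zero _ _ h

theorem C_zero : C gr deg (0 : R) = 0 := by
  ext m
  by_cases h : m = 0
  · subst h; simp only [coeff_zero, coeff_C_zero]
  · simp only [coeff_zero, coeff_C_of_ne _ h]

theorem C_smul (c : ℂ) (a : R) : C gr deg (c • a) = c • C gr deg a := by
  ext m
  by_cases h : m = 0
  · subst h; simp only [coeff_smul, coeff_C_zero]
  · simp only [coeff_smul, coeff_C_of_ne _ h, smul_zero]

end

variable [GradedAlgebra gr] [Fintype σ] [LinearOrder σ]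

instance instAlgebra : Algebra ℂ (GSeries gr deg) :=
  Algebra.ofModule
    (fun c F G => ext_adm fun p hp => by
      rw [coeff_smul, coeff_mul _ _ hp, coeff_mul _ _ hp, Finset.smul_sum]
      refine Finset.sum_congr rfl fun q _ => ?_
      rw [coeff_smul, smul_mul_assoc, smul_comm])
    (fun c F G => ext_adm fun p hp => by
      rw [coeff_smul, coeff_mul _ _ hp, coeff_mul _ _ hp, Finset.smul_sum]
      refine Finset.sum_congr rfl fun q _ => ?_
      rw [coeff_smul, map_smul, mul_smul_comm, smul_comm])

theorem coeff_C_mul [D : DecidableEq σ] (a : R) (G : GSeries gr deg) (p : σ →₀ ℕ) :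
    (C gr deg a * G).coeff p = a * G.coeff p := by
  -- The product is built on the decidable equality of the linear order; an arbitrary instance is
  -- replaced by that one.
  obtain rfl : D = fun a b => LinearOrder.toDecidableEq a b := Subsingleton.elim _ _
  by_cases hp : Admissible deg p
  · rw [coeff_mul _ _ hp, Finset.sum_eq_single (0, p)]
    · simp [coeff_C_zero, koszul_zero_left, oddCount_zero]
    · rintro ⟨u, v⟩ huv hne
      have hu : u ≠ 0 := by
        rintro rfl
        exact hne (by simpa using Finset.HasAntidiagonal.mem_antidiagonal.1 huv)
      simp [coeff_C_of_ne _ hu]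
    · intro h
      exact absurd (Finset.HasAntidiagonal.mem_antidiagonal.2 (zero_add p)) h
  · rw [coeff_eq_zero _ _ hp, coeff_eq_zero _ _ hp, mul_zero]

theorem C_one [DecidableEq σ] : C gr deg (1 : R) = 1 := by
  refine ext_adm fun m hm => ?_
  rw [coeff_one hm]
  split_ifs with h
  · rw [h, coeff_C_zero]
  · rw [coeff_C_of_ne _ h]

theorem coeff_X_mul_add [D : DecidableEq σ] (s : σ) (G : GSeries gr deg) {m : σ →₀ ℕ}
    (h : Admissible deg (m + Finsupp.single s 1)) :
    (X gr deg s * G).coeff (m + Finsupp.single s 1) =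
      (-1 : ℂ) ^ (pr (deg s) * below deg s m) • (parityHom gr ^ pr (deg s)) (G.coeff m) := by
  obtain rfl : D = fun a b => LinearOrder.toDecidableEq a b := Subsingleton.elim _ _
  rw [coeff_mul _ _ h, Finset.sum_eq_single (Finsupp.single s 1, m)]
  · simp only [coeff_X_single, koszul_single_left, oddCount_single, one_mul]
  · rintro ⟨u, v⟩ huv hne
    have hu : u ≠ Finsupp.single s 1 := by
      rintro rfl
      have := Finset.HasAntidiagonal.mem_antidiagonal.1 huv
      rw [add_comm] at this
      exact hne (by simpa using this)
    simp [coeff_X_of_ne hu]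
  · intro h
    exact absurd (Finset.HasAntidiagonal.mem_antidiagonal.2 (add_comm _ _)) h

theorem coeff_X_mul_of_eq_zero [D : DecidableEq σ] {s : σ} (G : GSeries gr deg) {m : σ →₀ ℕ}
    (h : m s = 0) : (X gr deg s * G).coeff m = 0 := by
  obtain rfl : D = fun a b => LinearOrder.toDecidableEq a b := Subsingleton.elim _ _
  by_cases hm : Admissible deg m
  · rw [coeff_mul _ _ hm]
    refine Finset.sum_eq_zero ?_
    rintro ⟨u, v⟩ huv
    have hu : u ≠ Finsupp.single s 1 := by
      rintro rfl
      have := Finset.HasAntidiagonal.mem_antidiagonal.1 huv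
      rw [← this] at h
      simp at h
    simp [coeff_X_of_ne hu]
  · exact coeff_eq_zero _ _ hm

theorem exists_eq_add_single {s : σ} {m : σ →₀ ℕ} (h : m s ≠ 0) :
    ∃ n : σ →₀ ℕ, m = n + Finsupp.single s 1 := by
  refine ⟨m - Finsupp.single s 1, (tsub_add_cancel_of_le ?_).symm⟩
  rw [Finsupp.single_le_iff]
  omega

/-! ### Parity -/

theorem coeff_parity (F : GSeries gr deg) (m : σ →₀ ℕ) :
    F.parity.coeff m = (-1 : ℂ) ^ oddCount deg m • parityHom gr (F.coeff m) := by
  by_cases hm : Admissible deg m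
  · exact coeff_ofFun _ hm
  · rw [coeff_eq_zero _ _ hm, coeff_eq_zero _ _ hm, map_zero, smul_zero]

theorem parity_C [DecidableEq σ] (a : R) :
    (C gr deg a).parity = C gr deg (parityHom gr a) := by
  ext m
  rw [coeff_parity]
  by_cases h : m = 0
  · subst h; simp [coeff_C_zero, oddCount_zero]
  · simp [coeff_C_of_ne _ h]

/-- The parity automorphism as an algebra homomorphism. -/
def parityAlg : GSeries gr deg →ₐ[ℂ] GSeries gr deg :=
  AlgHom.ofLinearMap
    { toFun := parity
      map_add' := fun F G => by
        ext m; simp only [coeff_parity, coeff_add, map_add, smul_add]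
      map_smul' := fun c F => by
        ext m; simp only [coeff_parity, coeff_smul, map_smul, RingHom.id_apply, smul_comm c] }
    (by
      change (1 : GSeries gr deg).parity = 1
      rw [← C_one, parity_C, map_one])
    (fun F G => by
      change (F * G).parity = F.parity * G.parity
      refine ext_adm fun p hp => ?_
      rw [coeff_parity, coeff_mul _ _ hp, coeff_mul _ _ hp, map_sum, Finset.smul_sum]
      refine Finset.sum_congr rfl fun q hq => ?_
      rw [← Finset.HasAntidiagonal.mem_antidiagonal.1 hq, coeff_parity, coeff_parity, map_smul,
        map_smul, map_mul, oddCount_add, smul_mul_assoc, mul_smul_comm, smul_smul, smul_smul,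
        smul_smul, ← pow_add, ← pow_add, ← pow_add, ← AlgHom.mul_apply, ← AlgHom.mul_apply,
        ← pow_succ, ← pow_succ']
      congr 2
      ring)

theorem parityAlg_apply (F : GSeries gr deg) : parityAlg F = F.parity := rfl

theorem parity_mul (F G : GSeries gr deg) : (F * G).parity = F.parity * G.parity :=
  map_mul parityAlg F G

theorem parity_add (F G : GSeries gr deg) : (F + G).parity = F.parity + G.parity :=
  map_add parityAlg F G

theorem parity_smul (c : ℂ) (F : GSeries gr deg) : (c • F).parity = c • F.parity :=
  map_smul parityAlg c F

theorem parity_zero : (0 : GSeries gr deg).parity = 0 := map_zero parityAlg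

theorem parity_X [DecidableEq σ] (s : σ) :
    (X gr deg s).parity = (-1 : ℂ) ^ pr (deg s) • X gr deg s := by
  ext m
  rw [coeff_parity, coeff_smul]
  by_cases h : m = Finsupp.single s 1
  · subst h; simp [coeff_X_single, oddCount_single]
  · simp [coeff_X_of_ne h]

/-- The series is even or odd, according to the parity of `i`. -/
def HasParity (i : ℕ) (F : GSeries gr deg) : Prop := F.parity = (-1 : ℂ) ^ i • F

theorem HasParity.mul {i j : ℕ} {F G : GSeries gr deg} (hF : HasParity i F) (hG : HasParity j G) :
    HasParity (i + j) (F * G) := by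
  unfold HasParity at *
  rw [parity_mul, hF, hG, smul_mul_smul_comm, pow_add]

theorem HasParity.smul {i : ℕ} {F : GSeries gr deg} (hF : HasParity i F) (c : ℂ) :
    HasParity i (c • F) := by
  unfold HasParity at *
  rw [parity_smul, hF, smul_comm]

theorem HasParity.zero (i : ℕ) : HasParity i (0 : GSeries gr deg) := by
  rw [HasParity, parity_zero, smul_zero]

theorem HasParity.add {i : ℕ} {F G : GSeries gr deg} (hF : HasParity i F) (hG : HasParity i G) :
    HasParity i (F + G) := by
  unfold HasParity at *
  rw [parity_add, hF, hG, smul_add]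

theorem HasParity.sum {ι : Type*} {i : ℕ} {S : Finset ι} {F : ι → GSeries gr deg}
    (hF : ∀ k ∈ S, HasParity i (F k)) : HasParity i (∑ k ∈ S, F k) :=
  Finset.sum_induction _ (HasParity i) (fun _ _ => HasParity.add) (HasParity.zero i) hF

theorem HasParity.congr {i j : ℕ} {F : GSeries gr deg} (hF : HasParity i F)
    (h : (-1 : ℂ) ^ i = (-1 : ℂ) ^ j) : HasParity j F := by
  rw [HasParity, ← h]; exact hF

theorem HasParity.one : HasParity 0 (1 : GSeries gr deg) := by
  rw [HasParity, pow_zero, one_smul]; exact map_one parityAlg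

theorem HasParity.parityAlg_pow {i : ℕ} {F : GSeries gr deg} (hF : HasParity i F) (k : ℕ) :
    (parityAlg ^ k) F = (-1 : ℂ) ^ (k * i) • F := by
  induction k with
  | zero => simp
  | succ k ih =>
    rw [pow_succ', AlgHom.mul_apply, ih, map_smul, parityAlg_apply, hF, smul_smul, ← pow_add,
      add_mul, one_mul]

theorem HasParity.pow {i : ℕ} {F : GSeries gr deg} (hF : HasParity i F) (k : ℕ) :
    HasParity (i * k) (F ^ k) := by
  induction k with
  | zero => simpa using HasParity.one
  | succ k ih => rw [pow_succ]; exact ih.mul hF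

theorem coeff_parityAlg_pow (k : ℕ) (F : GSeries gr deg) (m : σ →₀ ℕ) :
    ((parityAlg ^ k) F).coeff m =
      (-1 : ℂ) ^ (k * oddCount deg m) • (parityHom gr ^ k) (F.coeff m) := by
  induction k with
  | zero => simp
  | succ k ih =>
    rw [pow_succ', AlgHom.mul_apply, parityAlg_apply, coeff_parity, ih, map_smul, smul_smul,
      ← pow_add, pow_succ', AlgHom.mul_apply]
    congr 2
    ring

/-- A series of definite parity supercommutes with every series. -/
theorem HasParity.mul_eq [GradedComm gr] {i : ℕ} {F : GSeries gr deg} (hF : HasParity i F)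
    (G : GSeries gr deg) : F * G = (parityAlg ^ i) G * F := by
  refine ext_adm fun p hp => ?_
  rw [coeff_mul _ _ hp, coeff_mul _ _ hp]
  refine Finset.sum_nbij' Prod.swap Prod.swap ?_ ?_ ?_ ?_ ?_
  · rintro ⟨m, n⟩ h
    simpa [Finset.HasAntidiagonal.mem_antidiagonal, add_comm] using h
  · rintro ⟨m, n⟩ h
    simpa [Finset.HasAntidiagonal.mem_antidiagonal, add_comm] using h
  · rintro ⟨m, n⟩ _; rfl
  · rintro ⟨m, n⟩ _; rfl
  · rintro ⟨m, n⟩ h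
    have hmn : m + n = p := Finset.HasAntidiagonal.mem_antidiagonal.1 h
    -- A coefficient of a series of parity `i` has itself the parity of `i` plus the number of odd
    -- letters of its monomial.
    have hF' : parityHom gr (F.coeff m) = (-1 : ℂ) ^ (i + oddCount deg m) • F.coeff m := by
      have := congrArg (fun H => H.coeff m) hF
      simp only [coeff_parity, coeff_smul] at this
      rw [pow_add, mul_comm, mul_smul, ← this, smul_smul, ← pow_add, ← two_mul]
      simp
    have hpow : ∀ k : ℕ, (parityHom gr ^ k) (F.coeff m) =
        (-1 : ℂ) ^ (k * (i + oddCount deg m)) • F.coeff m := by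
      intro k
      induction k with
      | zero => simp
      | succ k ih =>
        rw [pow_succ', AlgHom.mul_apply, ih, map_smul, hF', smul_smul, ← pow_add, add_mul, one_mul]
    simp only [Prod.swap]
    rw [GradedComm.mul_of_parity hF', coeff_parityAlg_pow, hpow, smul_mul_smul_comm, smul_smul,
      ← AlgHom.mul_apply, ← pow_add,
      parityHom_pow_eq (i := i + oddCount deg m + oddCount deg m) (j := i)
        (by rw [add_assoc, pow_add, ← two_mul, pow_mul]; simp)]
    congr 1
    have hs := koszul_swap deg (hmn ▸ hp : Admissible deg (m + n))
    have h1 : (-1 : ℂ) ^ koszul deg m n =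
        (-1 : ℂ) ^ koszul deg n m * (-1 : ℂ) ^ (oddCount deg m * oddCount deg n) := by
      rw [← hs, ← pow_add, ← add_assoc, add_right_comm, pow_add _ (_ + _), ← two_mul, pow_mul]
      simp
    rw [h1]
    congr 1
    rw [← pow_add]
    -- The remaining exponents agree up to an even number.
    rw [show i * oddCount deg n + oddCount deg n * (i + oddCount deg m) =
      2 * (i * oddCount deg n) + oddCount deg m * oddCount deg n by ring, pow_add, pow_mul]
    simp

theorem HasParity.mul_comm [GradedComm gr] {i j : ℕ} {F G : GSeries gr deg} (hF : HasParity i F)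
    (hG : HasParity j G) : F * G = (-1 : ℂ) ^ (i * j) • (G * F) := by
  rw [hF.mul_eq, hG.parityAlg_pow, smul_mul_assoc]

theorem HasParity.commute [GradedComm gr] {F : GSeries gr deg} (hF : HasParity 0 F)
    (G : GSeries gr deg) : Commute F G := by
  have := hF.mul_eq G
  rwa [pow_zero] at this

theorem HasParity.sq_eq_zero [GradedComm gr] {F : GSeries gr deg} (hF : HasParity 1 F) :
    F * F = 0 := by
  have h := hF.mul_comm hF
  rw [mul_one, pow_one, neg_one_smul, eq_neg_iff_add_eq_zero, ← two_smul ℂ] at h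
  exact (smul_eq_zero.1 h).resolve_left two_ne_zero

/-! ### The filtration by polynomial degree -/

/-- The series has no terms of polynomial degree less than `N`. -/
def Fil (N : ℕ) (F : GSeries gr deg) : Prop := ∀ m, msize m < N → F.coeff m = 0

theorem Fil.mono {M N : ℕ} (h : M ≤ N) {F : GSeries gr deg} (hF : Fil N F) : Fil M F :=
  fun m hm => hF m (hm.trans_le h)

theorem Fil.zero_left (F : GSeries gr deg) : Fil 0 F := fun _ hm => absurd hm (Nat.not_lt_zero _)

theorem Fil.mul {M N : ℕ} {F G : GSeries gr deg} (hF : Fil M F) (hG : Fil N G) :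
    Fil (M + N) (F * G) := by
  intro p hp
  by_cases hadm : Admissible deg p
  · rw [coeff_mul _ _ hadm]
    refine Finset.sum_eq_zero fun q hq => ?_
    rw [← Finset.HasAntidiagonal.mem_antidiagonal.1 hq, msize_add] at hp
    by_cases h : msize q.1 < M
    · rw [hF _ h, zero_mul, smul_zero]
    · rw [hG q.2 (by omega), map_zero, mul_zero, smul_zero]
  · exact coeff_eq_zero _ _ hadm

/-- The map is continuous for the filtration topology, with bounded loss of degree. -/
def Filtered {τ : Type*} [Fintype τ] {deg' : τ → ℤ} (f : GSeries gr deg → GSeries gr deg') : Prop :=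
  ∃ k, ∀ N F, Fil (N + k) F → Fil N (f F)

section FilteredLemmas

variable {τ : Type*} [Fintype τ] [LinearOrder τ] {deg' : τ → ℤ}
  {υ : Type*} [Fintype υ] {deg'' : υ → ℤ}

theorem Filtered.comp {f : GSeries gr deg' → GSeries gr deg''} {g : GSeries gr deg → GSeries gr deg'}
    (hf : Filtered f) (hg : Filtered g) : Filtered fun F => f (g F) := by
  obtain ⟨k, hk⟩ := hf
  obtain ⟨l, hl⟩ := hg
  exact ⟨k + l, fun N F hF => hk _ _ (hl _ _ (by rwa [add_assoc]))⟩

theorem Filtered.id : Filtered fun F : GSeries gr deg => F := ⟨0, fun _ _ h => h⟩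

theorem Filtered.const_mul {f : GSeries gr deg → GSeries gr deg'} (hf : Filtered f)
    (A : GSeries gr deg') : Filtered fun F => A * f F := by
  obtain ⟨k, hk⟩ := hf
  exact ⟨k, fun N F hF => by simpa using (Fil.zero_left A).mul (hk N F hF)⟩

theorem Filtered.mul_const {f : GSeries gr deg → GSeries gr deg'} (hf : Filtered f)
    (A : GSeries gr deg') : Filtered fun F => f F * A := by
  obtain ⟨k, hk⟩ := hf
  exact ⟨k, fun N F hF => by simpa using (hk N F hF).mul (Fil.zero_left A)⟩

theorem Filtered.add {f g : GSeries gr deg → GSeries gr deg'} (hf : Filtered f) (hg : Filtered g) :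
    Filtered fun F => f F + g F := by
  obtain ⟨k, hk⟩ := hf
  obtain ⟨l, hl⟩ := hg
  refine ⟨k + l, fun N F hF m hm => ?_⟩
  rw [coeff_add, hk N F (hF.mono (by omega)) m hm, hl N F (hF.mono (by omega)) m hm, add_zero]

theorem Filtered.smul {f : GSeries gr deg → GSeries gr deg'} (hf : Filtered f) (c : ℂ) :
    Filtered fun F => c • f F := by
  obtain ⟨k, hk⟩ := hf
  exact ⟨k, fun N F hF m hm => by rw [coeff_smul, hk N F hF m hm, smul_zero]⟩

theorem Filtered.zero : Filtered fun _ : GSeries gr deg => (0 : GSeries gr deg') :=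
  ⟨0, fun _ _ _ _ _ => rfl⟩

theorem Filtered.parity : Filtered (parity : GSeries gr deg → GSeries gr deg) :=
  ⟨0, fun N F hF m hm => by rw [coeff_parity, hF m (by simpa using hm), map_zero, smul_zero]⟩

theorem Filtered.parityAlg_pow (k : ℕ) :
    Filtered fun F : GSeries gr deg => (parityAlg ^ k) F :=
  ⟨0, fun N F hF m hm => by
    rw [coeff_parityAlg_pow, hF m (by simpa using hm), map_zero, smul_zero]⟩

end FilteredLemmas

/-! ### Monomials generate -/

open Classical in
/-- The monomial `a ξ^m`. -/
def monomial (m : σ →₀ ℕ) (a : R) : GSeries gr deg :=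
  ofFun gr deg fun p => if p = m then a else 0

theorem coeff_monomial_self {m : σ →₀ ℕ} (hm : Admissible deg m) (a : R) :
    (monomial m a : GSeries gr deg).coeff m = a := by
  rw [monomial, coeff_ofFun _ hm, if_pos rfl]

theorem coeff_monomial_of_ne {m p : σ →₀ ℕ} (h : p ≠ m) (a : R) :
    (monomial m a : GSeries gr deg).coeff p = 0 := by
  by_cases hp : Admissible deg p
  · rw [monomial, coeff_ofFun _ hp, if_neg h]
  · exact coeff_eq_zero _ _ hp

theorem monomial_zero_eq_C [DecidableEq σ] (a : R) : (monomial 0 a : GSeries gr deg) = C gr deg a := by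
  ext m
  by_cases h : m = 0
  · subst h; rw [coeff_monomial_self (admissible_zero deg), coeff_C_zero]
  · rw [coeff_monomial_of_ne h, coeff_C_of_ne _ h]

theorem parityHom_pow_pow (k : ℕ) (a : R) :
    (parityHom gr ^ k) ((parityHom gr ^ k) a) = a := by
  rw [← AlgHom.mul_apply, ← pow_add,
    parityHom_pow_eq (i := k + k) (j := 0) (by rw [← two_mul, pow_mul]; simp)]
  rfl

theorem X_mul_monomial [DecidableEq σ] (s : σ) {m : σ →₀ ℕ}
    (h : Admissible deg (m + Finsupp.single s 1)) (a : R) :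
    X gr deg s * monomial m a = monomial (m + Finsupp.single s 1)
      ((-1 : ℂ) ^ (pr (deg s) * below deg s m) • (parityHom gr ^ pr (deg s)) a) := by
  ext p
  by_cases hp : p s = 0
  · rw [coeff_X_mul_of_eq_zero _ hp, coeff_monomial_of_ne]
    rintro rfl
    simp at hp
  · obtain ⟨n, rfl⟩ := exists_eq_add_single hp
    by_cases hadm : Admissible deg (n + Finsupp.single s 1)
    · rw [coeff_X_mul_add _ _ hadm]
      by_cases hn : n = m
      · subst hn
        rw [coeff_monomial_self h.of_add_left, coeff_monomial_self h]
      · rw [coeff_monomial_of_ne hn, coeff_monomial_of_ne (by simpa using hn), map_zero, smul_zero]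
    · rw [coeff_eq_zero _ _ hadm, coeff_eq_zero _ _ hadm]

theorem X_mul_monomial_eq_zero [DecidableEq σ] (s : σ) {m : σ →₀ ℕ}
    (h : ¬ Admissible deg (m + Finsupp.single s 1)) (a : R) :
    X gr deg s * monomial m a = 0 := by
  ext p
  rw [coeff_zero]
  by_cases hp : p s = 0
  · rw [coeff_X_mul_of_eq_zero _ hp]
  · obtain ⟨n, rfl⟩ := exists_eq_add_single hp
    by_cases hadm : Admissible deg (n + Finsupp.single s 1)
    · rw [coeff_X_mul_add _ _ hadm, coeff_monomial_of_ne (by rintro rfl; exact h hadm), map_zero,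
        smul_zero]
    · rw [coeff_eq_zero _ _ hadm]

/-- The exponents which are at most `N` in every variable. -/
def box (σ : Type*) [Fintype σ] [DecidableEq σ] (N : ℕ) : Finset (σ →₀ ℕ) :=
  Finset.Iic (Finsupp.equivFunOnFinite.symm fun _ => N)

theorem mem_box [DecidableEq σ] {m : σ →₀ ℕ} {N : ℕ} (h : msize m ≤ N) : m ∈ box σ N := by
  rw [box, Finset.mem_Iic]
  intro s
  have : m s ≤ msize m := Finset.single_le_sum (f := fun s => m s) (fun _ _ => Nat.zero_le _)
    (Finset.mem_univ s)
  simp only [Finsupp.equivFunOnFinite_symm_apply_apply]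
  omega

/-- Two continuous additive maps which agree on monomials are equal. -/
theorem ext_of_monomials {τ : Type*} [Fintype τ] {deg' : τ → ℤ}
    {f g : GSeries gr deg → GSeries gr deg'} (hf : Filtered f) (hg : Filtered g)
    (hfa : ∀ F G, f (F + G) = f F + f G) (hga : ∀ F G, g (F + G) = g F + g G)
    (hmono : ∀ m : σ →₀ ℕ, Admissible deg m → ∀ a : R, f (monomial m a) = g (monomial m a))
    (F : GSeries gr deg) : f F = g F := by
  obtain ⟨k, hk⟩ := hf
  obtain ⟨l, hl⟩ := hg
  let fA : GSeries gr deg →+ GSeries gr deg' := AddMonoidHom.mk' f hfa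
  let gA : GSeries gr deg →+ GSeries gr deg' := AddMonoidHom.mk' g hga
  ext p
  -- Large enough for the loss of degree of both maps: each sends the tail `F - P` to a series
  -- without coefficient at `p`.
  let N := msize p + 1 + (k + l)
  let P : GSeries gr deg := ∑ m ∈ box σ N, monomial m (F.coeff m)
  have hP : Fil N (F - P) := by
    intro m hm
    rw [coeff_sub, coeff_sum, Finset.sum_eq_single m]
    · by_cases hadm : Admissible deg m
      · rw [coeff_monomial_self hadm, sub_self]
      · rw [coeff_eq_zero _ _ hadm, coeff_eq_zero _ _ hadm, sub_self]
    · intro n _ hn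
      exact coeff_monomial_of_ne hn.symm _
    · exact fun h => absurd (mem_box hm.le) h
  have h1 : fA P = gA P := by
    simp only [P, map_sum]
    refine Finset.sum_congr rfl fun m _ => ?_
    by_cases hadm : Admissible deg m
    · exact hmono m hadm _
    · have : monomial m (F.coeff m) = (0 : GSeries gr deg) := by
        refine ext_adm fun q hq => ?_
        rw [coeff_monomial_of_ne (by rintro rfl; exact hadm hq)]
        rfl
      rw [this, map_zero, map_zero]
  have h2 : (fA (F - P)).coeff p = 0 :=
    hk (msize p + 1) _ (hP.mono (by omega)) p (Nat.lt_succ_self _)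
  have h3 : (gA (F - P)).coeff p = 0 :=
    hl (msize p + 1) _ (hP.mono (by omega)) p (Nat.lt_succ_self _)
  rw [map_sub, coeff_sub, sub_eq_zero] at h2 h3
  change (fA F).coeff p = (gA F).coeff p
  rw [h2, h3, h1]

/-- Two continuous additive maps which agree on constants and are compatible with left
multiplication by the variables are equal. -/
theorem ext_of_generators {τ : Type*} [Fintype τ] {deg' : τ → ℤ} [DecidableEq σ]
    {f g : GSeries gr deg → GSeries gr deg'} (hf : Filtered f) (hg : Filtered g)
    (hfa : ∀ F G, f (F + G) = f F + f G) (hga : ∀ F G, g (F + G) = g F + g G)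
    (hC : ∀ a, f (C gr deg a) = g (C gr deg a))
    (hX : ∀ s F, f F = g F → f (X gr deg s * F) = g (X gr deg s * F)) (F : GSeries gr deg) :
    f F = g F := by
  refine ext_of_monomials hf hg hfa hga ?_ F
  suffices hmono : ∀ N : ℕ, ∀ m : σ →₀ ℕ, msize m = N → Admissible deg m → ∀ a : R,
      f (monomial m a) = g (monomial m a) from fun m hm a => hmono _ m rfl hm a
  intro N
  induction N with
  | zero =>
    intro m hm _ a
    rw [eq_zero_of_msize hm, monomial_zero_eq_C, hC]
  | succ N ih =>
    intro m hm hadm a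
    obtain ⟨s, hs⟩ : ∃ s, m s ≠ 0 := by
      by_contra! h
      rw [msize, Finset.sum_eq_zero fun s _ => h s] at hm
      omega
    obtain ⟨n, rfl⟩ := exists_eq_add_single hs
    rw [msize_add, msize_single] at hm
    -- The coefficient is twisted in advance by the sign and the automorphism that ξ_s produces;
    -- both are involutive, so the product is exactly a ξ^m.
    have := X_mul_monomial (gr := gr) s hadm ((-1 : ℂ) ^ (pr (deg s) * below deg s n) •
      (parityHom gr ^ pr (deg s)) a)
    have e : (-1 : ℂ) ^ (pr (deg s) * below deg s n) • (parityHom gr ^ pr (deg s))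
        ((-1 : ℂ) ^ (pr (deg s) * below deg s n) • (parityHom gr ^ pr (deg s)) a) = a := by
      rw [map_smul, smul_smul, ← pow_add, parityHom_pow_pow, ← two_mul, pow_mul]
      simp
    rw [e] at this
    rw [← this]
    exact hX _ _ (ih n (by omega) hadm.of_add_left _)

end GSeries

end

end ChernSimons

/-! ### Graded derivations along the variables -/

namespace ChernSimons

set_option linter.unusedSectionVars false

noncomputable section

namespace GSeries

variable {R : Type*} [Ring R] [Algebra ℂ R] {gr : ℤ → Submodule ℂ R} {σ : Type*} {deg : σ → ℤ}
  [GradedAlgebra gr] [Fintype σ] [LinearOrder σ]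

/-! ### Partial derivatives -/

theorem coeff_pderiv_odd {s : σ} (hs : Odd (deg s)) (F : GSeries gr deg) (m : σ →₀ ℕ) :
    (F.pderiv s).coeff m =
      (-1 : ℂ) ^ below deg s m • parityHom gr (F.coeff (m + Finsupp.single s 1)) := by
  by_cases hm : Admissible deg m
  · rw [pderiv, coeff_ofFun _ hm, if_pos hs]
    rfl
  · rw [coeff_eq_zero _ _ hm, coeff_eq_zero _ _ fun h => hm h.of_add_left, map_zero, smul_zero]

theorem coeff_pderiv_even {s : σ} (hs : ¬ Odd (deg s)) (F : GSeries gr deg) (m : σ →₀ ℕ) :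
    (F.pderiv s).coeff m = ((m s : ℂ) + 1) • F.coeff (m + Finsupp.single s 1) := by
  by_cases hm : Admissible deg m
  · rw [pderiv, coeff_ofFun _ hm, if_neg hs]
  · rw [coeff_eq_zero _ _ hm, coeff_eq_zero _ _ fun h => hm h.of_add_left, smul_zero]

theorem pderiv_add (s : σ) (F G : GSeries gr deg) :
    (F + G).pderiv s = F.pderiv s + G.pderiv s := by
  ext m
  by_cases hs : Odd (deg s)
  · simp only [coeff_pderiv_odd hs, coeff_add, map_add, smul_add]
  · simp only [coeff_pderiv_even hs, coeff_add, smul_add]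

theorem pderiv_smul (s : σ) (c : ℂ) (F : GSeries gr deg) :
    (c • F).pderiv s = c • F.pderiv s := by
  ext m
  by_cases hs : Odd (deg s)
  · simp only [coeff_pderiv_odd hs, coeff_smul, map_smul, smul_comm c]
  · simp only [coeff_pderiv_even hs, coeff_smul, smul_comm c]

/-- The partial derivative as a linear map. -/
def pderivHom (s : σ) : GSeries gr deg →ₗ[ℂ] GSeries gr deg where
  toFun := pderiv s
  map_add' := pderiv_add s
  map_smul' := pderiv_smul s

theorem pderiv_zero (s : σ) : (0 : GSeries gr deg).pderiv s = 0 := map_zero (pderivHom s)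

theorem pderiv_sum {ι : Type*} (s : σ) (S : Finset ι) (F : ι → GSeries gr deg) :
    (∑ i ∈ S, F i).pderiv s = ∑ i ∈ S, (F i).pderiv s := map_sum (pderivHom s) F S

theorem Filtered.pderiv (s : σ) : Filtered fun F : GSeries gr deg => F.pderiv s := by
  refine ⟨1, fun N F hF m hm => ?_⟩
  have : F.coeff (m + Finsupp.single s 1) = 0 := hF _ (by rw [msize_add, msize_single]; omega)
  by_cases hs : Odd (deg s)
  · rw [coeff_pderiv_odd hs, this, map_zero, smul_zero]
  · rw [coeff_pderiv_even hs, this, smul_zero]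

theorem pderiv_C_mul [DecidableEq σ] (s : σ) (a : R) (F : GSeries gr deg) :
    (C gr deg a * F).pderiv s = C gr deg ((parityHom gr ^ pr (deg s)) a) * F.pderiv s := by
  ext m
  by_cases hs : Odd (deg s)
  · rw [coeff_C_mul, coeff_pderiv_odd hs, coeff_pderiv_odd hs, coeff_C_mul, map_mul, pr_odd hs,
      pow_one, mul_smul_comm]
  · rw [coeff_C_mul, coeff_pderiv_even hs, coeff_pderiv_even hs, coeff_C_mul, pr_not_odd hs,
      pow_zero, mul_smul_comm]
    rfl

theorem pderiv_C [DecidableEq σ] (s : σ) (a : R) : (C gr deg a).pderiv s = 0 := by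
  ext m
  have : m + Finsupp.single s 1 ≠ 0 := fun h => by
    have := DFunLike.congr_fun h s
    simp at this
  by_cases hs : Odd (deg s)
  · rw [coeff_pderiv_odd hs, coeff_C_of_ne _ this, map_zero, smul_zero, coeff_zero]
  · rw [coeff_pderiv_even hs, coeff_C_of_ne _ this, smul_zero, coeff_zero]

theorem pderiv_one (s : σ) : (1 : GSeries gr deg).pderiv s = 0 := pderiv_C s 1

/-- The canonical (anti)commutation relation of ∂_s and ξ_u. It is the only place where the ordering
of the letters is inspected for derivatives; Leibniz, commutation and parity of derivatives follow
from it on generators. -/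
theorem pderiv_X_mul [DecidableEq σ] (s u : σ) (F : GSeries gr deg) :
    (X gr deg u * F).pderiv s = (if s = u then F else 0) +
      (-1 : ℂ) ^ (pr (deg s) * pr (deg u)) • (X gr deg u * F.pderiv s) := by
  refine ext_adm fun m hm => ?_
  rw [coeff_add, coeff_smul]
  by_cases hs : Odd (deg s)
  · rw [coeff_pderiv_odd hs, pr_odd hs, one_mul]
    by_cases hsu : s = u
    · subst hsu
      rw [if_pos rfl, pr_odd hs]
      by_cases hms : m s = 0
      · rw [coeff_X_mul_of_eq_zero _ hms]
        have hadm : Admissible deg (m + Finsupp.single s 1) := fun t ht => by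
          have := hm t ht
          rw [Finsupp.add_apply, Finsupp.single_apply]
          split_ifs with h
          · subst h; omega
          · omega
        rw [coeff_X_mul_add _ _ hadm, pr_odd hs, map_smul, smul_smul, ← pow_add, pow_one,
          parityHom_parityHom, one_mul, ← two_mul, pow_mul]
        simp
      · obtain ⟨n, rfl⟩ := exists_eq_add_single hms
        -- Here ξ_s already divides the monomial: the left side vanishes because ξ_s² = 0, and the
        -- two terms on the right cancel.
        have hnot : ¬ Admissible deg (n + Finsupp.single s 1 + Finsupp.single s 1) := fun h => by
          have := h s hs
          simp at this
        rw [coeff_eq_zero _ _ hnot, coeff_X_mul_add _ _ hm, coeff_pderiv_odd hs, pr_odd hs,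
          map_smul, smul_smul, ← pow_add, pow_one, parityHom_parityHom, smul_smul, ← pow_add,
          map_zero, smul_zero, one_mul, add_assoc, ← two_mul, pow_add, pow_mul]
        simp
    · rw [if_neg hsu, coeff_zero, zero_add]
      by_cases hmu : m u = 0
      · rw [coeff_X_mul_of_eq_zero _ hmu, coeff_X_mul_of_eq_zero, map_zero, smul_zero, smul_zero]
        simp [hmu, hsu]
      · obtain ⟨n, rfl⟩ := exists_eq_add_single hmu
        rw [coeff_X_mul_add _ _ hm, coeff_pderiv_odd hs, add_right_comm n]
        by_cases hadm : Admissible deg (n + Finsupp.single s 1 + Finsupp.single u 1)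
        · rw [coeff_X_mul_add _ _ hadm]
          simp only [map_smul, smul_smul, below_add, below_single]
          rw [← AlgHom.mul_apply, ← AlgHom.mul_apply, ← pow_succ, ← pow_succ']
          congr 1
          by_cases hu : Odd (deg u)
          · rcases lt_or_gt_of_ne hsu with h | h
            · simp only [pr_odd hu, pr_odd hs, h, h.not_gt, if_true, if_false]; ring
            · simp only [pr_odd hu, pr_odd hs, h, h.not_gt, if_true, if_false]; ring
          · simp [pr_not_odd hu]
        · rw [coeff_eq_zero _ _ hadm]
          -- Since n + u is admissible and n + s + u is not, the odd letter s already occurs in n,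
          -- so n + s is inadmissible as well.
          have : F.coeff (n + Finsupp.single s 1) = 0 := by
            refine coeff_eq_zero _ _ fun h => hadm fun t ht => ?_
            have h1 := h t ht
            have h2 := hm t ht
            by_cases htu : u = t
            · subst htu
              simp only [Finsupp.add_apply, Finsupp.single_apply, if_neg hsu] at h2 ⊢
              omega
            · simp only [Finsupp.add_apply, Finsupp.single_apply, if_neg htu] at h1 ⊢
              omega
          rw [this]
          simp
  · rw [coeff_pderiv_even hs, pr_not_odd hs, zero_mul, pow_zero, one_smul]
    by_cases hsu : s = u
    · subst hsu
      rw [if_pos rfl]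
      have hadm : Admissible deg (m + Finsupp.single s 1) := fun t ht => by
        have := hm t ht
        have hst : s ≠ t := by rintro rfl; exact hs ht
        rwa [Finsupp.add_apply, Finsupp.single_apply, if_neg hst, add_zero]
      rw [coeff_X_mul_add _ _ hadm, pr_not_odd hs, zero_mul, pow_zero, one_smul, pow_zero]
      by_cases hms : m s = 0
      · rw [coeff_X_mul_of_eq_zero _ hms, hms]
        simp
      · obtain ⟨n, rfl⟩ := exists_eq_add_single hms
        rw [coeff_X_mul_add _ _ hm, coeff_pderiv_even hs, pr_not_odd hs, zero_mul, pow_zero,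
          pow_zero]
        simp only [AlgHom.one_apply, one_smul, Finsupp.add_apply, Finsupp.single_eq_same,
          Nat.cast_add, Nat.cast_one, add_smul]
        abel
    · rw [if_neg hsu, coeff_zero, zero_add]
      by_cases hmu : m u = 0
      · rw [coeff_X_mul_of_eq_zero _ hmu, coeff_X_mul_of_eq_zero, smul_zero]
        simp [hmu, hsu]
      · obtain ⟨n, rfl⟩ := exists_eq_add_single hmu
        have hadm : Admissible deg (n + Finsupp.single s 1 + Finsupp.single u 1) := fun t ht => by
          have := hm t ht
          have hst : s ≠ t := by rintro rfl; exact hs ht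
          simp only [Finsupp.add_apply, Finsupp.single_apply, if_neg hst] at this ⊢
          omega
        rw [coeff_X_mul_add _ _ hm, coeff_pderiv_even hs, add_right_comm n,
          coeff_X_mul_add _ _ hadm, map_smul, smul_smul, smul_smul, below_add, below_single]
        have : (n + Finsupp.single u 1 : σ →₀ ℕ) s = n s := by
          simp [Ne.symm hsu]
        rw [this, pr_not_odd hs, ite_self, add_zero, _root_.mul_comm]

theorem HasParity.X [DecidableEq σ] (s : σ) : HasParity (pr (deg s)) (X gr deg s) := parity_X s

theorem parityAlg_pow_X [DecidableEq σ] (k : ℕ) (u : σ) :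
    (parityAlg ^ k) (X gr deg u) = (-1 : ℂ) ^ (k * pr (deg u)) • X gr deg u :=
  (HasParity.X u).parityAlg_pow k

theorem parityAlg_pow_C [DecidableEq σ] (k : ℕ) (a : R) :
    (parityAlg ^ k) (C gr deg a) = C gr deg ((parityHom gr ^ k) a) := by
  induction k with
  | zero => rfl
  | succ k ih => rw [pow_succ', AlgHom.mul_apply, ih, parityAlg_apply, parity_C, pow_succ',
      AlgHom.mul_apply]

/-- The graded Leibniz rule. -/
theorem pderiv_mul (s : σ) (F G : GSeries gr deg) :
    (F * G).pderiv s = F.pderiv s * G + (parityAlg ^ pr (deg s)) F * G.pderiv s := by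
  refine ext_of_generators (f := fun F => (F * G).pderiv s)
    (g := fun F => F.pderiv s * G + (parityAlg ^ pr (deg s)) F * G.pderiv s)
    ((Filtered.pderiv s).comp (Filtered.id.mul_const G))
    (((Filtered.pderiv s).mul_const G).add ((Filtered.parityAlg_pow _).mul_const _))
    (fun F H => ?_) (fun F H => ?_) (fun a => ?_) (fun u F hF => ?_) F
  · simp only [add_mul, pderiv_add]
  · simp only [add_mul, pderiv_add, map_add]; abel
  · simp only [pderiv_C_mul, pderiv_C, zero_mul, zero_add, parityAlg_pow_C]
  · beta_reduce at hF ⊢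
    rw [mul_assoc, pderiv_X_mul, hF, pderiv_X_mul, map_mul, parityAlg_pow_X, mul_add, smul_add,
      add_mul, smul_mul_assoc, smul_mul_assoc, smul_mul_assoc, ← mul_assoc, ← mul_assoc, add_assoc]
    congr 1
    split_ifs
    · rfl
    · rw [zero_mul]

/-- Partial derivatives supercommute. -/
theorem pderiv_comm (s t : σ) (F : GSeries gr deg) :
    (F.pderiv s).pderiv t = (-1 : ℂ) ^ (pr (deg s) * pr (deg t)) • (F.pderiv t).pderiv s := by
  refine ext_of_generators (f := fun F => (F.pderiv s).pderiv t)
    (g := fun F => (-1 : ℂ) ^ (pr (deg s) * pr (deg t)) • (F.pderiv t).pderiv s)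
    ((Filtered.pderiv t).comp (Filtered.pderiv s))
    (((Filtered.pderiv s).comp (Filtered.pderiv t)).smul _)
    (fun F H => ?_) (fun F H => ?_) (fun a => ?_) (fun u F hF => ?_) F
  · simp only [pderiv_add]
  · simp only [pderiv_add, smul_add]
  · simp only [pderiv_C, pderiv_zero, smul_zero]
  · beta_reduce at hF ⊢
    simp only [pderiv_X_mul, pderiv_add, pderiv_smul, hF, smul_add, mul_smul_comm, smul_smul]
    have e : ∀ k : ℕ, (-1 : ℂ) ^ k * (-1 : ℂ) ^ k = 1 := fun k => by
      rw [← pow_add, ← two_mul, pow_mul]; simp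
    have h1 : ((if s = u then F else 0 : GSeries gr deg)).pderiv t =
        if s = u then F.pderiv t else 0 := by
      split_ifs <;> simp [pderiv_zero]
    have h2 : ((if t = u then F else 0 : GSeries gr deg)).pderiv s =
        if t = u then F.pderiv s else 0 := by
      split_ifs <;> simp [pderiv_zero]
    have h3 : (-1 : ℂ) ^ (pr (deg s) * pr (deg u)) • (if t = u then F.pderiv s else 0) =
        (-1 : ℂ) ^ (pr (deg s) * pr (deg t)) • (if t = u then F.pderiv s else 0) := by
      split_ifs with h
      · rw [h]
      · simp
    have h4 : ((-1 : ℂ) ^ (pr (deg s) * pr (deg t)) * (-1 : ℂ) ^ (pr (deg t) * pr (deg u))) •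
        (if s = u then F.pderiv t else 0) = if s = u then F.pderiv t else 0 := by
      split_ifs with h
      · rw [h, _root_.mul_comm (pr (deg t)), e, one_smul]
      · simp
    rw [h1, h2, h3, h4]
    have h5 : (-1 : ℂ) ^ (pr (deg s) * pr (deg u)) *
        ((-1 : ℂ) ^ (pr (deg t) * pr (deg u)) * (-1 : ℂ) ^ (pr (deg s) * pr (deg t))) =
      (-1 : ℂ) ^ (pr (deg s) * pr (deg t)) * ((-1 : ℂ) ^ (pr (deg t) * pr (deg u)) *
        (-1 : ℂ) ^ (pr (deg s) * pr (deg u))) := by ring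
    rw [h5]
    abel

theorem parity_pderiv (s : σ) (F : GSeries gr deg) :
    (F.pderiv s).parity = (-1 : ℂ) ^ pr (deg s) • F.parity.pderiv s := by
  refine ext_of_generators (f := fun F => (F.pderiv s).parity)
    (g := fun F => (-1 : ℂ) ^ pr (deg s) • F.parity.pderiv s)
    (Filtered.parity.comp (Filtered.pderiv s))
    (((Filtered.pderiv s).comp Filtered.parity).smul _)
    (fun F H => ?_) (fun F H => ?_) (fun a => ?_) (fun u F hF => ?_) F
  · simp only [pderiv_add, parity_add]
  · simp only [pderiv_add, parity_add, smul_add]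
  · simp only [parity_C, pderiv_C, parity_zero, smul_zero]
  · beta_reduce at hF ⊢
    rw [pderiv_X_mul, parity_add, parity_smul, parity_mul, hF, parity_mul, parity_X,
      smul_mul_assoc, smul_mul_assoc, pderiv_smul, pderiv_X_mul]
    simp only [smul_add, smul_smul, mul_smul_comm]
    congr 1
    · split_ifs with h
      · rw [h, ← pow_add, ← two_mul, pow_mul]
        simp
      · simp [parity_zero]
    · congr 1
      ring

theorem HasParity.pderiv {i : ℕ} {F : GSeries gr deg} (hF : HasParity i F) (s : σ) :
    HasParity (pr (deg s) + i) (F.pderiv s) := by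
  unfold HasParity at *
  rw [parity_pderiv, hF, pderiv_smul, smul_smul, pow_add]

end GSeries

end

end ChernSimons

/-! ### Substitution homomorphisms, renaming of variables, and weights -/

namespace ChernSimons

set_option linter.unusedSectionVars false

noncomputable section

namespace GSeries

variable {R : Type*} [Ring R] [Algebra ℂ R] {gr : ℤ → Submodule ℂ R} {σ : Type*} {deg : σ → ℤ}
  [GradedAlgebra gr] [Fintype σ] [LinearOrder σ]
  {τ : Type*} [Fintype τ] [LinearOrder τ] {deg' : τ → ℤ}

/-! ### Substitutions -/

/-- Values of the variables of the right parity and without constant term. -/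
structure IsSubst (deg : σ → ℤ) (φ : σ → GSeries gr deg') : Prop where
  fil : ∀ s, Fil 1 (φ s)
  parity : ∀ s, HasParity (pr (deg s)) (φ s)

/-- The ordered product of the powers of a family. -/
def orderedProd (φ : σ → GSeries gr deg') (m : σ →₀ ℕ) : GSeries gr deg' :=
  ((Finset.univ.sort (· ≤ ·)).map fun s => φ s ^ m s).prod

theorem eval_eq_formalSum (φ : σ → GSeries gr deg') (F : GSeries gr deg) :
    F.eval φ = formalSum fun m : σ →₀ ℕ => C gr deg' (F.coeff m) * orderedProd φ m := rfl

theorem orderedProd_zero (φ : σ → GSeries gr deg') : orderedProd φ 0 = 1 := by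
  simp [orderedProd]

theorem sum_sort {M : Type*} [AddCommMonoid M] (f : σ → M) :
    ((Finset.univ.sort (· ≤ ·)).map f).sum = ∑ s, f s := by
  rw [← List.sum_toFinset f (Finset.sort_nodup _ _), Finset.sort_toFinset]

theorem list_fil {φ : σ → GSeries gr deg'} (hφ : ∀ s, Fil 1 (φ s)) (m : σ →₀ ℕ) (l : List σ) :
    Fil (l.map m).sum ((l.map fun s => φ s ^ m s).prod) := by
  have hpow : ∀ s k, Fil k (φ s ^ k) := fun s k => by
    induction k with
    | zero => exact Fil.zero_left _
    | succ k ih => rw [pow_succ]; exact ih.mul (hφ s)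
  induction l with
  | nil => exact Fil.zero_left _
  | cons s l ih =>
    simp only [List.map_cons, List.sum_cons, List.prod_cons]
    exact (hpow s _).mul ih

theorem orderedProd_fil {φ : σ → GSeries gr deg'} (hφ : ∀ s, Fil 1 (φ s)) (m : σ →₀ ℕ) :
    Fil (msize m) (orderedProd φ m) := by
  have := list_fil hφ m (Finset.univ.sort (· ≤ ·))
  rwa [sum_sort] at this

/-- φ_s travels through the sorted list, picks up a sign from each smaller odd letter, and stops at
its own place where it raises the exponent. Arbitrary sorted lists are allowed so that the induction
runs. -/
theorem mul_list_prod [GradedComm gr] {φ : σ → GSeries gr deg'}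
    (hφ : ∀ s, HasParity (pr (deg s)) (φ s)) (s : σ) (m : σ →₀ ℕ) (l : List σ)
    (hl : l.Pairwise (· < ·)) (hs : s ∈ l) :
    φ s * (l.map fun t => φ t ^ m t).prod =
      (-1 : ℂ) ^ (pr (deg s) * (l.map fun t => if t < s ∧ Odd (deg t) then m t else 0).sum) •
        (l.map fun t => φ t ^ (m + Finsupp.single s 1 : σ →₀ ℕ) t).prod := by
  induction l with
  | nil => simp at hs
  | cons t l ih =>
    rw [List.pairwise_cons] at hl
    simp only [List.map_cons, List.sum_cons, List.prod_cons]
    by_cases hts : t = s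
    · subst hts
      have h1 : (l.map fun u => if u < t ∧ Odd (deg u) then m u else 0).sum = 0 := by
        refine List.sum_eq_zero fun x hx => ?_
        obtain ⟨u, hu, rfl⟩ := List.mem_map.1 hx
        rw [if_neg]
        rintro ⟨h, _⟩
        exact absurd h (hl.1 u hu).not_gt
      have h2 : (l.map fun u => φ u ^ (m + Finsupp.single t 1 : σ →₀ ℕ) u) = l.map fun u => φ u ^ m u := by
        refine List.map_congr_left fun u hu => ?_
        have : t ≠ u := (hl.1 u hu).ne
        simp [this]
      rw [h1, h2]
      simp [pow_succ', mul_assoc]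
    · have hsl : s ∈ l := (List.mem_cons.1 hs).resolve_left (Ne.symm hts)
      have hlt : t < s := hl.1 s hsl
      rw [← mul_assoc, (hφ s).mul_comm ((hφ t).pow (m t)), smul_mul_assoc, mul_assoc,
        ih hl.2 hsl, mul_smul_comm, smul_smul, ← pow_add, ← mul_add]
      congr 2
      · congr 2
        by_cases ht : Odd (deg t)
        · simp [hlt, ht, pr_odd ht]
        · simp [ht, pr_not_odd ht]
      · simp [Ne.symm hts]

theorem mul_orderedProd [GradedComm gr] {φ : σ → GSeries gr deg'}
    (hφ : ∀ s, HasParity (pr (deg s)) (φ s)) (s : σ) (m : σ →₀ ℕ) :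
    φ s * orderedProd φ m = (-1 : ℂ) ^ (pr (deg s) * below deg s m) •
      orderedProd φ (m + Finsupp.single s 1) := by
  have := mul_list_prod hφ s m (Finset.univ.sort (· ≤ ·)) (Finset.sortedLT_sort _).pairwise
    ((Finset.mem_sort _).2 (Finset.mem_univ s))
  rwa [sum_sort] at this

/-- A repeated odd letter gives a factor φ_s² = 0. Hence monomials that vanish in the source also
have vanishing image, as needed for multiplicativity of substitution. -/
theorem orderedProd_eq_zero [GradedComm gr] {φ : σ → GSeries gr deg'}
    (hφ : ∀ s, HasParity (pr (deg s)) (φ s)) {m : σ →₀ ℕ} (hm : ¬ Admissible deg m) :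
    orderedProd φ m = 0 := by
  unfold Admissible at hm
  push Not at hm
  obtain ⟨s, hs, h⟩ := hm
  refine List.prod_eq_zero (List.mem_map.2 ⟨s, (Finset.mem_sort _).2 (Finset.mem_univ s), ?_⟩)
  obtain ⟨k, hk⟩ := Nat.exists_eq_add_of_lt h
  have h2 : φ s * φ s = 0 := HasParity.sq_eq_zero (by have := hφ s; rwa [pr_odd hs] at this)
  rw [hk, show 1 + k + 1 = 2 + k by ring, pow_add, pow_two, h2, zero_mul]

/-- The ordered product φ^m starts in degree at least |m|, so the formal sum is finite at each `p`.
The bound `N` is left free so that it can be chosen to contain a prescribed exponent. -/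
theorem coeff_eval {φ : σ → GSeries gr deg'} (hφ : ∀ s, Fil 1 (φ s)) (F : GSeries gr deg)
    {p : τ →₀ ℕ} (hp : Admissible deg' p) {N : ℕ} (hN : msize p ≤ N) :
    (F.eval φ).coeff p = ∑ m ∈ box σ N, F.coeff m * (orderedProd φ m).coeff p := by
  rw [eval_eq_formalSum, formalSum, coeff_ofFun _ hp]
  simp only [coeff_C_mul]
  refine finsum_eq_sum_of_support_subset _ fun m hm => ?_
  rw [Function.mem_support] at hm
  refine Finset.mem_coe.2 (mem_box ?_)
  by_contra h
  exact hm (by rw [orderedProd_fil hφ m p (by omega), mul_zero])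

theorem eval_add {φ : σ → GSeries gr deg'} (hφ : ∀ s, Fil 1 (φ s)) (F G : GSeries gr deg) :
    (F + G).eval φ = F.eval φ + G.eval φ := by
  refine ext_adm fun p hp => ?_
  rw [coeff_add, coeff_eval hφ _ hp le_rfl, coeff_eval hφ _ hp le_rfl, coeff_eval hφ _ hp le_rfl,
    ← Finset.sum_add_distrib]
  simp only [coeff_add, add_mul]

theorem eval_smul {φ : σ → GSeries gr deg'} (hφ : ∀ s, Fil 1 (φ s)) (c : ℂ) (F : GSeries gr deg) :
    (c • F).eval φ = c • F.eval φ := by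
  refine ext_adm fun p hp => ?_
  rw [coeff_smul, coeff_eval hφ _ hp le_rfl, coeff_eval hφ _ hp le_rfl, Finset.smul_sum]
  simp only [coeff_smul, smul_mul_assoc]

theorem eval_C_mul [DecidableEq σ] [DecidableEq τ] {φ : σ → GSeries gr deg'}
    (hφ : ∀ s, Fil 1 (φ s)) (a : R) (F : GSeries gr deg) :
    (C gr deg a * F).eval φ = C gr deg' a * F.eval φ := by
  refine ext_adm fun p hp => ?_
  rw [coeff_C_mul, coeff_eval hφ _ hp le_rfl, coeff_eval hφ _ hp le_rfl, Finset.mul_sum]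
  simp only [coeff_C_mul, mul_assoc]

theorem Filtered.eval {φ : σ → GSeries gr deg'} (hφ : ∀ s, Fil 1 (φ s)) :
    Filtered fun F : GSeries gr deg => F.eval φ := by
  refine ⟨0, fun N F hF p hp => ?_⟩
  by_cases hadm : Admissible deg' p
  · rw [coeff_eval hφ _ hadm le_rfl]
    refine Finset.sum_eq_zero fun m _ => ?_
    by_cases hm : msize m < N
    · rw [hF m (by simpa using hm), zero_mul]
    · rw [orderedProd_fil hφ m p (by omega), mul_zero]
  · exact coeff_eq_zero _ _ hadm

theorem eval_monomial {φ : σ → GSeries gr deg'} (hφ : ∀ s, Fil 1 (φ s)) {m : σ →₀ ℕ}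
    (hm : Admissible deg m) (a : R) :
    (monomial m a : GSeries gr deg).eval φ = C gr deg' a * orderedProd φ m := by
  refine ext_adm fun p hp => ?_
  rw [coeff_eval hφ _ hp (Nat.le_add_left _ (msize m)), coeff_C_mul, Finset.sum_eq_single m]
  · rw [coeff_monomial_self hm]
  · intro n _ hn
    rw [coeff_monomial_of_ne hn, zero_mul]
  · exact fun h => absurd (mem_box (Nat.le_add_right _ _)) h

theorem eval_C [DecidableEq σ] [D : DecidableEq τ] {φ : σ → GSeries gr deg'}
    (hφ : ∀ s, Fil 1 (φ s)) (a : R) :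
    (C gr deg a).eval φ = C gr deg' a := by
  obtain rfl : D = fun a b => LinearOrder.toDecidableEq a b := Subsingleton.elim _ _
  rw [← monomial_zero_eq_C, eval_monomial hφ (admissible_zero deg), orderedProd_zero, mul_one]

theorem eval_zero {φ : σ → GSeries gr deg'} (hφ : ∀ s, Fil 1 (φ s)) :
    (0 : GSeries gr deg).eval φ = 0 := by
  rw [← C_zero, eval_C hφ, C_zero]

section Hom

variable [GradedComm gr] {φ : σ → GSeries gr deg'}

theorem C_mul_eq_mul_C [DecidableEq τ] {i : ℕ} {F : GSeries gr deg'} (hF : HasParity i F) (a : R) :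
    F * C gr deg' a = C gr deg' ((parityHom gr ^ i) a) * F := by
  rw [hF.mul_eq, parityAlg_pow_C]

/-- The reordering sign of ξ_s ξ^m in the source and that of φ_s φ^m in the target are the same,
because φ_s has the parity of ξ_s. -/
theorem eval_X_mul (hφ : IsSubst deg φ) [DecidableEq σ] (s : σ) (F : GSeries gr deg) :
    (X gr deg s * F).eval φ = φ s * F.eval φ := by
  refine ext_of_monomials (f := fun F => (X gr deg s * F).eval φ) (g := fun F => φ s * F.eval φ)
    ((Filtered.eval hφ.fil).comp (Filtered.id.const_mul _))
    ((Filtered.eval hφ.fil).const_mul _) (fun F G => ?_) (fun F G => ?_) (fun m hm a => ?_) F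
  · simp only [mul_add, eval_add hφ.fil]
  · simp only [mul_add, eval_add hφ.fil]
  · rw [eval_monomial hφ.fil hm, ← mul_assoc, C_mul_eq_mul_C (hφ.parity s), mul_assoc,
      mul_orderedProd hφ.parity, mul_smul_comm]
    by_cases h : Admissible deg (m + Finsupp.single s 1)
    · rw [X_mul_monomial s h, eval_monomial hφ.fil h, C_smul, smul_mul_assoc]
    · rw [X_mul_monomial_eq_zero s h, orderedProd_eq_zero hφ.parity h, eval_zero hφ.fil, mul_zero,
        smul_zero]

theorem eval_X (hφ : IsSubst deg φ) [DecidableEq σ] (s : σ) : (X gr deg s).eval φ = φ s := by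
  have := eval_X_mul hφ s (1 : GSeries gr deg)
  rwa [mul_one, ← C_one, eval_C hφ.fil, C_one, mul_one] at this

theorem eval_mul (hφ : IsSubst deg φ) (F G : GSeries gr deg) : (F * G).eval φ = F.eval φ * G.eval φ := by
  refine ext_of_generators (f := fun F => (F * G).eval φ) (g := fun F => F.eval φ * G.eval φ)
    ((Filtered.eval hφ.fil).comp (Filtered.id.mul_const _))
    ((Filtered.eval hφ.fil).mul_const _) (fun F G => ?_) (fun F G => ?_) (fun a => ?_)
    (fun u F hF => ?_) F
  · simp only [add_mul, eval_add hφ.fil]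
  · simp only [add_mul, eval_add hφ.fil]
  · simp only [eval_C_mul hφ.fil, eval_C hφ.fil]
  · beta_reduce at hF ⊢
    rw [mul_assoc, eval_X_mul hφ, hF, eval_X_mul hφ, mul_assoc]

/-- Substitution as an algebra homomorphism. -/
def evalAlg (hφ : IsSubst deg φ) : GSeries gr deg →ₐ[ℂ] GSeries gr deg' :=
  AlgHom.ofLinearMap
    { toFun := eval φ
      map_add' := eval_add hφ.fil
      map_smul' := eval_smul hφ.fil }
    (by
      change (1 : GSeries gr deg).eval φ = 1
      rw [← C_one, eval_C hφ.fil, C_one])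
    (eval_mul hφ)

theorem evalAlg_apply (hφ : IsSubst deg φ) (F : GSeries gr deg) : evalAlg hφ F = F.eval φ := rfl

theorem eval_sum (hφ : IsSubst deg φ) {ι : Type*} (S : Finset ι) (F : ι → GSeries gr deg) :
    (∑ i ∈ S, F i).eval φ = ∑ i ∈ S, (F i).eval φ := map_sum (evalAlg hφ) F S

theorem eval_sub (hφ : IsSubst deg φ) (F G : GSeries gr deg) : (F - G).eval φ = F.eval φ - G.eval φ :=
  map_sub (evalAlg hφ) F G

theorem eval_neg (hφ : IsSubst deg φ) (F : GSeries gr deg) : (-F).eval φ = -F.eval φ :=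
  map_neg (evalAlg hφ) F

theorem parity_eval (hφ : IsSubst deg φ) (F : GSeries gr deg) : (F.eval φ).parity = F.parity.eval φ := by
  refine ext_of_generators (f := fun F => (F.eval φ).parity) (g := fun F => F.parity.eval φ)
    (Filtered.parity.comp (Filtered.eval hφ.fil))
    ((Filtered.eval hφ.fil).comp Filtered.parity) (fun F G => ?_) (fun F G => ?_) (fun a => ?_)
    (fun u F hF => ?_) F
  · simp only [parity_add, eval_add hφ.fil]
  · simp only [parity_add, eval_add hφ.fil]
  · simp only [parity_C, eval_C hφ.fil]
  · beta_reduce at hF ⊢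
    rw [eval_X_mul hφ, parity_mul, hF, hφ.parity u, parity_mul, parity_X, smul_mul_assoc,
      smul_mul_assoc, eval_smul hφ.fil, eval_X_mul hφ]

theorem HasParity.eval (hφ : IsSubst deg φ) {i : ℕ} {F : GSeries gr deg} (hF : HasParity i F) :
    HasParity i (F.eval φ) := by
  rw [HasParity, parity_eval hφ, hF, eval_smul hφ.fil]

theorem Fil.eval (hφ : IsSubst deg φ) {N : ℕ} {F : GSeries gr deg} (hF : Fil N F) : Fil N (F.eval φ) := by
  intro p hp
  by_cases hadm : Admissible deg' p
  · rw [coeff_eval hφ.fil _ hadm le_rfl]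
    refine Finset.sum_eq_zero fun m _ => ?_
    by_cases hm : msize m < N
    · rw [hF m hm, zero_mul]
    · rw [orderedProd_fil hφ.fil m p (by omega), mul_zero]
  · exact coeff_eq_zero _ _ hadm

variable {υ : Type*} [Fintype υ] [LinearOrder υ] {deg'' : υ → ℤ} {ψ : τ → GSeries gr deg''}

theorem IsSubst.comp (hφ : IsSubst deg φ) (hψ : IsSubst deg' ψ) : IsSubst deg fun s => (φ s).eval ψ :=
  ⟨fun s => (hφ.fil s).eval hψ, fun s => (hφ.parity s).eval hψ⟩

theorem eval_eval (hφ : IsSubst deg φ) (hψ : IsSubst deg' ψ) (F : GSeries gr deg) :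
    (F.eval φ).eval ψ = F.eval fun s => (φ s).eval ψ := by
  have h := hφ.comp hψ
  refine ext_of_generators (f := fun F => (F.eval φ).eval ψ)
    (g := fun F => F.eval fun s => (φ s).eval ψ)
    ((Filtered.eval hψ.fil).comp (Filtered.eval hφ.fil))
    (Filtered.eval h.fil) (fun F G => ?_) (fun F G => ?_) (fun a => ?_)
    (fun u F hF => ?_) F
  · simp only [eval_add hφ.fil, eval_add hψ.fil]
  · simp only [eval_add h.fil]
  · simp only [eval_C hφ.fil, eval_C hψ.fil, eval_C h.fil]
  · beta_reduce at hF ⊢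
    rw [eval_X_mul hφ, eval_mul hψ, hF, eval_X_mul h]

end Hom

theorem Fil.X [DecidableEq τ] (t : τ) : Fil 1 (X gr deg' t) := fun m hm => by
  refine coeff_X_of_ne ?_
  rintro rfl
  rw [msize_single] at hm
  omega

theorem IsSubst.of_X [DecidableEq τ] {π : σ → τ} (hπ : ∀ s, pr (deg' (π s)) = pr (deg s)) :
    IsSubst deg fun s => X gr deg' (π s) :=
  ⟨fun _ => Fil.X _, fun s => by rw [← hπ s]; exact HasParity.X _⟩

theorem IsSubst.of_smul_X [DecidableEq τ] (c : σ → ℂ) {π : σ → τ}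
    (hπ : ∀ s, pr (deg' (π s)) = pr (deg s)) :
    IsSubst deg fun s => c s • X gr deg' (π s) :=
  ⟨fun s m hm => by rw [coeff_smul, Fil.X _ m hm, smul_zero],
    fun s => by rw [← hπ s]; exact (HasParity.X _).smul _⟩

section Embedding

variable [GradedComm gr] [DecidableEq τ] {π : σ → τ}

/-- Chain rule for a renaming of variables. Only injectivity is needed, not monotonicity: `eval`
multiplies the images in the target, where the reordering signs are automatic. -/
theorem pderiv_eval_X (hπ : ∀ s, pr (deg' (π s)) = pr (deg s))
    (hinj : Function.Injective π) (s : σ) (F : GSeries gr deg) :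
    (F.eval fun s => X gr deg' (π s)).pderiv (π s) =
      (F.pderiv s).eval fun s => X gr deg' (π s) := by
  have h : IsSubst deg fun s => X gr deg' (π s) := IsSubst.of_X hπ
  refine ext_of_generators (f := fun F => (F.eval fun s => X gr deg' (π s)).pderiv (π s))
    (g := fun F => (F.pderiv s).eval fun s => X gr deg' (π s))
    ((Filtered.pderiv _).comp (Filtered.eval h.fil))
    ((Filtered.eval h.fil).comp (Filtered.pderiv _)) (fun F G => ?_) (fun F G => ?_) (fun a => ?_)
    (fun u F hF => ?_) F
  · simp only [eval_add h.fil, pderiv_add]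
  · simp only [eval_add h.fil, pderiv_add]
  · simp only [eval_C h.fil, pderiv_C, eval_zero h.fil]
  · beta_reduce at hF ⊢
    rw [eval_X_mul h, pderiv_X_mul, hF, pderiv_X_mul, eval_add h.fil, eval_smul h.fil,
      eval_X_mul h, hπ, hπ]
    congr 1
    by_cases hsu : s = u
    · rw [if_pos hsu, if_pos (by rw [hsu])]
    · rw [if_neg hsu, if_neg fun e => hsu (hinj e), eval_zero h.fil]

theorem pderiv_eval_X_of_notMem (hπ : ∀ s, pr (deg' (π s)) = pr (deg s))
    {t : τ} (ht : ∀ s, π s ≠ t) (F : GSeries gr deg) :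
    (F.eval fun s => X gr deg' (π s)).pderiv t = 0 := by
  have h : IsSubst deg fun s => X gr deg' (π s) := IsSubst.of_X hπ
  refine ext_of_generators (f := fun F => (F.eval fun s => X gr deg' (π s)).pderiv t)
    (g := fun _ => 0)
    ((Filtered.pderiv _).comp (Filtered.eval h.fil))
    Filtered.zero (fun F G => ?_) (fun F G => ?_) (fun a => ?_)
    (fun u F hF => ?_) F
  · simp only [eval_add h.fil, pderiv_add]
  · rw [add_zero]
  · simp only [eval_C h.fil, pderiv_C]
  · beta_reduce at hF ⊢
    rw [eval_X_mul h, pderiv_X_mul, hF, if_neg (ht u).symm, mul_zero, smul_zero, add_zero]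

end Embedding

/-- Scaling of the variables multiplies the coefficients. -/
theorem coeff_eval_smul_X [GradedComm gr] [DecidableEq σ] (c : σ → ℂ) (F : GSeries gr deg)
    (m : σ →₀ ℕ) :
    (F.eval fun s => c s • X gr deg s).coeff m = (∏ s, c s ^ m s) • F.coeff m := by
  have h : IsSubst deg fun s => c s • X gr deg s :=
    IsSubst.of_smul_X (π := fun s => s) c fun _ => rfl
  have hs : ∀ (G : GSeries gr deg) (p : σ →₀ ℕ),
      (ofFun gr deg fun p => (∏ s, c s ^ p s) • G.coeff p).coeff p =
        (∏ s, c s ^ p s) • G.coeff p := fun G p => by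
    by_cases hp : Admissible deg p
    · rw [coeff_ofFun _ hp]
    · rw [coeff_eq_zero _ _ hp, coeff_eq_zero _ _ hp, smul_zero]
  rw [← hs]
  congr 1
  refine ext_of_generators (f := fun F => F.eval fun s => c s • X gr deg s)
    (g := fun F => ofFun gr deg fun p => (∏ s, c s ^ p s) • F.coeff p)
    (Filtered.eval h.fil) ⟨0, fun N G hG p hp => ?_⟩ (fun F G => eval_add h.fil F G)
    (fun F G => ?_) (fun a => ?_) (fun u F hF => ?_) F
  · rw [hs, hG p hp, smul_zero]
  · ext p
    rw [coeff_add, hs, hs, hs, coeff_add, smul_add]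
  · ext p
    rw [hs, eval_C h.fil]
    by_cases hp : p = 0
    · simp [hp]
    · rw [coeff_C_of_ne _ hp, smul_zero]
  · beta_reduce at hF ⊢
    rw [eval_X_mul h, hF]
    refine ext_adm fun p hp => ?_
    rw [smul_mul_assoc, coeff_smul, hs]
    by_cases hu : p u = 0
    · rw [coeff_X_mul_of_eq_zero _ hu, coeff_X_mul_of_eq_zero _ hu, smul_zero, smul_zero]
    · obtain ⟨n, rfl⟩ := exists_eq_add_single hu
      rw [coeff_X_mul_add _ _ hp, coeff_X_mul_add _ _ hp, hs]
      have : (∏ s, c s ^ (n + Finsupp.single u 1 : σ →₀ ℕ) s) = c u * ∏ s, c s ^ n s := by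
        simp only [Finsupp.add_apply, pow_add, Finset.prod_mul_distrib]
        rw [_root_.mul_comm]
        congr 1
        rw [Finset.prod_eq_single u]
        · simp
        · intro b _ hb
          simp [hb.symm]
        · simp
      rw [this, map_smul]
      simp only [smul_smul]
      congr 1
      ring

/-! ### Weights -/

/-- The weight of a monomial. -/
def wt (ω : σ → ℤ) (m : σ →₀ ℕ) : ℤ := ∑ s, (m s : ℤ) * ω s

theorem wt_add (ω : σ → ℤ) (m n : σ →₀ ℕ) : wt ω (m + n) = wt ω m + wt ω n := by
  simp [wt, add_mul, Finset.sum_add_distrib]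

theorem wt_single (ω : σ → ℤ) (s : σ) : wt ω (Finsupp.single s 1) = ω s := by
  unfold wt
  rw [Finset.sum_eq_single s]
  · simp
  · intro b _ hb
    simp [hb.symm]
  · simp

/-- All monomials of the series have weight `d`. -/
def WtHom (ω : σ → ℤ) (d : ℤ) (F : GSeries gr deg) : Prop := ∀ m, F.coeff m ≠ 0 → wt ω m = d

theorem WtHom.coeff_eq_zero {ω : σ → ℤ} {d : ℤ} {F : GSeries gr deg} (hF : WtHom ω d F)
    {m : σ →₀ ℕ} (hm : wt ω m ≠ d) : F.coeff m = 0 := by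
  by_contra h
  exact hm (hF m h)

theorem WtHom.zero (ω : σ → ℤ) (d : ℤ) : WtHom ω d (0 : GSeries gr deg) :=
  fun _ h => absurd rfl h

theorem WtHom.add {ω : σ → ℤ} {d : ℤ} {F G : GSeries gr deg} (hF : WtHom ω d F)
    (hG : WtHom ω d G) : WtHom ω d (F + G) := fun m h => by
  by_contra hm
  rw [coeff_add, hF.coeff_eq_zero hm, hG.coeff_eq_zero hm, add_zero] at h
  exact h rfl

theorem WtHom.smul {ω : σ → ℤ} {d : ℤ} {F : GSeries gr deg} (hF : WtHom ω d F) (c : ℂ) :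
    WtHom ω d (c • F) := fun m h => hF m fun h0 => h (by rw [coeff_smul, h0, smul_zero])

theorem WtHom.neg {ω : σ → ℤ} {d : ℤ} {F : GSeries gr deg} (hF : WtHom ω d F) :
    WtHom ω d (-F) := by
  rw [← neg_one_smul ℂ]; exact hF.smul _

theorem WtHom.sum {ω : σ → ℤ} {d : ℤ} {ι : Type*} {S : Finset ι} {F : ι → GSeries gr deg}
    (hF : ∀ k ∈ S, WtHom ω d (F k)) : WtHom ω d (∑ k ∈ S, F k) :=
  Finset.sum_induction _ (WtHom ω d) (fun _ _ => WtHom.add) (WtHom.zero ω d) hF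

theorem WtHom.mul {ω : σ → ℤ} {d e : ℤ} {F G : GSeries gr deg} (hF : WtHom ω d F)
    (hG : WtHom ω e G) : WtHom ω (d + e) (F * G) := fun p h => by
  by_cases hp : Admissible deg p
  · rw [coeff_mul _ _ hp] at h
    obtain ⟨q, hq, h⟩ := Finset.exists_ne_zero_of_sum_ne_zero h
    rw [← Finset.HasAntidiagonal.mem_antidiagonal.1 hq, wt_add, hF q.1, hG q.2]
    · intro h0
      rw [h0, map_zero, mul_zero, smul_zero] at h
      exact h rfl
    · intro h0
      rw [h0, zero_mul, smul_zero] at h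
      exact h rfl
  · exact absurd (GSeries.coeff_eq_zero _ _ hp) h

theorem WtHom.C [DecidableEq σ] (ω : σ → ℤ) (a : R) : WtHom ω 0 (C gr deg a) := fun m h => by
  by_cases hm : m = 0
  · subst hm; simp [wt]
  · exact absurd (coeff_C_of_ne _ hm) h

theorem WtHom.one (ω : σ → ℤ) : WtHom ω 0 (1 : GSeries gr deg) := WtHom.C ω 1

theorem WtHom.X [DecidableEq σ] (ω : σ → ℤ) (s : σ) : WtHom ω (ω s) (X gr deg s) := fun m h => by
  by_cases hm : m = Finsupp.single s 1
  · subst hm; exact wt_single ω s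
  · exact absurd (coeff_X_of_ne hm) h

theorem WtHom.list_prod {ω : σ → ℤ} {ι : Type*} {d : ι → ℤ} {F : ι → GSeries gr deg}
    (hF : ∀ i, WtHom ω (d i) (F i)) (l : List ι) :
    WtHom ω (l.map d).sum (l.map F).prod := by
  induction l with
  | nil => exact WtHom.one ω
  | cons i l ih => simpa using (hF i).mul ih

theorem WtHom.pow {ω : σ → ℤ} {d : ℤ} {F : GSeries gr deg} (hF : WtHom ω d F) (k : ℕ) :
    WtHom ω (k * d) (F ^ k) := by
  induction k with
  | zero => simpa using WtHom.one ω
  | succ k ih =>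
    rw [pow_succ, Nat.cast_succ, add_mul, one_mul]
    exact ih.mul hF

theorem WtHom.pderiv {ω : σ → ℤ} {d : ℤ} {F : GSeries gr deg} (hF : WtHom ω d F) (s : σ) :
    WtHom ω (d - ω s) (F.pderiv s) := fun m h => by
  by_contra hm
  have h0 : F.coeff (m + Finsupp.single s 1) = 0 := hF.coeff_eq_zero (by
    rw [wt_add, wt_single]
    omega)
  refine h ?_
  by_cases hs : Odd (deg s)
  · rw [coeff_pderiv_odd hs, h0, map_zero, smul_zero]
  · rw [coeff_pderiv_even hs, h0, smul_zero]

/-- A weight-preserving substitution reaches `p` only from exponents of the weight of `p`. This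
gives the homogeneity of images and also isolates one term of an infinite sum of classes. -/
theorem coeff_eval_eq_zero {ω : σ → ℤ} {ω' : τ → ℤ} {φ : σ → GSeries gr deg'}
    (hφ : ∀ s, Fil 1 (φ s)) (hω : ∀ s, WtHom ω' (ω s) (φ s)) {F : GSeries gr deg} {p : τ →₀ ℕ}
    (h : ∀ q, wt ω q = wt ω' p → F.coeff q = 0) : (F.eval φ).coeff p = 0 := by
  by_cases hp : Admissible deg' p
  · rw [coeff_eval hφ F hp le_rfl]
    refine Finset.sum_eq_zero fun q _ => ?_
    by_cases hq : wt ω q = wt ω' p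
    · rw [h q hq, zero_mul]
    · have h1 : WtHom ω' (wt ω q) (orderedProd φ q) := by
        have := WtHom.list_prod (fun s => (hω s).pow (q s)) (Finset.univ.sort (· ≤ ·))
        rwa [sum_sort] at this
      rw [h1.coeff_eq_zero (Ne.symm hq), mul_zero]
  · exact GSeries.coeff_eq_zero _ _ hp

theorem WtHom.eval {ω : σ → ℤ} {ω' : τ → ℤ} {φ : σ → GSeries gr deg'}
    (hφ : ∀ s, Fil 1 (φ s)) (hω : ∀ s, WtHom ω' (ω s) (φ s)) {d : ℤ} {F : GSeries gr deg}
    (hF : WtHom ω d F) : WtHom ω' d (F.eval φ) := fun p h => by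
  by_contra hp
  exact h (coeff_eval_eq_zero hφ hω fun q hq => hF.coeff_eq_zero (by rw [hq]; exact hp))

theorem WtHom.eq_zero_of_neg {ω : σ → ℤ} (hω : ∀ s, 0 ≤ ω s) {d : ℤ} (hd : d < 0)
    {F : GSeries gr deg} (hF : WtHom ω d F) : F = 0 := by
  ext m
  refine hF.coeff_eq_zero (ne_of_gt (hd.trans_le ?_))
  exact Finset.sum_nonneg fun s _ => mul_nonneg (Int.natCast_nonneg _) (hω s)

end GSeries

end

end ChernSimons

/-! ### De Rham calculus: from the Lagrangian to the Atiyah matrix -/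

namespace ChernSimons

set_option linter.unusedSectionVars false

noncomputable section

open GSeries

/-! ### The de Rham differential -/

section DeRham

variable {R : Type*} [Ring R] [Algebra ℂ R] {gr : ℤ → Submodule ℂ R} [GradedAlgebra gr]
  {σ : Type*} [Fintype σ] [LinearOrder σ] {deg : σ → ℤ}

theorem sum_lex {M : Type*} [AddCommMonoid M] (f : Fin 2 ×ₗ σ → M) :
    ∑ p, f p = ∑ s, f (toLex (0, s)) + ∑ s, f (toLex (1, s)) := by
  rw [← Equiv.sum_comp toLex f, Fintype.sum_prod_type, Fin.sum_univ_two]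

theorem formDeg_zero (s : σ) : formDeg deg (toLex (0, s)) = deg s := by
  simp [formDeg]

theorem formDeg_one (s : σ) : formDeg deg (toLex (1, s)) = deg s - 1 := by
  simp [formDeg]

theorem pr_one : pr 1 = 1 := pr_odd odd_one

theorem toForm_isSubst :
    IsSubst deg fun s => X gr (formDeg deg) (toLex (0, s)) :=
  IsSubst.of_X fun s => by rw [formDeg_zero]

theorem deRham_smul (c : ℂ) (F : GSeries gr (formDeg deg)) : deRham (c • F) = c • deRham F := by
  simp only [deRham, pderiv_smul, mul_smul_comm, Finset.smul_sum]

theorem deRham_zero : deRham (0 : GSeries gr (formDeg deg)) = 0 := by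
  simp only [deRham, pderiv_zero, mul_zero, Finset.sum_const_zero]

theorem deRham_one : deRham (1 : GSeries gr (formDeg deg)) = 0 := by
  simp only [deRham, pderiv_one, mul_zero, Finset.sum_const_zero]

/-- ∂/∂ξ_t never hits the factors dξ_s. Passing dξ_s and then ∂/∂ξ_s costs deg t · (deg s - 1) + deg
s · deg t, which is deg t modulo 2: the de Rham operator is odd. -/
theorem pderiv_deRham (t : σ) (F : GSeries gr (formDeg deg)) :
    (deRham F).pderiv (toLex (0, t)) =
      (-1 : ℂ) ^ pr (deg t) • deRham (F.pderiv (toLex (0, t))) := by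
  simp only [deRham, pderiv_sum, Finset.smul_sum]
  refine Finset.sum_congr rfl fun s _ => ?_
  have hne : (toLex (0, t) : Fin 2 ×ₗ σ) ≠ toLex (1, s) := by
    intro h
    have := congrArg (fun p => (ofLex p).1) h
    simp at this
  rw [pderiv_X_mul, if_neg hne, zero_add, pderiv_comm (toLex (0, s)), mul_smul_comm, smul_smul,
    formDeg_zero, formDeg_zero, formDeg_one]
  congr 1
  rw [← pow_add]
  have h1 := neg_one_pow_pr_sub (deg s) 1
  rw [pr_one] at h1
  rw [pow_add, pow_mul', h1, ← pow_mul', ← pow_add]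
  rw [show pr (deg t) * (pr (deg s) + 1) + pr (deg s) * pr (deg t) =
    2 * (pr (deg t) * pr (deg s)) + pr (deg t) by ring, pow_add, pow_mul]
  simp

theorem GSeries.HasParity.deRham {i : ℕ} {F : GSeries gr (formDeg deg)} (hF : HasParity i F) :
    HasParity (i + 1) (deRham F) := by
  refine HasParity.sum fun s _ => ?_
  refine ((HasParity.X (gr := gr) (deg := formDeg deg) (toLex (1, s))).mul (hF.pderiv (toLex (0, s)))).congr ?_
  rw [pow_add, formDeg_one, formDeg_zero, neg_one_pow_pr_sub, pr_one, ← pow_add,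
    show pr (deg s) + 1 + (pr (deg s) + i) = 2 * pr (deg s) + (i + 1) by ring, pow_add, pow_mul]
  simp

theorem GSeries.HasParity.toForm [GradedComm gr] {i : ℕ} {F : GSeries gr deg} (hF : HasParity i F) :
    HasParity i (toForm F) := hF.eval toForm_isSubst

theorem GSeries.WtHom.deRham {ω : Fin 2 ×ₗ σ → ℤ} {d e : ℤ} {F : GSeries gr (formDeg deg)}
    (hω : ∀ s, ω (toLex (1, s)) = ω (toLex (0, s)) + e) (hF : WtHom ω d F) :
    WtHom ω (d + e) (deRham F) := by
  refine WtHom.sum fun s _ => ?_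
  have := (WtHom.X (gr := gr) (deg := formDeg deg) ω (toLex (1, s))).mul
    (hF.pderiv (toLex (0, s)))
  rw [hω] at this
  convert this using 1
  ring

theorem GSeries.WtHom.toForm {ω : Fin 2 ×ₗ σ → ℤ} {d : ℤ} {F : GSeries gr deg}
    (hF : WtHom (fun s => ω (toLex (0, s))) d F) : WtHom ω d (toForm F) :=
  hF.eval (fun _ => Fil.X _) fun _ => WtHom.X _ _

theorem GSeries.WtHom.of_zero (F : GSeries gr deg) : WtHom (fun _ : σ => (0 : ℤ)) 0 F :=
  fun m _ => by simp [wt]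

/-- The weight counting differentials of coordinates. -/
def formWeight (σ : Type*) (p : Fin 2 ×ₗ σ) : ℤ := ((ofLex p).1 : ℕ)

theorem formWeight_deRham_toForm (F : GSeries gr deg) :
    WtHom (formWeight σ) 1 (deRham (toForm F)) := by
  have h : WtHom (formWeight σ) 0 (toForm F) := WtHom.toForm (by
    simpa [formWeight] using WtHom.of_zero F)
  simpa using h.deRham (e := 1) fun s => by simp [formWeight]

end DeRham

/-! ### Homogeneous series -/

section Homogeneous

variable {R : Type*} [Ring R] [Algebra ℂ R] {gr : ℤ → Submodule ℂ R} [GradedAlgebra gr]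
  {σ : Type*} [Fintype σ] [LinearOrder σ] {deg : σ → ℤ}

theorem neg_one_pow_oddCount (deg : σ → ℤ) (m : σ →₀ ℕ) :
    (-1 : ℂ) ^ oddCount deg m = (-1 : ℂ) ^ pr (∑ s, (m s : ℤ) * deg s) := by
  have key : ∀ S : Finset σ, (-1 : ℂ) ^ pr (∑ s ∈ S, (m s : ℤ) * deg s) =
      (-1 : ℂ) ^ ∑ s ∈ S, if Odd (deg s) then m s else 0 := by
    intro S
    induction S using Finset.induction_on with
    | empty => simp [pr]
    | insert a S ha ih =>
      rw [Finset.sum_insert ha, Finset.sum_insert ha, neg_one_pow_pr_add, pow_add, pow_add, ih,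
        neg_one_pow_pr_mul]
      congr 1
      by_cases h : Odd (deg a)
      · rw [pr_odd h, mul_one, if_pos h]
        rcases Nat.even_or_odd (m a) with h' | h'
        · rw [h'.neg_one_pow, pr_not_odd (by simpa using h'), pow_zero]
        · rw [h'.neg_one_pow, pr_odd (by simpa using h'), pow_one]
      · rw [pr_not_odd h, if_neg h, mul_zero]
  rw [key, oddCount]

theorem GSeries.IsHomogeneous.hasParity {k : ℤ} {F : GSeries gr deg} (hF : F.IsHomogeneous k) :
    HasParity (pr k) F := by
  ext m
  rw [coeff_parity, coeff_smul, parityHom_of_mem (hF m), smul_smul, neg_one_pow_pr_sub, pow_add,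
    ← neg_one_pow_oddCount, mul_left_comm, ← pow_add, ← two_mul, pow_mul]
  simp

theorem isHomogeneous_X [DecidableEq σ] (s : σ) : (X gr deg s).IsHomogeneous (deg s) := by
  intro m
  by_cases h : m = Finsupp.single s 1
  · subst h
    have : (∑ t, ((Finsupp.single s 1 : σ →₀ ℕ) t : ℤ) * deg t) = deg s := wt_single deg s
    rw [coeff_X_single, this, sub_self]
    exact SetLike.GradedOne.one_mem
  · rw [coeff_X_of_ne h]
    exact zero_mem _

theorem coeff_cubicAndHigher (F : GSeries gr deg) (m : σ →₀ ℕ) :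
    F.cubicAndHigher.coeff m = if 3 ≤ msize m then F.coeff m else 0 := by
  by_cases hm : Admissible deg m
  · exact coeff_ofFun _ hm
  · rw [coeff_eq_zero _ _ hm, coeff_eq_zero _ _ hm, ite_self]

theorem GSeries.HasParity.cubicAndHigher {i : ℕ} {F : GSeries gr deg} (hF : HasParity i F) :
    HasParity i F.cubicAndHigher := by
  ext m
  have := congrArg (fun G => G.coeff m) hF
  simp only [coeff_parity, coeff_smul] at this
  rw [coeff_parity, coeff_smul, coeff_cubicAndHigher]
  split_ifs
  · exact this
  · simp

theorem GSeries.WtHom.cubicAndHigher {ω : σ → ℤ} {d : ℤ} {F : GSeries gr deg} (hF : WtHom ω d F) :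
    WtHom ω d F.cubicAndHigher := fun m h => by
  rw [coeff_cubicAndHigher] at h
  split_ifs at h
  · exact hF m h
  · exact absurd rfl h

theorem coeff_pderiv_congr {F G : GSeries gr deg} {s : σ} {m : σ →₀ ℕ}
    (h : F.coeff (m + Finsupp.single s 1) = G.coeff (m + Finsupp.single s 1)) :
    (F.pderiv s).coeff m = (G.pderiv s).coeff m := by
  by_cases hs : Odd (deg s)
  · rw [coeff_pderiv_odd hs, coeff_pderiv_odd hs, h]
  · rw [coeff_pderiv_even hs, coeff_pderiv_even hs, h]

/-- Second derivatives do not see the truncation to cubic and higher terms, except for their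
constant term. -/
theorem pderiv_pderiv_cubicAndHigher {F : GSeries gr deg} {s t : σ}
    (h : ((F.pderiv s).pderiv t).coeff 0 = 0) :
    (F.cubicAndHigher.pderiv s).pderiv t = (F.pderiv s).pderiv t := by
  ext m
  by_cases hm : msize m = 0
  · rw [eq_zero_of_msize hm, h]
    have : ((F.cubicAndHigher.pderiv s).pderiv t).coeff 0 =
        (((0 : GSeries gr deg).pderiv s).pderiv t).coeff 0 := by
      refine coeff_pderiv_congr (coeff_pderiv_congr ?_)
      rw [coeff_cubicAndHigher, if_neg, coeff_zero]
      rw [msize_add, msize_add, msize_single, msize_single, msize_zero]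
      omega
    rw [this, pderiv_zero, pderiv_zero, coeff_zero]
  · refine coeff_pderiv_congr (coeff_pderiv_congr ?_)
    rw [coeff_cubicAndHigher, if_pos]
    rw [msize_add, msize_add, msize_single, msize_single]
    omega

end Homogeneous

/-! ### The Atiyah matrix and the Lagrangian -/

section Lagrangian

variable {R : Type*} [Ring R] [Algebra ℂ R] {gr : ℤ → Submodule ℂ R} [GradedAlgebra gr] {r : ℕ}
  {B : CDGA gr} {I : TwoSidedIdeal R} {deg : Fin r → ℤ}

namespace CurvedLInfinity

theorem d_one (g : CurvedLInfinity B I deg) : g.d 1 = 0 := by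
  have h := g.leibniz 1 1
  have h1 : (1 : GSeries gr (ceDeg deg)).parity = 1 := map_one parityAlg
  rw [h1, mul_one, mul_one, one_mul] at h
  exact left_eq_add.1 h

theorem dForm_zero (g : CurvedLInfinity B I deg) : g.dForm 0 = 0 := by
  unfold dForm
  have : (0 : GSeries gr (formDeg (ceDeg deg))).mapCoeff B.d = 0 := by
    refine ext_adm fun m hm => ?_
    rw [mapCoeff, coeff_ofFun _ hm, coeff_zero, map_zero]
  rw [this, zero_add]
  refine Finset.sum_eq_zero fun i _ => ?_
  rw [pderiv_zero, pderiv_zero, mul_zero, mul_zero, sub_zero]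

/-- The basis vectors ∂_j are flat, so the term in which the connection acts first vanishes. What
remains is the connection applied to [d, ∂_j], that is, de Rham differentials of first derivatives
of `q`. -/
theorem atiyahMatrix_apply [GradedComm gr] (g : CurvedLInfinity B I deg) (j i : Fin r) :
    g.atiyahMatrix j i =
      -((-1 : ℂ) ^ pr (ceDeg deg j) • deRham (toForm ((g.q i).pderiv j))) := by
  have hconn : connection (gr := gr) (deg := deg)
      (fun k => if k = j then (1 : GSeries gr (ceDeg deg)) else 0) = 0 := by
    funext i
    simp only [connection]
    split_ifs
    · rw [toForm, ← C_one, eval_C toForm_isSubst.fil, C_one, deRham_one]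
      rfl
    · rw [toForm, eval_zero toForm_isSubst.fil, deRham_zero]
      rfl
  have hd : g.dFormTangent 0 = 0 := by
    funext i
    simp only [dFormTangent, Pi.zero_apply, dForm_zero, parity_zero, zero_mul,
      Finset.sum_const_zero, add_zero]
  have ht : g.dTangent (fun k => if k = j then 1 else 0) i = g.tangentMatrix j i := by
    simp only [dTangent]
    have : g.d (if i = j then 1 else 0) = 0 := by
      split_ifs
      · exact g.d_one
      · exact map_zero _
    rw [this, zero_add, Finset.sum_eq_single j]
    · have h1 : (1 : GSeries gr (ceDeg deg)).parity = 1 := map_one parityAlg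
      rw [if_pos rfl, h1, one_mul]
    · intro k _ hk
      rw [if_neg hk, parity_zero, zero_mul]
    · simp
  unfold atiyahMatrix atiyah
  rw [hconn, hd]
  simp only [connection, Pi.zero_apply, add_zero]
  rw [ht, tangentMatrix, negOnePow_eq_pr, toForm, eval_neg toForm_isSubst,
    eval_smul toForm_isSubst.fil, ← neg_one_smul ℂ, deRham_smul, deRham_smul, neg_one_smul]
  rfl

theorem hasParity_q (g : CurvedLInfinity B I deg) (i : Fin r) :
    HasParity (pr (ceDeg deg i + 1)) (g.q i) :=
  (g.d_homogeneous _ _ (isHomogeneous_X i)).hasParity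

end CurvedLInfinity

theorem cotDeg_zero (i : Fin r) : cotDeg deg (toLex (0, i)) = ceDeg deg i := by
  simp [cotDeg, ceDeg]

theorem pr_cotDeg_one (i : Fin r) : pr (cotDeg deg (toLex (1, i))) = pr (ceDeg deg i) := by
  have : cotDeg deg (toLex (1, i)) = - ceDeg deg i := by
    simp [cotDeg, ceDeg]
  simp only [this, pr, ← Int.not_even_iff_odd, even_neg]

theorem base_isSubst :
    IsSubst (ceDeg deg) fun j => X gr (cotDeg deg) (toLex (0, j)) :=
  IsSubst.of_X fun s => by rw [cotDeg_zero]

theorem pullbackForm_degrees (p : Fin 2 ×ₗ Fin r) :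
    pr (fieldDeg deg (toLex ((ofLex p).1, toLex (0, (ofLex p).2)))) =
      pr (formDeg (ceDeg deg) p) := by
  simp [fieldDeg, formDeg, cotDeg, ceDeg]

theorem pullbackForm_isSubst :
    IsSubst (formDeg (ceDeg deg))
      fun p => X gr (fieldDeg deg) (toLex ((ofLex p).1, toLex (0, (ofLex p).2))) :=
  IsSubst.of_X pullbackForm_degrees

theorem pullbackForm_injective : Function.Injective fun p : Fin 2 ×ₗ Fin r =>
    (toLex ((ofLex p).1, toLex ((0 : Fin 2), (ofLex p).2)) : Fin 2 ×ₗ (Fin 2 ×ₗ Fin r)) := by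
  intro p q h
  have h1 := congrArg (fun p => (ofLex p).1) h
  have h2 := congrArg (fun p => (ofLex (ofLex p).2).2) h
  exact Prod.ext h1 h2

/-- The additional terms dβ ∂/∂β of the de Rham operator on the cotangent space annihilate forms in
α and dα. -/
theorem pullbackForm_deRham [GradedComm gr] (F : GSeries gr (formDeg (ceDeg deg))) :
    pullbackForm (deRham F) = deRham (pullbackForm F) := by
  unfold pullbackForm
  rw [deRham, eval_sum pullbackForm_isSubst, deRham, sum_lex (σ := Fin r)]
  have h0 : ∀ s : Fin r, (F.eval fun p => X gr (fieldDeg deg)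
      (toLex ((ofLex p).1, toLex (0, (ofLex p).2)))).pderiv (toLex (0, toLex (1, s))) = 0 := by
    intro s
    refine pderiv_eval_X_of_notMem pullbackForm_degrees (fun p h => ?_) F
    have := congrArg (fun p => (ofLex (ofLex p).2).1) h
    simp at this
  simp only [h0, mul_zero, Finset.sum_const_zero, add_zero]
  refine Finset.sum_congr rfl fun s _ => ?_
  rw [eval_X_mul pullbackForm_isSubst]
  congr 1
  exact (pderiv_eval_X pullbackForm_degrees pullbackForm_injective (toLex (0, s)) F).symm

theorem pullbackForm_toForm [GradedComm gr] (F : GSeries gr (ceDeg deg)) :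
    pullbackForm (toForm F) =
      toForm (F.eval fun j => X gr (cotDeg deg) (toLex (0, j))) := by
  unfold pullbackForm toForm
  rw [eval_eval toForm_isSubst pullbackForm_isSubst, eval_eval base_isSubst toForm_isSubst]
  congr 1
  funext s
  rw [eval_X pullbackForm_isSubst, eval_X toForm_isSubst]
  rfl

namespace CurvedLInfinity

/-- In ∑ β_i q_i(α) the functions q_i do not involve β, so the derivative in β_k strips off this
variable and leaves q_k. -/
theorem hamiltonian_pderiv_pderiv [GradedComm gr] (g : CurvedLInfinity B I deg) (i k : Fin r) :
    (g.hamiltonian.pderiv (toLex (1, k))).pderiv (toLex (0, i)) =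
      ((g.q k).pderiv i).eval fun j => X gr (cotDeg deg) (toLex (0, j)) := by
  have hd : ∀ s : Fin r, pr (cotDeg deg (toLex (0, s))) = pr (ceDeg deg s) :=
    fun s => by rw [cotDeg_zero]
  have h1 : g.hamiltonian.pderiv (toLex (1, k)) =
      (g.q k).eval fun j => X gr (cotDeg deg) (toLex (0, j)) := by
    rw [hamiltonian, pderiv_sum, Finset.sum_eq_single k]
    · rw [pderiv_X_mul, if_pos rfl, pderiv_eval_X_of_notMem hd, mul_zero, smul_zero, add_zero]
      intro s h
      have := congrArg (fun p => (ofLex p).1) h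
      simp at this
    · intro b _ hb
      have hne : (toLex (1, k) : Fin 2 ×ₗ Fin r) ≠ toLex (1, b) := by
        intro h
        have := congrArg (fun p => (ofLex p).2) h
        exact hb this.symm
      rw [pderiv_X_mul, if_neg hne, pderiv_eval_X_of_notMem hd, mul_zero, smul_zero, add_zero]
      intro s h
      have := congrArg (fun p => (ofLex p).1) h
      simp at this
    · simp
  rw [h1]
  refine pderiv_eval_X hd (fun a b h => ?_) i (g.q k)
  exact congrArg (fun p : Fin 2 ×ₗ Fin r => (ofLex p).2) h

theorem formWeight_atiyahMatrix [GradedComm gr] (g : CurvedLInfinity B I deg) (i k : Fin r) :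
    WtHom (formWeight (Fin r)) 1 (g.atiyahMatrix i k) := by
  rw [atiyahMatrix_apply]
  exact ((formWeight_deRham_toForm _).smul _).neg

theorem formWeight_pullbackForm {d : ℤ} {F : GSeries gr (formDeg (ceDeg deg))}
    (hF : WtHom (formWeight (Fin r)) d F) :
    WtHom (formWeight (Fin 2 ×ₗ Fin r)) d (pullbackForm F) :=
  hF.eval (fun _ => Fil.X _) fun _ => WtHom.X (formWeight (Fin 2 ×ₗ Fin r)) _

/-- The second derivatives of the Lagrangian are the entries of the Atiyah matrix. -/
theorem lagrangian_pderiv_pderiv [GradedComm gr] (g : CurvedLInfinity B I deg) (i k : Fin r) :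
    (g.lagrangian.pderiv (toLex (0, toLex (1, k)))).pderiv (toLex (0, toLex (0, i))) =
      -((-1 : ℂ) ^ pr (ceDeg deg k) • pullbackForm (g.atiyahMatrix i k)) := by
  have hπ : ∀ s, pr (formDeg (cotDeg deg) (toLex (0, s))) = pr (cotDeg deg s) :=
    fun s => by rw [formDeg_zero]
  have hinj : Function.Injective
      fun s : Fin 2 ×ₗ Fin r => (toLex (0, s) : Fin 2 ×ₗ (Fin 2 ×ₗ Fin r)) :=
    fun a b h => congrArg (fun p : Fin 2 ×ₗ (Fin 2 ×ₗ Fin r) => (ofLex p).2) h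
  have h1 : ((deRham (toForm g.hamiltonian)).pderiv (toLex (0, toLex (1, k)))).pderiv
      (toLex (0, toLex (0, i))) =
      -((-1 : ℂ) ^ pr (ceDeg deg k) • pullbackForm (g.atiyahMatrix i k)) := by
    rw [pderiv_deRham, pderiv_smul, pderiv_deRham, smul_smul, toForm, pderiv_eval_X hπ hinj,
      pderiv_eval_X hπ hinj, hamiltonian_pderiv_pderiv, pr_cotDeg_one, cotDeg_zero,
      atiyahMatrix_apply, pullbackForm, eval_neg pullbackForm_isSubst,
      eval_smul pullbackForm_isSubst.fil, smul_neg, neg_neg, smul_smul]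
    congr 1
    have := pullbackForm_deRham (toForm ((g.q k).pderiv i))
    rw [pullbackForm_toForm] at this
    exact this.symm
  rw [← h1]
  -- The truncation could only remove the constant term of the second derivative, and that term is
  -- zero because every monomial contains exactly one differential.
  refine pderiv_pderiv_cubicAndHigher ?_
  rw [h1]
  refine (((formWeight_pullbackForm (g.formWeight_atiyahMatrix i k)).smul _).neg).coeff_eq_zero ?_
  simp [wt]

/-- The Hamiltonian is odd, since q_i has the parity opposite to β_i, and the odd de Rham operator
makes it even. Evenness allows the vertex factors to be permuted and to pass through derivatives
without signs. -/
theorem hasParity_lagrangian [GradedComm gr] (g : CurvedLInfinity B I deg) :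
    HasParity 0 g.lagrangian := by
  refine HasParity.cubicAndHigher (HasParity.congr (i := 1 + 1) (HasParity.deRham ?_) (by simp))
  refine HasParity.toForm (HasParity.sum fun i _ => ?_)
  refine ((HasParity.X (gr := gr) (deg := cotDeg deg) (toLex (1, i))).mul
    ((g.hasParity_q i).eval base_isSubst)).congr ?_
  rw [pr_cotDeg_one, pow_add, neg_one_pow_pr_add, pr_one, ← pow_add, ← add_assoc, ← two_mul,
    pow_add, pow_mul]
  simp

/-- The weight counting the coordinates `β` and `dβ`. -/
def betaWeight (r : ℕ) (p : Fin 2 ×ₗ (Fin 2 ×ₗ Fin r)) : ℤ := ((ofLex (ofLex p).2).1 : ℕ)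

theorem betaWeight_lagrangian (g : CurvedLInfinity B I deg) :
    WtHom (betaWeight r) 1 g.lagrangian := by
  refine WtHom.cubicAndHigher ?_
  have h : WtHom (betaWeight r) 1 (toForm g.hamiltonian) := by
    refine WtHom.toForm (WtHom.sum fun i _ => ?_)
    have h1 := WtHom.X (gr := gr) (deg := cotDeg deg)
      (fun s => betaWeight r (toLex (0, s))) (toLex (1, i))
    have h2 : WtHom (fun s => betaWeight r (toLex (0, s))) 0
        ((g.q i).eval fun j => X gr (cotDeg deg) (toLex (0, j))) :=
      (WtHom.of_zero (g.q i)).eval (fun _ => Fil.X _) fun s => by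
        simpa [betaWeight] using WtHom.X (gr := gr) (deg := cotDeg deg)
          (fun s => betaWeight r (toLex (0, s))) (toLex (0, s))
    simpa [betaWeight] using h1.mul h2
  simpa using WtHom.deRham (e := 0) (fun s => by simp [betaWeight]) h

end CurvedLInfinity

end Lagrangian

end

end ChernSimons

/-! ### Algebraic side of the graphs: contraction around a cycle -/

namespace ChernSimons

set_option linter.unusedSectionVars false

noncomputable section

open GSeries

section Contraction

variable {R : Type*} [Ring R] [Algebra ℂ R] {gr : ℤ → Submodule ℂ R} [GradedAlgebra gr] {r : ℕ}
  {B : CDGA gr} {I : TwoSidedIdeal R} {deg : Fin r → ℤ} {n : ℕ}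

/-! ### The Casimir operators -/

theorem pr_multiDeg (v : Fin n) (s : Fin 2 ×ₗ (Fin 2 ×ₗ Fin r)) :
    pr (multiDeg deg n (toLex (v, s))) = pr (fieldDeg deg s) := rfl

theorem pr_fieldDeg_alpha (i : Fin r) :
    pr (fieldDeg deg (toLex (0, toLex (0, i)))) = pr (ceDeg deg i) := by
  rw [fieldDeg, formDeg_zero, cotDeg_zero]

theorem pr_fieldDeg_beta (i : Fin r) :
    pr (fieldDeg deg (toLex (0, toLex (1, i)))) = pr (ceDeg deg i) := by
  rw [fieldDeg, formDeg_zero, pr_cotDeg_one]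

theorem pr_alpha (v : Fin n) (i : Fin r) :
    pr (multiDeg deg n (toLex (v, toLex (0, toLex (0, i))))) = pr (ceDeg deg i) := by
  rw [pr_multiDeg, pr_fieldDeg_alpha]

theorem pr_beta (v : Fin n) (i : Fin r) :
    pr (multiDeg deg n (toLex (v, toLex (0, toLex (1, i))))) = pr (ceDeg deg i) := by
  rw [pr_multiDeg, pr_fieldDeg_beta]

/-- Two derivatives of equal parity compose to an even operator, which commutes with every
derivative; hence Casimirs commute. -/
theorem GSeries.pderiv_pair_comm {σ : Type*} [Fintype σ] [LinearOrder σ] {δ : σ → ℤ}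
    {a b c d : σ} (hcd : pr (δ c) = pr (δ d)) (F : GSeries gr δ) :
    (((F.pderiv d).pderiv c).pderiv b).pderiv a = (((F.pderiv b).pderiv a).pderiv d).pderiv c := by
  have h : ∀ (x : σ) (G : GSeries gr δ),
      ((G.pderiv d).pderiv c).pderiv x = ((G.pderiv x).pderiv d).pderiv c := fun x G => by
    rw [pderiv_comm c x, pderiv_comm d x, pderiv_smul, smul_smul, hcd, ← pow_add, ← two_mul,
      pow_mul]
    simp
  rw [h, h]

theorem casimir_comm (v w v' w' : Fin n) (F : GSeries gr (multiDeg deg n)) :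
    casimir v w (casimir v' w' F) = casimir v' w' (casimir v w F) := by
  simp only [casimir, pderiv_sum]
  rw [Finset.sum_comm]
  refine Finset.sum_congr rfl fun i _ => Finset.sum_congr rfl fun j _ => ?_
  exact pderiv_pair_comm (by rw [pr_alpha, pr_beta]) F

/-! ### The Lagrangian at a vertex -/

theorem vertex_isSubst (v : Fin n) :
    IsSubst (fieldDeg deg) fun s => X gr (multiDeg deg n) (toLex (v, s)) :=
  IsSubst.of_X fun s => pr_multiDeg v s

/-- A function of the field at one point, placed at the vertex `v`. -/
def atVertex (v : Fin n) (F : GSeries gr (fieldDeg deg)) : GSeries gr (multiDeg deg n) :=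
  F.eval fun s => X gr (multiDeg deg n) (toLex (v, s))

/-- The series does not depend on the field at the vertex `v`. -/
def Indep (v : Fin n) (F : GSeries gr (multiDeg deg n)) : Prop :=
  ∀ s, F.pderiv (toLex (v, s)) = 0

theorem Indep.mul [GradedComm gr] {v : Fin n} {F G : GSeries gr (multiDeg deg n)}
    (hF : Indep v F) (hG : Indep v G) : Indep v (F * G) := fun s => by
  rw [pderiv_mul, hF s, hG s, zero_mul, mul_zero, add_zero]

theorem Indep.smul {v : Fin n} {F : GSeries gr (multiDeg deg n)} (hF : Indep v F) (c : ℂ) :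
    Indep v (c • F) := fun s => by rw [pderiv_smul, hF s, smul_zero]

theorem Indep.sum {v : Fin n} {ι : Type*} {S : Finset ι} {F : ι → GSeries gr (multiDeg deg n)}
    (hF : ∀ i ∈ S, Indep v (F i)) : Indep v (∑ i ∈ S, F i) := fun s => by
  rw [pderiv_sum]
  exact Finset.sum_eq_zero fun i hi => hF i hi s

theorem Indep.one (v : Fin n) : Indep v (1 : GSeries gr (multiDeg deg n)) :=
  fun _ => pderiv_one _

theorem atVertex_indep [GradedComm gr] {v w : Fin n} (h : v ≠ w) (F : GSeries gr (fieldDeg deg)) :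
    Indep w (atVertex v F) := fun s => by
  refine pderiv_eval_X_of_notMem (pr_multiDeg v) (fun t ht => h ?_) F
  exact congrArg (fun p : Fin n ×ₗ (Fin 2 ×ₗ (Fin 2 ×ₗ Fin r)) => (ofLex p).1) ht

theorem atVertex_pderiv [GradedComm gr] (v : Fin n) (s) (F : GSeries gr (fieldDeg deg)) :
    (atVertex v F).pderiv (toLex (v, s)) = atVertex v (F.pderiv s) :=
  pderiv_eval_X (pr_multiDeg v) (fun _ _ h =>
    congrArg (fun p : Fin n ×ₗ (Fin 2 ×ₗ (Fin 2 ×ₗ Fin r)) => (ofLex p).2) h) s F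

/-! ### Graphs with two edges ending in the same vertex -/

/-- The weight counting the coordinates `β`, `dβ` at the vertex `v`. -/
def vertexWeight (r : ℕ) (v : Fin n) (p : Fin n ×ₗ (Fin 2 ×ₗ (Fin 2 ×ₗ Fin r))) : ℤ :=
  if (ofLex p).1 = v then CurvedLInfinity.betaWeight r (ofLex p).2 else 0

theorem vertexWeight_nonneg (v : Fin n) (p) : 0 ≤ vertexWeight r v p := by
  unfold vertexWeight CurvedLInfinity.betaWeight
  split_ifs <;> simp

theorem vertexWeight_lagrangian (g : CurvedLInfinity B I deg) (u v : Fin n) :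
    WtHom (vertexWeight r v) (if u = v then 1 else 0) (atVertex u g.lagrangian) := by
  by_cases h : u = v
  · rw [if_pos h]
    refine g.betaWeight_lagrangian.eval (fun _ => Fil.X _) fun s => ?_
    have := WtHom.X (gr := gr) (deg := multiDeg deg n) (vertexWeight r v) (toLex (u, s))
    simpa [vertexWeight, h] using this
  · rw [if_neg h]
    refine (WtHom.of_zero g.lagrangian).eval (fun _ => Fil.X _) fun s => ?_
    have := WtHom.X (gr := gr) (deg := multiDeg deg n) (vertexWeight r v) (toLex (u, s))
    simpa [vertexWeight, h] using this

theorem vertexWeight_casimir {v : Fin n} {d : ℤ} {F : GSeries gr (multiDeg deg n)}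
    (hF : WtHom (vertexWeight r v) d F) (e : Fin n × Fin n) :
    WtHom (vertexWeight r v) (d - if e.2 = v then 1 else 0) (casimir e.1 e.2 F) := by
  refine WtHom.sum fun i _ => ?_
  have := (hF.pderiv (toLex (e.2, toLex (0, toLex (1, i))))).pderiv
    (toLex (e.1, toLex (0, toLex (0, i))))
  simpa [vertexWeight, CurvedLInfinity.betaWeight] using this

theorem vertexWeight_foldr {v : Fin n} {d : ℤ} {F : GSeries gr (multiDeg deg n)}
    (hF : WtHom (vertexWeight r v) d F) (l : List (Fin n × Fin n)) :
    WtHom (vertexWeight r v) (d - (l.map fun e => if e.2 = v then (1 : ℤ) else 0).sum)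
      (l.foldr (fun e F => casimir e.1 e.2 F) F) := by
  induction l with
  | nil => simpa using hF
  | cons e l ih =>
    rw [List.foldr_cons, List.map_cons, List.sum_cons]
    convert vertexWeight_casimir ih e using 1
    ring

namespace CurvedLInfinity

theorem contraction_eq (g : CurvedLInfinity B I deg) (γ : LabelledGraph n) :
    g.contraction γ = (List.ofFn γ).foldr (fun e F => casimir e.1 e.2 F)
      ((List.finRange n).map fun v => atVertex v g.lagrangian).prod := by
  rw [contraction, List.ofFn_eq_map (f := fun v : Fin n => g.lagrangian.eval _)]
  rfl

/-- A vertex carries at most one `β`-input. -/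
theorem contraction_eq_zero (g : CurvedLInfinity B I deg) {γ : LabelledGraph n}
    (hγ : ¬ Function.Injective fun e => (γ e).2) : g.contraction γ = 0 := by
  simp only [Function.Injective, not_forall] at hγ
  obtain ⟨e, e', hee, hne⟩ := hγ
  set v := (γ e).2 with hv
  have h1 := WtHom.list_prod (fun u => vertexWeight_lagrangian g u v) (List.finRange n)
  have h2 : ((List.finRange n).map fun u => if u = v then (1 : ℤ) else 0).sum = 1 := by
    rw [← List.ofFn_eq_map, List.sum_ofFn]
    simp
  rw [h2] at h1
  have h3 := vertexWeight_foldr h1 (List.ofFn γ)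
  rw [← contraction_eq] at h3
  refine h3.eq_zero_of_neg (vertexWeight_nonneg v) ?_
  rw [List.map_ofFn, List.sum_ofFn]
  -- The Lagrangian at `v` supplies β-weight one, while each of the two edges ending there removes
  -- one, so the total weight is negative.
  have h4 : ∑ a ∈ ({e, e'} : Finset (Fin n)), (if (γ a).2 = v then (1 : ℤ) else 0) ≤
      ∑ a, if (γ a).2 = v then (1 : ℤ) else 0 :=
    Finset.sum_le_sum_of_subset_of_nonneg (Finset.subset_univ _) fun a _ _ => by
      split_ifs <;> simp
  rw [Finset.sum_pair hne, if_pos hv.symm, if_pos hee.symm] at h4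
  simp only [Function.comp_apply]
  omega

/-! ### Cyclic graphs -/

/-- The matrix of second derivatives of the Lagrangian at a vertex. -/
def vertexMatrix (g : CurvedLInfinity B I deg) (v : Fin n) :
    Matrix (Fin r) (Fin r) (GSeries gr (multiDeg deg n)) := fun i k =>
  (-1 : ℂ) ^ pr (ceDeg deg k) • atVertex v
    ((g.lagrangian.pderiv (toLex (0, toLex (1, k)))).pderiv (toLex (0, toLex (0, i))))

theorem neg_one_pow_two_mul_add (a b : ℕ) : (-1 : ℂ) ^ (2 * a + b) = (-1 : ℂ) ^ b := by
  rw [pow_add, pow_mul]; simp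

theorem hasParity_vertexMatrix [GradedComm gr] (g : CurvedLInfinity B I deg) (v : Fin n)
    (i k : Fin r) :
    HasParity (pr (ceDeg deg i) + pr (ceDeg deg k)) (g.vertexMatrix v i k) := by
  have := ((g.hasParity_lagrangian.pderiv (toLex (0, toLex (1, k)))).pderiv
    (toLex (0, toLex (0, i)))).eval (vertex_isSubst v)
  rw [pr_fieldDeg_alpha, pr_fieldDeg_beta, add_zero] at this
  exact this.smul _

theorem parityAlg_pow_of_even {σ : Type*} [Fintype σ] [LinearOrder σ] {δ : σ → ℤ}
    {F : GSeries gr δ} (hF : HasParity 0 F) (k : ℕ) : (parityAlg ^ k) F = F := by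
  rw [hF.parityAlg_pow, mul_zero, pow_zero, one_smul]

/-- The contraction of a chain of vertices. -/
theorem exists_chain [GradedComm gr] (g : CurvedLInfinity B I deg) (v : Fin n)
    (l : List (Fin n)) (hl : (v :: l).Nodup) :
    ∃ (Y : GSeries gr (multiDeg deg n)) (Z : Fin r → GSeries gr (multiDeg deg n)),
      (∀ P, HasParity 0 P → (∀ x ∈ v :: l, Indep x P) →
        ((v :: l).zip l).foldr (fun e F => casimir e.1 e.2 F)
          (P * ((v :: l).map fun v => atVertex v g.lagrangian).prod) = P * Y) ∧
      (∀ k, Y.pderiv (toLex (v, toLex (0, toLex (1, k)))) = (-1 : ℂ) ^ pr (ceDeg deg k) • Z k) ∧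
      (∀ k, HasParity (pr (ceDeg deg k)) (Z k)) ∧
      (∀ x, x ∉ v :: l → ∀ k, Indep x (Z k)) ∧
      (∀ j k, (Z k).pderiv (toLex ((v :: l).getLast (List.cons_ne_nil _ _),
        toLex (0, toLex (0, j)))) = (((v :: l).reverse.map g.vertexMatrix).prod) j k) := by
  -- `Y` is the contraction of the chain and `Z k` its signed derivative in β_k at the first vertex,
  -- the input still open at this end. The prefix `P` stands for the even vertex factors to the
  -- left, independent of the chain; it is what the induction needs when a vertex is prepended.
  -- Differentiating `Z k` in the α-input at the last vertex yields the product of the vertex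
  -- matrices in reversed order.
  induction l generalizing v with
  | nil =>
    refine ⟨atVertex v g.lagrangian, fun k => (-1 : ℂ) ^ pr (ceDeg deg k) •
      atVertex v (g.lagrangian.pderiv (toLex (0, toLex (1, k)))), ?_, ?_, ?_, ?_, ?_⟩
    · intro P _ _
      simp
    · intro k
      rw [atVertex_pderiv, smul_smul, ← pow_add, ← two_mul, pow_mul]
      simp
    · intro k
      have := (g.hasParity_lagrangian.pderiv (toLex (0, toLex (1, k)))).eval (vertex_isSubst v)
      rw [pr_fieldDeg_beta, add_zero] at this
      exact this.smul _
    · intro x hx k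
      exact (atVertex_indep (fun h => hx (by simp [h])) _).smul _
    · intro j k
      simp only [List.getLast_singleton, List.reverse_singleton, List.map_cons, List.map_nil,
        List.prod_singleton]
      rw [pderiv_smul, atVertex_pderiv]
      rfl
  | cons w l ih =>
    have hvl : v ∉ w :: l := (List.nodup_cons.1 hl).1
    have hwl : (w :: l).Nodup := (List.nodup_cons.1 hl).2
    obtain ⟨Y, Z, hY, hYZ, hZp, hZi, hZM⟩ := ih w hwl
    have hvw : v ≠ w := fun h => hvl (by simp [h])
    have hL : HasParity 0 (atVertex v g.lagrangian) :=
      g.hasParity_lagrangian.eval (vertex_isSubst v)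
    have hMi : ∀ x, x ≠ v → ∀ i k, Indep x (g.vertexMatrix v i k) :=
      fun x hx i k => (atVertex_indep hx.symm _).smul _
    -- The new edge takes α_i at `v` and β_i at `w`. The latter derivative turns the old `Y` into `Z
    -- i`; opening the β_k-input at `v` then produces the Hessian entry, multiplied on the right of
    -- `Z i`.
    refine ⟨∑ i, (-1 : ℂ) ^ pr (ceDeg deg i) •
        ((atVertex v g.lagrangian).pderiv (toLex (v, toLex (0, toLex (0, i)))) * Z i),
      fun k => ∑ i, Z i * g.vertexMatrix v i k, ?_, ?_, ?_, ?_, ?_⟩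
    · intro P hP hPi
      have hPL : HasParity 0 (P * atVertex v g.lagrangian) := hP.mul hL
      rw [List.zip_cons_cons, List.foldr_cons, List.map_cons, List.prod_cons, ← mul_assoc,
        hY _ hPL fun x hx => (hPi x (List.mem_cons_of_mem _ hx)).mul
          (atVertex_indep (fun h : v = x => hvl (h ▸ hx)) _), casimir, Finset.mul_sum]
      refine Finset.sum_congr rfl fun i _ => ?_
      have hw : Indep w (P * atVertex v g.lagrangian) :=
        (hPi w (by simp)).mul (atVertex_indep hvw _)
      rw [pderiv_mul, hw, zero_mul, zero_add, parityAlg_pow_of_even hPL, hYZ, mul_smul_comm,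
        pderiv_smul, pderiv_mul, hZi v hvl i, mul_zero, add_zero, pderiv_mul,
        hPi v (by simp), zero_mul, zero_add, parityAlg_pow_of_even hP, mul_smul_comm, mul_assoc]
    · intro k
      rw [pderiv_sum, Finset.smul_sum]
      refine Finset.sum_congr rfl fun i _ => ?_
      rw [pderiv_smul, pderiv_mul, hZi v hvl i, mul_zero, add_zero, pderiv_comm, atVertex_pderiv,
        atVertex_pderiv, pr_alpha, pr_beta]
      have hM : atVertex v ((g.lagrangian.pderiv (toLex (0, toLex (1, k)))).pderiv
          (toLex (0, toLex (0, i)))) = (-1 : ℂ) ^ pr (ceDeg deg k) • g.vertexMatrix v i k := by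
        rw [vertexMatrix, smul_smul, ← pow_add, ← two_mul, pow_mul]
        simp
      rw [hM, smul_mul_assoc, smul_mul_assoc,
        (g.hasParity_vertexMatrix v i k).mul_comm (hZp i), smul_smul, smul_smul, smul_smul,
        ← pow_add, ← pow_add, ← pow_add]
      congr 1
      -- Apart from even terms, the exponent exceeds the desired one by p + p² for the parity p of
      -- index i, so p = 0 and p = 1 are treated separately.
      rcases Nat.lt_or_ge (pr (ceDeg deg i)) 1 with h | h
      · rw [Nat.lt_one_iff.1 h]
        ring_nf
      · have : pr (ceDeg deg i) = 1 := le_antisymm (by unfold pr; split_ifs <;> simp) h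
        rw [this, ← neg_one_pow_two_mul_add (1 + pr (ceDeg deg k)) (pr (ceDeg deg k))]
        ring_nf
    · intro k
      refine HasParity.sum fun i _ => ((hZp i).mul (g.hasParity_vertexMatrix v i k)).congr ?_
      rw [← add_assoc, ← two_mul, neg_one_pow_two_mul_add]
    · intro x hx k
      refine Indep.sum fun i _ => (hZi x (fun h => hx (List.mem_cons_of_mem _ h)) i).mul
        (hMi x (fun h => hx (by simp [h])) i k)
    · intro j k
      have hu : (v :: w :: l).getLast (List.cons_ne_nil _ _) =
          (w :: l).getLast (List.cons_ne_nil _ _) := by simp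
      have huv : (w :: l).getLast (List.cons_ne_nil _ _) ≠ v :=
        fun h => hvl (h ▸ List.getLast_mem _)
      rw [hu, pderiv_sum, List.reverse_cons, List.map_append, List.prod_append, Matrix.mul_apply]
      refine Finset.sum_congr rfl fun i _ => ?_
      rw [pderiv_mul, hMi _ huv, mul_zero, add_zero, hZM]
      simp

/-- The contraction of a cycle of vertices. -/
theorem contraction_cycle [GradedComm gr] (g : CurvedLInfinity B I deg) (v : Fin n)
    (l : List (Fin n)) (hl : (v :: l).Nodup) :
    (((v :: l).getLast (List.cons_ne_nil _ _), v) :: (v :: l).zip l).foldr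
      (fun e F => casimir e.1 e.2 F)
        ((v :: l).map fun v => atVertex v g.lagrangian).prod =
      ∑ k, (-1 : ℂ) ^ pr (ceDeg deg k) • (((v :: l).reverse.map g.vertexMatrix).prod) k k := by
  obtain ⟨Y, Z, hY, hYZ, -, -, hZM⟩ := g.exists_chain v l hl
  have := hY 1 HasParity.one fun x _ => Indep.one x
  rw [one_mul, one_mul] at this
  -- The closing edge applies the two derivatives still open, β_k at the first vertex and α_k at the
  -- last one, and so turns the matrix product into a graded trace.
  rw [List.foldr_cons, this, casimir]
  refine Finset.sum_congr rfl fun k _ => ?_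
  rw [hYZ, pderiv_smul, hZM]

/-- Casimirs commute and the vertex factors are even, hence central; neither the labelling of the
edges nor that of the vertices matters, and the standard cycle suffices. -/
theorem contraction_eq_of_perm [GradedComm gr] (g : CurvedLInfinity B I deg) {γ : LabelledGraph n}
    {v : Fin n} {l : List (Fin n)} (hl : (v :: l).Perm (List.finRange n))
    (hγ : (List.ofFn γ).Perm
      (((v :: l).getLast (List.cons_ne_nil _ _), v) :: (v :: l).zip l)) :
    g.contraction γ =
      ∑ k, (-1 : ℂ) ^ pr (ceDeg deg k) • (((v :: l).reverse.map g.vertexMatrix).prod) k k := by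
  have hcomm : LeftCommutative fun (e : Fin n × Fin n) (F : GSeries gr (multiDeg deg n)) =>
      casimir e.1 e.2 F := ⟨fun e e' F => casimir_comm _ _ _ _ F⟩
  rw [← g.contraction_cycle v l (hl.nodup_iff.2 (List.nodup_finRange n)), contraction_eq,
    hγ.foldr_eq]
  congr 1
  symm
  refine (hl.map _).prod_eq' ?_
  refine List.pairwise_of_forall_mem_list fun a ha b _ => ?_
  obtain ⟨u, _, rfl⟩ := List.mem_map.1 ha
  exact HasParity.commute (g.hasParity_lagrangian.eval (vertex_isSubst u)) b

/-! ### Evaluation on the harmonic fields -/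

theorem harmonicField_eq (len : ℝ) (s : Fin 2 ×ₗ (Fin 2 ×ₗ Fin r)) (x : ℝ) :
    harmonicField gr deg len s x =
      (if (ofLex s).1 = 0 then (1 : ℂ) else 1 / (2 * (Real.pi : ℂ) * Complex.I * len)) •
        X gr (fieldDeg deg) s := by
  unfold harmonicField
  split_ifs
  · rw [one_smul]
  · rfl

theorem harmonicField_isSubst (len : ℝ) (x : ℝ) :
    IsSubst (fieldDeg deg) fun s => harmonicField gr deg len s x := by
  simp only [harmonicField_eq]
  exact IsSubst.of_smul_X (π := fun s => s) _ fun s => rfl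

theorem multiHarmonic_isSubst (len : ℝ) (x : Fin n → ℝ) :
    IsSubst (multiDeg deg n)
      fun p => harmonicField gr deg len (ofLex p).2 (x (ofLex p).1) := by
  simp only [harmonicField_eq]
  exact IsSubst.of_smul_X (π := fun p : Fin n ×ₗ (Fin 2 ×ₗ (Fin 2 ×ₗ Fin r)) => (ofLex p).2) _
    fun _ => rfl

/-- Weight one means that each monomial has exactly one factor from φ¹. Only this factor is rescaled
by dz = dx/(2πi len), so the substitution is multiplication by a scalar. -/
theorem eval_harmonicField [GradedComm gr] (len x : ℝ) {F : GSeries gr (fieldDeg deg)}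
    (hF : WtHom (formWeight (Fin 2 ×ₗ Fin r)) 1 F) :
    (F.eval fun s => harmonicField gr deg len s x) =
      (1 / (2 * (Real.pi : ℂ) * Complex.I * len)) • F := by
  simp only [harmonicField_eq]
  ext m
  rw [coeff_eval_smul_X, coeff_smul]
  by_cases hm : F.coeff m = 0
  · rw [hm, smul_zero, smul_zero]
  · congr 1
    have h := hF m hm
    have h0 : ∀ c : ℂ, (∏ s : Fin 2 ×ₗ (Fin 2 ×ₗ Fin r),
        (if (ofLex s).1 = 0 then (1 : ℂ) else c) ^ m s) = c ^ ∑ s, m (toLex (1, s)) := by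
      intro c
      rw [← Equiv.prod_comp toLex, Fintype.prod_prod_type, Fin.prod_univ_two]
      simp [Finset.prod_pow_eq_pow_sum]
    rw [h0]
    rw [wt, sum_lex] at h
    have h1 : ∑ s, m (toLex ((1 : Fin 2), s)) = 1 := by
      have h' : ∑ s : Fin 2 ×ₗ Fin r, (m (toLex ((1 : Fin 2), s)) : ℤ) = 1 := by
        simpa [formWeight] using h
      exact_mod_cast h'
    rw [h1, pow_one]

/-- The value of the contraction of a cyclic graph on the harmonic fields. -/
theorem eval_contraction_eq_of_perm [GradedComm gr] (g : CurvedLInfinity B I deg)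
    {γ : LabelledGraph n} {v : Fin n} {l : List (Fin n)} (hl : (v :: l).Perm (List.finRange n))
    (hγ : (List.ofFn γ).Perm
      (((v :: l).getLast (List.cons_ne_nil _ _), v) :: (v :: l).zip l))
    (len : ℝ) (x : Fin n → ℝ) :
    ((g.contraction γ).eval fun p => harmonicField gr deg len (ofLex p).2 (x (ofLex p).1)) =
      (-(1 / (2 * (Real.pi : ℂ) * Complex.I * len))) ^ n •
        pullbackForm (superTrace (g.atiyahMatrix ^ n)) := by
  have hφ := multiHarmonic_isSubst (gr := gr) (deg := deg) len x
  -- On constant fields all vertices carry the same matrix. The sign in `vertexMatrix` cancels the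
  -- one in `lagrangian_pderiv_pderiv`, leaving only the overall minus.
  have hM : ∀ u : Fin n, (evalAlg hφ).mapMatrix (g.vertexMatrix u) =
      (-(1 / (2 * (Real.pi : ℂ) * Complex.I * len))) •
        (evalAlg pullbackForm_isSubst).mapMatrix g.atiyahMatrix := by
    intro u
    ext1 i k
    simp only [AlgHom.mapMatrix_apply, Matrix.map_apply, Matrix.smul_apply, evalAlg_apply]
    rw [vertexMatrix, eval_smul hφ.fil, atVertex, eval_eval (vertex_isSubst u) hφ,
      lagrangian_pderiv_pderiv]
    have h1 : (fun s => (X gr (multiDeg deg n) (toLex (u, s))).eval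
        fun p => harmonicField gr deg len (ofLex p).2 (x (ofLex p).1)) =
        fun s => harmonicField gr deg len s (x u) := by
      funext s
      rw [eval_X hφ]
      rfl
    have hf := harmonicField_isSubst (gr := gr) (deg := deg) len (x u)
    rw [h1, eval_neg hf, eval_smul hf.fil,
      eval_harmonicField _ _ (formWeight_pullbackForm (g.formWeight_atiyahMatrix i k)), smul_neg,
      smul_smul, ← pow_add, ← two_mul, pow_mul, neg_smul]
    simp [pullbackForm]
  have hlen : (v :: l).length = n := by rw [hl.length_eq, List.length_finRange]
  rw [g.contraction_eq_of_perm hl hγ, eval_sum hφ, superTrace, pullbackForm,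
    eval_sum pullbackForm_isSubst, Finset.smul_sum]
  refine Finset.sum_congr rfl fun k _ => ?_
  rw [eval_smul hφ.fil, eval_smul pullbackForm_isSubst.fil, smul_comm, negOnePow_eq_pr]
  congr 1
  have h2 : (evalAlg hφ).mapMatrix ((v :: l).reverse.map g.vertexMatrix).prod =
      (-(1 / (2 * (Real.pi : ℂ) * Complex.I * len))) ^ n •
        (evalAlg pullbackForm_isSubst).mapMatrix (g.atiyahMatrix ^ n) := by
    rw [map_list_prod, List.map_map, map_pow, ← smul_pow, List.prod_eq_pow_card _ _ fun a ha => ?_]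
    · rw [List.length_map, List.length_reverse, hlen]
    · obtain ⟨u, _, rfl⟩ := List.mem_map.1 ha
      exact hM u
  exact congrFun (congrFun h2 k) k

end CurvedLInfinity

end Contraction

end

end ChernSimons

/-! ### Analytic side: Fourier expansion of the propagator -/

namespace ChernSimons

set_option linter.unusedSectionVars false

noncomputable section

open MeasureTheory

/-! ### Fourier series on the circle -/

/-- The function `e^{2πikx/len}`. -/
def circleChar (len : ℝ) (k : ℤ) (x : ℝ) : ℂ :=
  Complex.exp (2 * Real.pi * Complex.I * k * x / len)

theorem norm_circleChar (len : ℝ) (k : ℤ) (x : ℝ) : ‖circleChar len k x‖ = 1 := by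
  have : (2 * Real.pi * Complex.I * k * x / len : ℂ) =
      ((2 * Real.pi * k * x / len : ℝ) : ℂ) * Complex.I := by push_cast; ring
  rw [circleChar, this, Complex.norm_exp_ofReal_mul_I]

theorem circleChar_zero_right (len : ℝ) (k : ℤ) : circleChar len k 0 = 1 := by
  simp [circleChar]

theorem circleChar_zero_left (len x : ℝ) : circleChar len 0 x = 1 := by
  simp [circleChar]

theorem continuous_circleChar (len : ℝ) (k : ℤ) : Continuous (circleChar len k) := by
  unfold circleChar
  fun_prop

theorem hasDerivAt_circleChar (len : ℝ) (k : ℤ) (x : ℝ) :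
    HasDerivAt (circleChar len k)
      (2 * Real.pi * Complex.I * k / len * circleChar len k x) x := by
  have h : HasDerivAt (fun x : ℝ => (2 * Real.pi * Complex.I * k * x / len : ℂ))
      (2 * Real.pi * Complex.I * k / len) x := by
    have h0 := ((Complex.ofRealCLM.hasDerivAt (x := x)).const_mul
      (2 * Real.pi * Complex.I * k : ℂ)).div_const (len : ℂ)
    simpa using h0
  have := h.cexp
  rw [mul_comm (2 * Real.pi * Complex.I * k / len : ℂ) (circleChar len k x)]
  exact this

theorem integral_circleChar {len : ℝ} (hlen : 0 < len) (k : ℤ) :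
    ∫ x in Set.Ioc 0 len, circleChar len k x = if k = 0 then (len : ℂ) else 0 := by
  rw [← intervalIntegral.integral_of_le hlen.le]
  have hl : (len : ℂ) ≠ 0 := by exact_mod_cast hlen.ne'
  split_ifs with hk
  · subst hk
    simp [circleChar_zero_left]
  · have hc : (2 * Real.pi * Complex.I * k / len : ℂ) ≠ 0 := by
      have h1 : (Real.pi : ℂ) ≠ 0 := by exact_mod_cast Real.pi_ne_zero
      have h2 : (k : ℂ) ≠ 0 := by exact_mod_cast hk
      exact div_ne_zero (mul_ne_zero (mul_ne_zero (mul_ne_zero two_ne_zero h1)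
        Complex.I_ne_zero) h2) hl
    have h : ∀ x : ℝ, circleChar len k x =
        Complex.exp ((2 * Real.pi * Complex.I * k / len : ℂ) * x) := fun x => by
      rw [circleChar]; congr 1; ring
    simp only [h]
    rw [integral_exp_mul_complex hc]
    have : (2 * Real.pi * Complex.I * k / len : ℂ) * len = k * (2 * Real.pi * Complex.I) := by
      field_simp
    rw [this, Complex.exp_int_mul_two_pi_mul_I]
    simp

/-- The Fourier series with coefficients `c`. -/
def fourierSum (len : ℝ) (c : ℤ → ℂ) (x : ℝ) : ℂ := ∑' k, c k * circleChar len k x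

theorem norm_mul_circleChar (len : ℝ) (c : ℤ → ℂ) (k : ℤ) (x : ℝ) :
    ‖c k * circleChar len k x‖ = ‖c k‖ := by
  rw [norm_mul, norm_circleChar, mul_one]

section

variable {len : ℝ} {c d : ℤ → ℂ}

theorem continuous_fourierSum (hc : Summable fun k => ‖c k‖) : Continuous (fourierSum len c) :=
  continuous_tsum (fun k => continuous_const.mul (continuous_circleChar len k)) hc
    fun k x => (norm_mul_circleChar len c k x).le

theorem norm_fourierSum_le (hc : Summable fun k => ‖c k‖) (x : ℝ) :
    ‖fourierSum len c x‖ ≤ ∑' k, ‖c k‖ := by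
  have h : (fun k => ‖c k * circleChar len k x‖) = fun k => ‖c k‖ :=
    funext fun k => norm_mul_circleChar len c k x
  refine (norm_tsum_le_tsum_norm (by rw [h]; exact hc)).trans (le_of_eq ?_)
  rw [h]

theorem fourierSum_zero_right : fourierSum len c 0 = ∑' k, c k := by
  simp only [fourierSum, circleChar_zero_right, mul_one]

theorem circleChar_mul (len : ℝ) (k j : ℤ) (a y b : ℝ) :
    circleChar len k (a - y) * circleChar len j (y - b) =
      circleChar len k a * circleChar len (-j) b * circleChar len (j - k) y := by
  simp only [circleChar]
  rw [← Complex.exp_add, ← Complex.exp_add, ← Complex.exp_add]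
  congr 1
  push_cast
  ring

theorem integral_circleChar_mul (hlen : 0 < len) (k j : ℤ) (a b : ℝ) :
    ∫ y in Set.Ioc 0 len, circleChar len k (a - y) * circleChar len j (y - b) =
      if k = j then len * circleChar len j (a - b) else 0 := by
  simp only [circleChar_mul]
  rw [integral_const_mul, integral_circleChar hlen]
  by_cases h : k = j
  · subst h
    have := circleChar_mul len k k a 0 b
    rw [circleChar_zero_right, mul_one, sub_zero, zero_sub] at this
    rw [sub_self, if_pos rfl, if_pos rfl, ← this, mul_comm]
    congr 1
    simp only [circleChar]
    rw [← Complex.exp_add]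
    congr 1
    push_cast
    ring
  · rw [if_neg h, if_neg fun e => h (sub_eq_zero.1 e).symm, mul_zero]

/-- Absolute summability permits termwise integration, and orthogonality of the characters keeps
only the mode `j`. -/
theorem integral_fourierSum_mul_circleChar (hlen : 0 < len) (hc : Summable fun k => ‖c k‖)
    (j : ℤ) (a b : ℝ) :
    ∫ y in Set.Ioc 0 len, fourierSum len c (a - y) * circleChar len j (y - b) =
      len * c j * circleChar len j (a - b) := by
  have hcont : ∀ k, Continuous fun y =>
      c k * circleChar len k (a - y) * circleChar len j (y - b) := fun k =>
    (continuous_const.mul ((continuous_circleChar len k).comp (by fun_prop))).mul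
      ((continuous_circleChar len j).comp (by fun_prop))
  have hnorm : ∀ k y, ‖c k * circleChar len k (a - y) * circleChar len j (y - b)‖ = ‖c k‖ :=
    fun k y => by rw [norm_mul, norm_mul, norm_circleChar, norm_circleChar, mul_one, mul_one]
  have h := hasSum_integral_of_summable_integral_norm (μ := volume.restrict (Set.Ioc 0 len))
    (F := fun (k : ℤ) (y : ℝ) => c k * circleChar len k (a - y) * circleChar len j (y - b))
    (fun k => Integrable.of_bound (hcont k).aestronglyMeasurable ‖c k‖
      (Filter.Eventually.of_forall fun y => (hnorm k y).le))
    (by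
      simp only [hnorm, integral_const]
      exact hc.const_smul _)
  have h1 : ∀ y, ∑' k, c k * circleChar len k (a - y) * circleChar len j (y - b) =
      fourierSum len c (a - y) * circleChar len j (y - b) := fun y => by
    rw [tsum_mul_right, fourierSum]
  simp only [h1] at h
  rw [← h.tsum_eq, tsum_eq_single j]
  · simp only [mul_assoc]
    rw [integral_const_mul, integral_circleChar_mul hlen, if_pos rfl]
    ring
  · intro k hk
    simp only [mul_assoc]
    rw [integral_const_mul, integral_circleChar_mul hlen, if_neg hk, mul_zero]

theorem integral_fourierSum (hlen : 0 < len) (hc : Summable fun k => ‖c k‖) (a : ℝ) :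
    ∫ y in Set.Ioc 0 len, fourierSum len c (a - y) = len * c 0 := by
  have := integral_fourierSum_mul_circleChar hlen hc 0 a 0
  simpa [circleChar_zero_left] using this

/-- The convolution of Fourier series. -/
theorem integral_fourierSum_mul_fourierSum (hlen : 0 < len) (hc : Summable fun k => ‖c k‖)
    (hd : Summable fun k => ‖d k‖) (a b : ℝ) :
    ∫ y in Set.Ioc 0 len, fourierSum len c (a - y) * fourierSum len d (y - b) =
      fourierSum len (fun k => len * c k * d k) (a - b) := by
  have hcont : ∀ k, Continuous fun y =>
      d k * (fourierSum len c (a - y) * circleChar len k (y - b)) := fun k =>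
    continuous_const.mul (((continuous_fourierSum hc).comp (by fun_prop)).mul
      ((continuous_circleChar len k).comp (by fun_prop)))
  have hnorm : ∀ k y, ‖d k * (fourierSum len c (a - y) * circleChar len k (y - b))‖ ≤
      ‖d k‖ * ∑' k, ‖c k‖ := fun k y => by
    rw [norm_mul, norm_mul, norm_circleChar, mul_one]
    exact mul_le_mul_of_nonneg_left (norm_fourierSum_le hc _) (norm_nonneg _)
  have hint : ∀ k, Integrable (fun y =>
      d k * (fourierSum len c (a - y) * circleChar len k (y - b)))
      (volume.restrict (Set.Ioc 0 len)) := fun k =>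
    Integrable.of_bound (hcont k).aestronglyMeasurable _
      (Filter.Eventually.of_forall fun y => hnorm k y)
  have h := hasSum_integral_of_summable_integral_norm (μ := volume.restrict (Set.Ioc 0 len))
    (F := fun (k : ℤ) (y : ℝ) => d k * (fourierSum len c (a - y) * circleChar len k (y - b)))
    hint
    (by
      refine Summable.of_nonneg_of_le (fun k => integral_nonneg fun y => norm_nonneg _)
        (fun k => ?_) ((hd.mul_right (∑' k, ‖c k‖)).mul_left len)
      refine (integral_mono (hint k).norm (integrable_const _) (hnorm k)).trans (le_of_eq ?_)
      simp [hlen.le])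
  have h1 : ∀ y, ∑' k, d k * (fourierSum len c (a - y) * circleChar len k (y - b)) =
      fourierSum len c (a - y) * fourierSum len d (y - b) := fun y => by
    rw [fourierSum, fourierSum, ← tsum_mul_left]
    congr 1
    funext k
    ring
  simp only [h1] at h
  rw [← h.tsum_eq, fourierSum]
  congr 1
  funext k
  rw [integral_const_mul, integral_fourierSum_mul_circleChar hlen hc]
  ring

end

/-! ### The Fourier series of the propagator -/

/-- The eigenvalues of the Laplacian on the circle. -/
def eigenvalue (len : ℝ) (k : ℤ) : ℝ := (2 * Real.pi * k / len) ^ 2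

/-- The Fourier coefficients of the propagator. -/
def propCoeff (len ε L : ℝ) (k : ℤ) : ℂ :=
  Complex.I / (2 * Real.pi * k) *
    ((Real.exp (-(ε * eigenvalue len k)) - Real.exp (-(L * eigenvalue len k)) : ℝ) : ℂ)

theorem summable_pow_mul_exp {len t : ℝ} (hlen : 0 < len) (ht : 0 < t) (p : ℕ) :
    Summable fun k : ℤ => |(k : ℝ)| ^ p * Real.exp (-(t * eigenvalue len k)) := by
  -- With T = t(2π/len)²/π the Gaussian exponent -πTk² of the theta series is -tλ_k.
  have hT : 0 < t * (2 * Real.pi / len) ^ 2 / Real.pi := by positivity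
  have := summable_pow_mul_jacobiTheta₂_term_bound 0 hT p
  refine this.congr fun k => ?_
  push_cast
  congr 2
  unfold eigenvalue
  field_simp
  ring

theorem deriv_heatKernel {len t : ℝ} (hlen : 0 < len) (ht : 0 < t) (x : ℝ) :
    deriv (fun y : ℝ => heatKernel len t y) x =
      ∑' k : ℤ, (Real.exp (-(t * eigenvalue len k)) : ℂ) *
        ((1 / len : ℂ) * (2 * Real.pi * Complex.I * k / len) * circleChar len k x) := by
  have hu := (summable_pow_mul_exp hlen ht 1).mul_left (2 * Real.pi / len)
  have h := hasDerivAt_tsum (𝕜 := ℝ) (y₀ := 0) hu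
    (g := fun (k : ℤ) (y : ℝ) => (Real.exp (-(t * eigenvalue len k)) : ℂ) * circleChar len k y)
    (g' := fun (k : ℤ) (y : ℝ) => (Real.exp (-(t * eigenvalue len k)) : ℂ) *
      (2 * Real.pi * Complex.I * k / len * circleChar len k y))
    (fun k y => (hasDerivAt_circleChar len k y).const_mul _)
    (fun k y => by
      rw [norm_mul, norm_mul, norm_circleChar, mul_one, norm_div, norm_mul, norm_mul, norm_mul]
      simp only [Complex.norm_real, Complex.norm_I, Complex.norm_intCast, Complex.norm_ofNat,
        Real.norm_eq_abs, Real.abs_exp, abs_of_pos hlen, abs_of_pos Real.pi_pos]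
      apply le_of_eq
      ring)
    (by
      refine Summable.of_norm ?_
      refine (summable_pow_mul_exp hlen ht 0).congr fun k => ?_
      rw [norm_mul, norm_circleChar, Complex.norm_real, Real.norm_eq_abs, Real.abs_exp]
      simp) x
  have h2 := (h.const_mul (1 / (len : ℂ))).deriv
  have h3 : (fun y : ℝ => heatKernel len t y) = fun y => 1 / (len : ℂ) *
      ∑' k : ℤ, (Real.exp (-(t * eigenvalue len k)) : ℂ) * circleChar len k y := by
    funext y
    rw [heatKernel]
    congr 2
    funext k
    rw [circleChar, eigenvalue]
    push_cast
    rfl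
  rw [h3, h2, ← tsum_mul_left]
  congr 1
  funext k
  ring

theorem norm_propCoeff_le {len ε L : ℝ} (k : ℤ) :
    ‖propCoeff len ε L k‖ ≤
      Real.exp (-(ε * eigenvalue len k)) + Real.exp (-(L * eigenvalue len k)) := by
  have h1 : ‖Complex.I / (2 * Real.pi * k)‖ ≤ 1 := by
    rw [norm_div, norm_mul, norm_mul]
    simp only [Complex.norm_real, Complex.norm_I, Complex.norm_intCast, Complex.norm_ofNat,
      Real.norm_eq_abs, abs_of_pos Real.pi_pos]
    by_cases hk : k = 0
    · simp [hk]
    · have h2 : (1 : ℝ) ≤ |(k : ℝ)| := by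
        exact_mod_cast Int.one_le_abs hk
      have h3 := Real.pi_gt_three
      rw [div_le_one (by positivity)]
      nlinarith
  rw [propCoeff, norm_mul, Complex.norm_real, Real.norm_eq_abs]
  refine (mul_le_of_le_one_left (abs_nonneg _) h1).trans ?_
  refine (abs_sub _ _).trans ?_
  rw [Real.abs_exp, Real.abs_exp]

theorem summable_propCoeff {len ε L : ℝ} (hlen : 0 < len) (hε : 0 < ε) (hL : 0 < L) :
    Summable fun k => ‖propCoeff len ε L k‖ := by
  refine Summable.of_nonneg_of_le (fun _ => norm_nonneg _) (fun k => norm_propCoeff_le k) ?_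
  have h1 := summable_pow_mul_exp hlen hε 0
  have h2 := summable_pow_mul_exp hlen hL 0
  simp only [pow_zero, one_mul] at h1 h2
  exact h1.add h2

theorem integral_exp_eigenvalue {len : ℝ} (hlen : 0 < len) (ε L : ℝ) {k : ℤ} (hk : k ≠ 0) :
    ∫ t in ε..L, (Real.exp (-(t * eigenvalue len k)) : ℂ) =
      ((Real.exp (-(ε * eigenvalue len k)) - Real.exp (-(L * eigenvalue len k)) : ℝ) : ℂ) /
        eigenvalue len k := by
  have hk' : (k : ℝ) ≠ 0 := by exact_mod_cast hk
  have he : eigenvalue len k ≠ 0 := by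
    unfold eigenvalue
    have := Real.pi_ne_zero
    have := hlen.ne'
    positivity
  have he' : (-(eigenvalue len k) : ℂ) ≠ 0 := by
    rw [neg_ne_zero]
    exact_mod_cast he
  have h : ∀ t : ℝ, (Real.exp (-(t * eigenvalue len k)) : ℂ) =
      Complex.exp (-(eigenvalue len k : ℂ) * t) := fun t => by
    push_cast
    congr 1
    ring
  push_cast
  simp only [← Complex.ofReal_neg, ← Complex.ofReal_mul, ← Complex.ofReal_exp]
  simp only [h]
  rw [integral_exp_mul_complex he']
  rw [div_neg, ← neg_div, neg_sub]

/-- For t ≥ ε the derivative of the heat kernel is dominated by its series of norms at t = ε, so sum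
and integral may be exchanged. Integrating e^{-tλ_k} brings in 1/λ_k = len²/(2πk)², which turns the
factor 2πik/len² into i/(2πk). -/
theorem propagator_eq_fourierSum {len ε L : ℝ} (hlen : 0 < len) (hε : 0 < ε) (hL : ε ≤ L) (x : ℝ) :
    propagator len ε L x = fourierSum len (propCoeff len ε L) x := by
  have hcont : ∀ k : ℤ, Continuous fun t : ℝ => (Real.exp (-(t * eigenvalue len k)) : ℂ) *
        ((1 / len : ℂ) * (2 * Real.pi * Complex.I * k / len) * circleChar len k x) := fun k => by
    fun_prop
  have hnorm : ∀ (k : ℤ) (t : ℝ), ‖(Real.exp (-(t * eigenvalue len k)) : ℂ) *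
        ((1 / len : ℂ) * (2 * Real.pi * Complex.I * k / len) * circleChar len k x)‖ =
      (1 / len) * (2 * Real.pi / len) * (|(k : ℝ)| ^ 1 * Real.exp (-(t * eigenvalue len k))) := by
    intro k t
    rw [norm_mul, norm_mul, norm_mul, norm_circleChar, mul_one, norm_div, norm_div, norm_mul,
      norm_mul, norm_mul]
    simp only [Complex.norm_real, Complex.norm_I, Complex.norm_intCast, Complex.norm_ofNat,
      Real.norm_eq_abs, Real.abs_exp, abs_of_pos hlen, abs_of_pos Real.pi_pos, norm_one]
    ring
  have hint : ∀ k : ℤ, Integrable (fun t : ℝ => (Real.exp (-(t * eigenvalue len k)) : ℂ) *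
        ((1 / len : ℂ) * (2 * Real.pi * Complex.I * k / len) * circleChar len k x))
      (volume.restrict (Set.Ioc ε L)) := fun k =>
    ((hcont k).integrableOn_Icc).mono_set Set.Ioc_subset_Icc_self
  have h := hasSum_integral_of_summable_integral_norm (μ := volume.restrict (Set.Ioc ε L)) hint
    (by
      refine Summable.of_nonneg_of_le (fun k => integral_nonneg fun y => norm_nonneg _)
        (fun k => ?_) (((summable_pow_mul_exp hlen hε 1).mul_left
          ((1 / len) * (2 * Real.pi / len))).mul_left (L - ε))
      have hle : ∀ t ∈ Set.Ioc ε L, ‖(Real.exp (-(t * eigenvalue len k)) : ℂ) *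
          ((1 / len : ℂ) * (2 * Real.pi * Complex.I * k / len) * circleChar len k x)‖ ≤
          (1 / len) * (2 * Real.pi / len) *
            (|(k : ℝ)| ^ 1 * Real.exp (-(ε * eigenvalue len k))) := by
        intro t ht
        rw [hnorm]
        have : 0 ≤ eigenvalue len k := sq_nonneg _
        gcongr
        exact ht.1.le
      refine (setIntegral_mono_on (hint k).norm (integrableOn_const (by simp)) measurableSet_Ioc
        hle).trans (le_of_eq ?_)
      simp [hL])
  rw [propagator, intervalIntegral.integral_of_le hL]
  have h1 : ∫ t in Set.Ioc ε L, deriv (fun y : ℝ => heatKernel len t y) x =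
      ∫ t in Set.Ioc ε L, ∑' k : ℤ, (Real.exp (-(t * eigenvalue len k)) : ℂ) *
        ((1 / len : ℂ) * (2 * Real.pi * Complex.I * k / len) * circleChar len k x) :=
    setIntegral_congr_fun measurableSet_Ioc fun t ht =>
      deriv_heatKernel hlen (hε.trans ht.1) x
  rw [h1, ← h.tsum_eq, fourierSum]
  congr 1
  funext k
  rw [integral_mul_const, ← intervalIntegral.integral_of_le hL]
  -- The zero mode is killed by the derivative; `propCoeff` agrees because i/0 is 0 here.
  by_cases hk : k = 0
  · subst hk
    simp [propCoeff]
  · rw [integral_exp_eigenvalue hlen ε L hk, propCoeff, ← mul_assoc]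
    congr 1
    have h2 : (k : ℂ) ≠ 0 := by exact_mod_cast hk
    have h3 : (len : ℂ) ≠ 0 := by exact_mod_cast hlen.ne'
    have h4 : (Real.pi : ℂ) ≠ 0 := by exact_mod_cast Real.pi_ne_zero
    have h5 : ((eigenvalue len k : ℝ) : ℂ) = (2 * Real.pi * k / len) ^ 2 := by
      rw [eigenvalue]; push_cast; rfl
    rw [h5]
    field_simp

end

end ChernSimons

/-! ### Integration over the positions of the vertices, and the limits in ε and L -/

namespace ChernSimons

set_option linter.unusedSectionVars false

noncomputable section

open MeasureTheory

/-! ### Integrals over the configuration space of vertices -/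

/-- The measure on the configurations of `n` points on the circle. -/
abbrev boxMeasure (len : ℝ) (n : ℕ) : Measure (Fin n → ℝ) :=
  Measure.pi fun _ => volume.restrict (Set.Ioc 0 len)

theorem volume_restrict_box (len : ℝ) (n : ℕ) :
    (volume : Measure (Fin n → ℝ)).restrict (Set.pi Set.univ fun _ => Set.Ioc (0 : ℝ) len) =
      boxMeasure len n := by
  rw [volume_pi, Measure.restrict_pi_pi]

theorem integral_box_succ {len : ℝ} {n : ℕ} (i : Fin (n + 1)) (F : (Fin (n + 1) → ℝ) → ℂ) :
    ∫ x, F x ∂boxMeasure len (n + 1) =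
      ∫ p : ℝ × (Fin n → ℝ), F (i.insertNth p.1 p.2)
        ∂((volume.restrict (Set.Ioc 0 len)).prod (boxMeasure len n)) := by
  have h := (measurePreserving_piFinSuccAbove
    (fun _ : Fin (n + 1) => (volume : Measure ℝ).restrict (Set.Ioc 0 len)) i).symm
  rw [← h.integral_comp' (g := F)]
  rfl

theorem integral_box_perm {len : ℝ} {n : ℕ} (ρ : Equiv.Perm (Fin n)) (F : (Fin n → ℝ) → ℂ) :
    ∫ x, F (fun j => x (ρ j)) ∂boxMeasure len n = ∫ x, F x ∂boxMeasure len n := by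
  have h := measurePreserving_arrowCongr'
    (fun _ : Fin n => (volume : Measure ℝ).restrict (Set.Ioc 0 len))
    (fun _ : Fin n => (volume : Measure ℝ).restrict (Set.Ioc 0 len)) ρ.symm
    (MeasurableEquiv.refl ℝ) (fun _ => MeasurePreserving.id _)
  rw [← h.integral_comp' (g := F)]
  rfl

/-- The product of the values of `P` on the differences of consecutive terms of `a, l, b`. -/
def chainProd (P : ℝ → ℂ) : ℝ → List ℝ → ℝ → ℂ
  | a, [], b => P (a - b)
  | a, y :: l, b => P (a - y) * chainProd P y l b

theorem prod_map_zip_eq_chainProd {ι : Type*} (P : ℝ → ℂ) (x : ι → ℝ) (v : ι) (l : List ι)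
    (b : ℝ) :
    (((v :: l).zip l).map fun e => P (x e.1 - x e.2)).prod *
        P (x ((v :: l).getLast (List.cons_ne_nil _ _)) - b) =
      chainProd P (x v) (l.map x) b := by
  induction l generalizing v with
  | nil => simp [chainProd]
  | cons w l ih =>
    rw [List.map_cons, chainProd, ← ih w, List.zip_cons_cons, List.map_cons, List.prod_cons,
      List.getLast_cons (List.cons_ne_nil _ _), mul_assoc]

theorem continuous_chainProd {P : ℝ → ℂ} (hP : Continuous P)
    (n : ℕ) {T : Type*} [TopologicalSpace T] {a b : T → ℝ} {x : T → Fin n → ℝ}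
    (ha : Continuous a) (hb : Continuous b) (hx : Continuous x) :
    Continuous fun t => chainProd P (a t) (List.ofFn (x t)) (b t) := by
  induction n generalizing a with
  | zero =>
    simp only [List.ofFn_zero, chainProd]
    fun_prop
  | succ n ih =>
    simp only [List.ofFn_succ, chainProd]
    have h0 : Continuous fun t => x t 0 := (continuous_apply 0).comp hx
    exact (hP.comp (ha.sub h0)).mul (ih h0 (by fun_prop))

theorem norm_chainProd_le {P : ℝ → ℂ} {M : ℝ} (hM : ∀ x, ‖P x‖ ≤ M) (a : ℝ) (l : List ℝ) (b : ℝ) :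
    ‖chainProd P a l b‖ ≤ M ^ (l.length + 1) := by
  induction l generalizing a with
  | nil => simpa [chainProd] using hM _
  | cons y l ih =>
    have hM0 : 0 ≤ M := (norm_nonneg _).trans (hM 0)
    rw [chainProd, norm_mul, List.length_cons, pow_succ' M]
    exact mul_le_mul (hM _) (ih y) (norm_nonneg _) hM0

section

variable {len : ℝ} {c : ℤ → ℂ}

theorem summable_norm_mul_pow (hc : Summable fun k => ‖c k‖) (n : ℕ) :
    Summable fun k => ‖(len : ℂ) ^ n * c k ^ (n + 1)‖ := by
  simp only [norm_mul, norm_pow]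
  refine Summable.mul_left _ ?_
  have hM : ∀ k, ‖c k‖ ≤ ∑' j, ‖c j‖ := fun k =>
    hc.le_tsum k fun _ _ => norm_nonneg _
  refine Summable.of_nonneg_of_le (fun _ => by positivity) (fun k => ?_)
    (hc.mul_left ((∑' j, ‖c j‖) ^ n))
  rw [pow_succ]
  exact mul_le_mul_of_nonneg_right (pow_le_pow_left₀ (norm_nonneg _) (hM k) n) (norm_nonneg _)

/-- Each interior point is integrated by one convolution, which multiplies Fourier coefficients and
contributes a factor `len`. -/
theorem integral_chainProd (hlen : 0 < len) (hc : Summable fun k => ‖c k‖) (n : ℕ) (a b : ℝ) :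
    ∫ x, chainProd (fourierSum len c) a (List.ofFn x) b ∂boxMeasure len n =
      fourierSum len (fun k => (len : ℂ) ^ n * c k ^ (n + 1)) (a - b) := by
  induction n generalizing a with
  | zero =>
    have h1 : (boxMeasure len 0).real Set.univ = 1 := by
      simp [boxMeasure, Measure.real]
    simp [chainProd, h1]
  | succ n ih =>
    have hP := continuous_fourierSum (len := len) hc
    rw [integral_box_succ 0]
    simp only [List.ofFn_succ, chainProd, Fin.insertNth_zero', Fin.cons_zero, Fin.cons_succ]
    rw [integral_prod]
    · simp only [integral_const_mul]
      simp only [ih]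
      rw [integral_fourierSum_mul_fourierSum hlen hc (summable_norm_mul_pow hc n)]
      congr 1
      funext k
      ring
    · refine Integrable.of_bound (C := (∑' k, ‖c k‖) ^ (n + 2)) ?_
        (Filter.Eventually.of_forall fun p => ?_)
      · refine Continuous.aestronglyMeasurable ?_
        exact (hP.comp (by fun_prop)).mul
          (continuous_chainProd hP n continuous_fst continuous_const continuous_snd)
      · have := norm_chainProd_le (fun x => norm_fourierSum_le (len := len) hc x) a
          (p.1 :: List.ofFn p.2) b
        simpa [chainProd] using this

/-- Closing the chain evaluates its Fourier series at zero, which is the sum of the coefficients;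
the last integral supplies the missing factor `len`. This is the trace of a power of a convolution
operator. -/
theorem integral_chainProd_cyclic (hlen : 0 < len) (hc : Summable fun k => ‖c k‖) (n : ℕ) :
    ∫ x, chainProd (fourierSum len c) (x 0) (List.ofFn fun j : Fin n => x j.succ) (x 0)
        ∂boxMeasure len (n + 1) =
      ∑' k, ((len : ℂ) * c k) ^ (n + 1) := by
  have hP := continuous_fourierSum (len := len) hc
  rw [integral_box_succ 0]
  simp only [Fin.insertNth_zero', Fin.cons_zero, Fin.cons_succ]
  rw [integral_prod]
  · simp only [integral_chainProd hlen hc, sub_self, fourierSum_zero_right]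
    rw [integral_const]
    simp only [Measure.real, Measure.restrict_apply_univ, Real.volume_Ioc, sub_zero,
      ENNReal.toReal_ofReal hlen.le, Complex.real_smul]
    rw [← tsum_mul_left]
    congr 1
    funext k
    ring
  · refine Integrable.of_bound (C := (∑' k, ‖c k‖) ^ (n + 1)) ?_
      (Filter.Eventually.of_forall fun p => ?_)
    · exact (continuous_chainProd hP n continuous_fst continuous_fst
        continuous_snd).aestronglyMeasurable
    · have := norm_chainProd_le (fun x => norm_fourierSum_le (len := len) hc x) p.1
          (List.ofFn p.2) p.1
      simpa using this

theorem integral_prod_edges_of_perm (hlen : 0 < len) (hc : Summable fun k => ‖c k‖) {n : ℕ}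
    {γ : LabelledGraph (n + 1)} {v : Fin (n + 1)} {l : List (Fin (n + 1))}
    (hl : (v :: l).Perm (List.finRange (n + 1)))
    (hγ : (List.ofFn γ).Perm
      (((v :: l).getLast (List.cons_ne_nil _ _), v) :: (v :: l).zip l)) :
    ∫ x, ∏ e, fourierSum len c (x (γ e).1 - x (γ e).2) ∂boxMeasure len (n + 1) =
      ∑' k, ((len : ℂ) * c k) ^ (n + 1) := by
  have hlen' : (v :: l).length = n + 1 := by simpa using hl.length_eq
  have hll : l.length = n := by simpa using hlen'
  have hnd : (v :: l).Nodup := hl.nodup_iff.2 (List.nodup_finRange _)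
  -- The vertices in cyclic order; permuting the integration variables by ρ carries the given cycle
  -- to the standard one.
  let ρ : Fin (n + 1) → Fin (n + 1) := fun j => (v :: l).get (j.cast hlen'.symm)
  have hρ : Function.Injective ρ := fun i j h => by
    have := (List.nodup_iff_injective_get.1 hnd) h
    simpa using this
  let e : Equiv.Perm (Fin (n + 1)) := Equiv.ofBijective ρ (Finite.injective_iff_bijective.1 hρ)
  rw [← integral_chainProd_cyclic hlen hc n, ← integral_box_perm e
    fun x => chainProd (fourierSum len c) (x 0) (List.ofFn fun j : Fin n => x j.succ) (x 0)]
  congr 1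
  funext x
  have h2 : (List.ofFn fun j : Fin n => x (e j.succ)) = l.map x := by
    refine List.ext_get (by simp [hll]) fun i hi hi' => ?_
    simp [e, ρ]
  change _ = chainProd (fourierSum len c) (x v) (List.ofFn fun j : Fin n => x (e j.succ)) (x v)
  rw [h2, ← prod_map_zip_eq_chainProd, ← List.prod_ofFn]
  have h3 : (List.ofFn fun e => fourierSum len c (x (γ e).1 - x (γ e).2)) =
      (List.ofFn γ).map fun e => fourierSum len c (x e.1 - x e.2) := by
    rw [List.map_ofFn]; rfl
  rw [h3, (hγ.map _).prod_eq, List.map_cons, List.prod_cons, mul_comm]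

/-- A vertex that is no tail meets only the edge ending in it, so its position occurs in one
propagator alone; integrating over it extracts the vanishing zero mode. -/
theorem integral_prod_edges_eq_zero (hlen : 0 < len) (hc : Summable fun k => ‖c k‖) (h0 : c 0 = 0)
    {n : ℕ} {γ : LabelledGraph n} (h2 : Function.Bijective fun e => (γ e).2)
    (h1 : ¬ Function.Surjective fun e => (γ e).1) :
    ∫ x, ∏ e, fourierSum len c (x (γ e).1 - x (γ e).2) ∂boxMeasure len n = 0 := by
  obtain ⟨v, hv⟩ := not_forall.1 h1
  obtain ⟨e₀, he₀⟩ := h2.2 v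
  have hv' : ∀ e, (γ e).1 ≠ v := fun e he => hv ⟨e, he⟩
  match n, γ, v, e₀ with
  | 0, _, v, _ => exact v.elim0
  | n + 1, γ, v, e₀ =>
    have hP := continuous_fourierSum (len := len) hc
    rw [integral_box_succ v, integral_prod_symm]
    · refine integral_eq_zero_of_ae (Filter.Eventually.of_forall fun z => ?_)
      have hne : ∀ e ∈ Finset.univ.erase e₀, (γ e).2 ≠ v := fun e he h =>
        (Finset.mem_erase.1 he).1 (h2.1 (h.trans he₀.symm))
      obtain ⟨w, hw⟩ := Fin.exists_succAbove_eq (hv' e₀)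
      have key : ∀ y : ℝ, ∏ e, fourierSum len c
          ((v.insertNth y z : Fin (n + 1) → ℝ) (γ e).1 -
            (v.insertNth y z : Fin (n + 1) → ℝ) (γ e).2) =
          (∏ e ∈ Finset.univ.erase e₀, fourierSum len c
            ((v.insertNth 0 z : Fin (n + 1) → ℝ) (γ e).1 -
              (v.insertNth 0 z : Fin (n + 1) → ℝ) (γ e).2)) * fourierSum len c (z w - y) := by
        intro y
        have hins : ∀ u, u ≠ v → (v.insertNth y z : Fin (n + 1) → ℝ) u =
            (v.insertNth 0 z : Fin (n + 1) → ℝ) u := fun u hu => by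
          obtain ⟨u', rfl⟩ := Fin.exists_succAbove_eq hu
          simp
        rw [← Finset.prod_erase_mul _ _ (Finset.mem_univ e₀)]
        congr 1
        · refine Finset.prod_congr rfl fun e he => ?_
          rw [hins _ (hv' e), hins _ (hne e he)]
        · have he₀' : (γ e₀).2 = v := he₀
          rw [he₀', ← hw]
          simp
      simp only [key]
      rw [integral_const_mul, integral_fourierSum hlen hc, h0, mul_zero, mul_zero]
      rfl
    · refine Integrable.of_bound (C := (∑' k, ‖c k‖) ^ (n + 1)) ?_
        (Filter.Eventually.of_forall fun p => ?_)
      · refine Continuous.aestronglyMeasurable ?_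
        have hins : Continuous fun p : ℝ × (Fin n → ℝ) =>
            (v.insertNth p.1 p.2 : Fin (n + 1) → ℝ) :=
          continuous_pi fun u => by
            rcases Fin.eq_self_or_eq_succAbove v u with rfl | ⟨j, rfl⟩
            · simpa using continuous_fst
            · simp only [Fin.insertNth_apply_succAbove]
              fun_prop
        refine continuous_finsetProd _ fun e _ => hP.comp ?_
        exact ((continuous_apply _).comp hins).sub ((continuous_apply _).comp hins)
      · rw [norm_prod]
        refine (Finset.prod_le_prod (fun _ _ => norm_nonneg _)
          fun e _ => norm_fourierSum_le (len := len) hc _).trans ?_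
        simp

end

/-! ### The cyclic integrals and their limits -/

/-- The integral of the product of the propagators over the cycle with `n` vertices. -/
def cycleSum (len ε L : ℝ) (n : ℕ) : ℂ := ∑' k, ((len : ℂ) * propCoeff len ε L k) ^ n

theorem eigenvalue_nonneg (len : ℝ) (k : ℤ) : 0 ≤ eigenvalue len k := sq_nonneg _

theorem propCoeff_zero (len ε L : ℝ) : propCoeff len ε L 0 = 0 := by simp [propCoeff]

theorem propCoeff_neg (len ε L : ℝ) (k : ℤ) : propCoeff len ε L (-k) = -propCoeff len ε L k := by
  have h : eigenvalue len (-k) = eigenvalue len k := by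
    unfold eigenvalue
    push_cast
    ring
  rw [propCoeff, propCoeff, h]
  push_cast
  rw [mul_neg, div_neg, neg_mul]

/-- The Fourier coefficients of the propagator are odd in k, so the terms at k and -k cancel. This
includes n = 1, where the bound |k|^{-n} would not be summable. -/
theorem cycleSum_eq_zero_of_odd (len ε L : ℝ) {n : ℕ} (hn : Odd n) : cycleSum len ε L n = 0 := by
  have h : cycleSum len ε L n = -cycleSum len ε L n := by
    conv_lhs => rw [cycleSum, ← (Equiv.neg ℤ).tsum_eq]
    rw [cycleSum, ← tsum_neg]
    congr 1
    funext k
    rw [Equiv.neg_apply, propCoeff_neg, mul_neg, hn.neg_pow]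
  exact self_eq_neg.1 h

/-- A summable bound for the terms of the cyclic sums. -/
def cycleBound (len : ℝ) (n : ℕ) (k : ℤ) : ℝ := (len / (2 * Real.pi)) ^ n * |1 / (k : ℝ) ^ n|

theorem summable_cycleBound (len : ℝ) {n : ℕ} (hn : 1 < n) : Summable (cycleBound len n) :=
  (Real.summable_one_div_int_pow.2 hn).abs.mul_left _

/-- The difference of the two exponentials has absolute value at most 1 whatever ε, L ≥ 0 are, which
gives one dominating series for both limits. -/
theorem norm_cycle_term_le {len ε L : ℝ} (hlen : 0 < len) (hε : 0 ≤ ε) (hL : 0 ≤ L) (n : ℕ)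
    (k : ℤ) : ‖((len : ℂ) * propCoeff len ε L k) ^ n‖ ≤ cycleBound len n k := by
  have h1 : |Real.exp (-(ε * eigenvalue len k)) - Real.exp (-(L * eigenvalue len k))| ≤ 1 := by
    have he := eigenvalue_nonneg len k
    have h2 : Real.exp (-(ε * eigenvalue len k)) ≤ 1 :=
      Real.exp_le_one_iff.2 (by have := mul_nonneg hε he; linarith)
    have h3 : Real.exp (-(L * eigenvalue len k)) ≤ 1 :=
      Real.exp_le_one_iff.2 (by have := mul_nonneg hL he; linarith)
    have h4 := Real.exp_pos (-(ε * eigenvalue len k))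
    have h5 := Real.exp_pos (-(L * eigenvalue len k))
    rw [abs_le]
    constructor <;> linarith
  have h6 : ‖(len : ℂ) * propCoeff len ε L k‖ ≤ len / (2 * Real.pi) * |1 / (k : ℝ)| := by
    rw [propCoeff, norm_mul, norm_mul, norm_div, norm_mul, norm_mul]
    simp only [Complex.norm_real, Complex.norm_I, Complex.norm_intCast, Complex.norm_ofNat,
      Real.norm_eq_abs, abs_of_pos Real.pi_pos, abs_of_pos hlen]
    calc _ ≤ len * (1 / (2 * Real.pi * |(k : ℝ)|) * 1) := by gcongr
      _ = _ := by rw [abs_div, abs_one]; ring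
  rw [norm_pow, cycleBound]
  refine (pow_le_pow_left₀ (norm_nonneg _) h6 n).trans (le_of_eq ?_)
  rw [mul_pow, ← abs_pow, div_pow 1, one_pow]

theorem tendsto_cycleSum_zero {len L : ℝ} (hlen : 0 < len) (hL : 0 ≤ L) {n : ℕ} (hn : 1 < n) :
    Filter.Tendsto (fun ε => cycleSum len ε L n) (nhdsWithin 0 (Set.Ioi 0))
      (nhds (cycleSum len 0 L n)) := by
  refine tendsto_tsum_of_dominated_convergence (summable_cycleBound len hn) (fun k => ?_) ?_
  · have : Continuous fun ε : ℝ => ((len : ℂ) * propCoeff len ε L k) ^ n := by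
      unfold propCoeff
      fun_prop
    exact this.continuousAt.continuousWithinAt
  · filter_upwards [self_mem_nhdsWithin] with ε hε k
    exact norm_cycle_term_le hlen (le_of_lt hε) hL n k

theorem tendsto_cycleSum_atTop {len : ℝ} (hlen : 0 < len) {n : ℕ} (hn : 1 < n) :
    Filter.Tendsto (fun L => cycleSum len 0 L n) Filter.atTop
      (nhds (∑' k : ℤ, ((len : ℂ) * (Complex.I / (2 * Real.pi * k))) ^ n)) := by
  refine tendsto_tsum_of_dominated_convergence (summable_cycleBound len hn) (fun k => ?_) ?_
  · by_cases hk : k = 0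
    · subst hk
      simp [propCoeff_zero]
    · have he : 0 < eigenvalue len k := by
        unfold eigenvalue
        have hk' : (k : ℝ) ≠ 0 := by exact_mod_cast hk
        have := Real.pi_ne_zero
        have := hlen.ne'
        positivity
      have h1 : Filter.Tendsto (fun L : ℝ => Real.exp (-(L * eigenvalue len k))) Filter.atTop
          (nhds 0) :=
        Real.tendsto_exp_neg_atTop_nhds_zero.comp (Filter.tendsto_id.atTop_mul_const he)
      have h2 : Filter.Tendsto (fun L : ℝ => ((Real.exp (-(0 * eigenvalue len k)) -
          Real.exp (-(L * eigenvalue len k)) : ℝ) : ℂ)) Filter.atTop (nhds 1) := by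
        have h3 := (tendsto_const_nhds (x := Real.exp (-(0 * eigenvalue len k)))).sub h1
        have h4 := (Complex.continuous_ofReal.tendsto _).comp h3
        rw [zero_mul, neg_zero, Real.exp_zero, sub_zero, Complex.ofReal_one] at h4
        simpa only [zero_mul, neg_zero, Real.exp_zero, Function.comp_def] using h4
      have h5 := ((h2.const_mul (Complex.I / (2 * Real.pi * k))).const_mul (len : ℂ)).pow n
      rw [mul_one] at h5
      exact h5
  · filter_upwards [Filter.eventually_ge_atTop 0] with L hL k
    exact norm_cycle_term_le hlen le_rfl hL n k

/-- For even exponents k and -k contribute equally, whence 2ζ(n); the term k = 0 is zero by the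
convention on division. -/
theorem tsum_cycle_limit (len : ℝ) {n : ℕ} (hn : 1 < n) (he : Even n) :
    ∑' k : ℤ, ((len : ℂ) * (Complex.I / (2 * Real.pi * k))) ^ n =
      2 * riemannZeta n * ((len : ℂ) * Complex.I / (2 * Real.pi)) ^ n := by
  have h : ∀ k : ℤ, ((len : ℂ) * (Complex.I / (2 * Real.pi * k))) ^ n =
      ((len : ℂ) * Complex.I / (2 * Real.pi)) ^ n * (1 / (k : ℂ) ^ n) := fun k => by
    rw [← one_div_pow, ← mul_pow]
    congr 1
    rw [div_mul_div_comm, mul_one, mul_div_assoc]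
  simp only [h]
  rw [tsum_mul_left, mul_comm]
  congr 1
  rw [two_mul_riemannZeta_eq_tsum_int_inv_pow_of_even hn he]
  simp

end

end ChernSimons

/-! ### Combinatorics of labelled directed cycles -/

namespace ChernSimons

set_option linter.unusedSectionVars false

noncomputable section

open Equiv

/-! ### Cyclic graphs -/

namespace LabelledGraph

/-- The graph with edges `t e → h (t e)`. -/
def ofPerms {n : ℕ} (t h : Perm (Fin n)) : LabelledGraph n := fun e => (t e, h (t e))

theorem exists_eq_ofPerms {n : ℕ} {γ : LabelledGraph n}
    (h1 : Function.Bijective fun e => (γ e).1) (h2 : Function.Bijective fun e => (γ e).2) :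
    ∃ t h : Perm (Fin n), γ = ofPerms t h := by
  refine ⟨Equiv.ofBijective _ h1, (Equiv.ofBijective _ h1).symm.trans (Equiv.ofBijective _ h2), ?_⟩
  funext e
  refine Prod.ext rfl ?_
  simp only [ofPerms, Equiv.trans_apply, Equiv.symm_apply_apply]
  rfl

theorem ofPerms_injective {n : ℕ} {t t' h h' : Perm (Fin n)} (H : ofPerms t h = ofPerms t' h') :
    t = t' ∧ h = h' := by
  have ht : t = t' := Equiv.ext fun e => congrArg Prod.fst (congrFun H e)
  subst ht
  refine ⟨rfl, Equiv.ext fun v => ?_⟩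
  have := congrArg Prod.snd (congrFun H (t.symm v))
  simpa [ofPerms] using this

/-- Each vertex v is joined exactly to h v and to its preimage, so the connected components are the
orbits of `h`. -/
theorem isConnected_ofPerms_iff {n : ℕ} (t h : Perm (Fin (n + 1))) :
    (ofPerms t h).IsConnected ↔ h.IsCycleOn (Set.univ : Set (Fin (n + 1))) := by
  have hr : ∀ v w, (∃ e, ofPerms t h e = (v, w)) ↔ h v = w := fun v w => by
    constructor
    · rintro ⟨e, he⟩
      rw [ofPerms, Prod.mk.injEq] at he
      rw [← he.1, he.2]
    · rintro rfl
      exact ⟨t.symm v, by simp [ofPerms]⟩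
  unfold IsConnected
  simp only [hr]
  set G := SimpleGraph.fromRel fun v w => h v = w with hG
  have hstep : ∀ v, G.Reachable v (h v) := fun v => by
    by_cases hv : v = h v
    · rw [← hv]
    · refine SimpleGraph.Adj.reachable ?_
      rw [hG, SimpleGraph.fromRel_adj]
      exact ⟨hv, Or.inl rfl⟩
  constructor
  · intro hc
    refine ⟨Set.bijOn_univ.2 h.bijective, fun x hx y hy => ?_⟩
    clear hx hy
    obtain ⟨p⟩ := hc.preconnected x y
    induction p with
    | nil => exact Perm.SameCycle.refl _ _
    | cons hadj _ ih =>
      rw [hG, SimpleGraph.fromRel_adj] at hadj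
      refine Perm.SameCycle.trans ?_ ih
      rcases hadj.2 with e | e
      · exact ⟨1, by simpa using e⟩
      · exact Perm.SameCycle.symm ⟨1, by simpa using e⟩
  · intro hc
    have : Nonempty (Fin (n + 1)) := ⟨0⟩
    refine SimpleGraph.Connected.mk fun x y => ?_
    obtain ⟨i, rfl⟩ := (hc.2 (Set.mem_univ x) (Set.mem_univ y)).exists_nat_pow_eq
    induction i with
    | zero => exact SimpleGraph.Reachable.refl _
    | succ i ih =>
      rw [pow_succ', Perm.mul_apply]
      exact ih.trans (hstep _)

theorem not_isConnected_zero (γ : LabelledGraph 0) : ¬ γ.IsConnected := fun h =>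
  h.nonempty.elim fun v => v.elim0

/-- The vertices of a connected graph that is a directed cycle can be listed in cyclic order. -/
theorem exists_cyclic_list {n : ℕ} {t h : Perm (Fin (n + 1))}
    (hc : h.IsCycleOn (Set.univ : Set (Fin (n + 1)))) :
    ∃ (v : Fin (n + 1)) (l : List (Fin (n + 1))), (v :: l).Perm (List.finRange (n + 1)) ∧
      (List.ofFn (ofPerms t h)).Perm
        (((v :: l).getLast (List.cons_ne_nil _ _), v) :: (v :: l).zip l) := by
  -- The orbit of 0 fills all n + 1 vertices, so it closes up after n + 1 steps.
  have hcard : ∀ v, (h ^ (n + 1)) v = v := fun v => by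
    have hc' : h.IsCycleOn ((Finset.univ : Finset (Fin (n + 1))) : Set (Fin (n + 1))) := by
      simpa using hc
    have := hc'.pow_card_apply (Finset.mem_univ v)
    simpa using this
  have hlist : (0 : Fin (n + 1)) :: List.ofFn (fun j : Fin n => (h ^ ((j : ℕ) + 1)) 0) =
      List.ofFn fun j : Fin (n + 1) => (h ^ (j : ℕ)) 0 := by
    rw [List.ofFn_succ]
    rfl
  have hsurj : Function.Surjective fun j : Fin (n + 1) => (h ^ (j : ℕ)) 0 := fun y => by
    have hc' : h.IsCycleOn ((Finset.univ : Finset (Fin (n + 1))) : Set (Fin (n + 1))) := by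
      simpa using hc
    obtain ⟨i, hi, e⟩ := hc'.exists_pow_eq (Finset.mem_univ 0) (Finset.mem_univ y)
    exact ⟨⟨i, by simpa using hi⟩, e⟩
  have hbij : Function.Bijective fun j : Fin (n + 1) => (h ^ (j : ℕ)) 0 :=
    Finite.surjective_iff_bijective.1 hsurj
  have hperm : (List.ofFn fun j : Fin (n + 1) => (h ^ (j : ℕ)) 0).Perm
      (List.finRange (n + 1)) := by
    refine (List.perm_ext_iff_of_nodup (List.nodup_ofFn.2 hbij.1) (List.nodup_finRange _)).2
      fun y => ?_
    simp only [List.mem_ofFn', List.mem_finRange, iff_true]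
    exact hsurj y
  refine ⟨0, List.ofFn fun j : Fin n => (h ^ ((j : ℕ) + 1)) 0, hlist ▸ hperm, ?_⟩
  have ht : (List.ofFn t).Perm (List.finRange (n + 1)) := by
    refine (List.perm_ext_iff_of_nodup (List.nodup_ofFn.2 t.injective) (List.nodup_finRange _)).2
      fun y => ?_
    simp only [List.mem_ofFn', List.mem_finRange, iff_true]
    exact t.surjective y
  have h1 : List.ofFn (ofPerms t h) = (List.ofFn t).map fun a => (a, h a) := by
    rw [List.map_ofFn]
    rfl
  -- Along the orbit, the pairs (a, h a) are the consecutive pairs of the list followed by the edge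
  -- returning from its end to 0.
  have h2 : ((List.ofFn fun j : Fin (n + 1) => (h ^ (j : ℕ)) 0).map fun a => (a, h a)) =
      ((0 : Fin (n + 1)) :: List.ofFn (fun j : Fin n => (h ^ ((j : ℕ) + 1)) 0)).zip
        (List.ofFn fun j : Fin n => (h ^ ((j : ℕ) + 1)) 0) ++ [((h ^ n) 0, 0)] := by
    rw [List.map_ofFn, List.ofFn_succ', List.concat_eq_append]
    congr 1
    · rw [hlist]
      refine List.ext_get (by simp) fun i hi hi' => ?_
      simp [-List.ofFn_succ, pow_succ', Perm.mul_apply]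
    · have := hcard 0
      rw [pow_succ', Perm.mul_apply] at this
      simp [this]
  have h3 : ((0 : Fin (n + 1)) :: List.ofFn (fun j : Fin n => (h ^ ((j : ℕ) + 1)) 0)).getLast
      (List.cons_ne_nil _ _) = (h ^ n) 0 := by
    simp only [hlist]
    rw [List.getLast_eq_getElem]
    simp [-List.ofFn_succ]
  rw [h1, h3]
  refine ((ht.trans hperm.symm).map _).trans ?_
  rw [h2]
  exact List.perm_append_singleton _ _

/-- Cycle types ignore fixed points, so the single cycle on one vertex has to be excluded. -/
theorem isCycleOn_univ_iff_cycleType {n : ℕ} (hn : 2 ≤ n) (h : Perm (Fin n)) :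
    h.IsCycleOn (Set.univ : Set (Fin n)) ↔ h.cycleType = {n} := by
  have : Nontrivial (Fin n) := Fin.nontrivial_iff_two_le.2 hn
  constructor
  · intro hc
    have hcyc : h.IsCycle := Perm.isCycle_iff_exists_isCycleOn.2
      ⟨Set.univ, Set.nontrivial_univ, hc, fun _ _ => Set.mem_univ _⟩
    rw [hcyc.cycleType]
    have : h.support = Finset.univ := by
      ext x
      simp only [Perm.mem_support, Finset.mem_univ, iff_true]
      exact hc.apply_ne Set.nontrivial_univ (Set.mem_univ x)
    rw [this]
    simp
  · intro hc
    have hcyc : h.IsCycle := by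
      rw [← Perm.card_cycleType_eq_one, hc, Multiset.card_singleton]
    have hs : h.support = Finset.univ := by
      rw [← Finset.card_eq_iff_eq_univ]
      have := Perm.sum_cycleType h
      rw [hc, Multiset.sum_singleton] at this
      simp [← this]
    have huniv : {x | h x ≠ x} = Set.univ := Set.eq_univ_of_forall fun x =>
      Perm.mem_support.1 (hs ▸ Finset.mem_univ x)
    exact huniv ▸ hcyc.isCycleOn

-- Such a graph is a labelling `t` of the edges by their tails, n! choices, together with a
-- successor map that is an n-cycle, (n-1)! choices.
open Classical in
theorem card_connected_bijective {n : ℕ} (hn : 2 ≤ n) :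
    (Finset.univ.filter fun γ : LabelledGraph n => γ.IsConnected ∧
      (Function.Bijective fun e => (γ e).1) ∧ Function.Bijective fun e => (γ e).2).card =
      n.factorial * (n - 1).factorial := by
  obtain ⟨k, rfl⟩ : ∃ k, n = k + 1 := ⟨n - 1, by omega⟩
  have hcount : ((Finset.univ : Finset (Perm (Fin (k + 1)))) ×ˢ
      (Finset.univ.filter fun h : Perm (Fin (k + 1)) => h.cycleType = {k + 1})).card =
      (k + 1).factorial * k.factorial := by
    rw [Finset.card_product, Perm.card_of_cycleType_singleton hn (by simp), Finset.card_univ,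
      Fintype.card_perm]
    simp
  rw [Nat.add_sub_cancel, ← hcount]
  symm
  refine Finset.card_bij (fun p _ => ofPerms p.1 p.2) ?_ ?_ ?_
  · rintro ⟨t, h⟩ hp
    simp only [Finset.mem_product, Finset.mem_univ, true_and, Finset.mem_filter] at hp ⊢
    refine ⟨(isConnected_ofPerms_iff t h).2 ((isCycleOn_univ_iff_cycleType hn h).2 hp),
      t.bijective, (h.bijective.comp t.bijective)⟩
  · rintro ⟨t, h⟩ _ ⟨t', h'⟩ _ H
    obtain ⟨rfl, rfl⟩ := ofPerms_injective H
    rfl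
  · intro γ hγ
    simp only [Finset.mem_filter, Finset.mem_univ, true_and] at hγ
    obtain ⟨t, h, rfl⟩ := exists_eq_ofPerms hγ.2.1 hγ.2.2
    refine ⟨(t, h), ?_, rfl⟩
    simp only [Finset.mem_product, Finset.mem_univ, true_and, Finset.mem_filter]
    exact (isCycleOn_univ_iff_cycleType hn h).1 ((isConnected_ofPerms_iff t h).1 hγ.1)

end LabelledGraph

end

end ChernSimons

/-! ### Todd and A-hat power series, Bernoulli numbers and zeta values -/

namespace ChernSimons

set_option linter.unusedSectionVars false

noncomputable section

open PowerSeries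

/-! ### The logarithms of the Todd and A-hat series -/

/-- The chain rule gives f (log f)' = f'. Together with the constant term this determines the
logarithm, and it is the form in which logarithms are handled here. -/
theorem derivative_logSeries_mul {f : PowerSeries ℂ} (hf : constantCoeff f = 1) :
    d⁄dX ℂ (logSeries f) * f = d⁄dX ℂ f := by
  have hs : HasSubst (f - 1) := HasSubst.of_constantCoeff_zero' (by simp [hf])
  -- The derivative of log(1 + X) is the alternating geometric series.
  have h1 : d⁄dX ℂ (PowerSeries.log ℂ) * (1 + X) = 1 := by
    rw [deriv_log]
    ext n
    rw [mul_add, mul_one, map_add]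
    cases n with
    | zero => simp
    | succ n => simp [coeff_succ_mul_X, coeff_one, pow_succ]
  have h2 := congrArg (substAlgHom (R := ℂ) hs) h1
  rw [map_mul, map_add, map_one] at h2
  simp only [coe_substAlgHom, subst_X hs] at h2
  rw [add_sub_cancel] at h2
  rw [logSeries, derivative_subst hs, mul_right_comm, h2, one_mul, map_sub]
  simp

theorem constantCoeff_logSeries {f : PowerSeries ℂ} (hf : constantCoeff f = 1) :
    constantCoeff (logSeries f) = 0 := constantCoeff_logOf hf

theorem X_mul_inv_toddSeries :
    X * (PowerSeries.mk fun n => (-1 : ℂ) ^ n / ((n + 1).factorial : ℂ)) =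
      1 - evalNegHom (exp ℂ) := by
  ext n
  cases n with
  | zero =>
    rw [coeff_zero_X_mul]
    simp [evalNegHom, -coeff_zero_eq_constantCoeff, coeff_rescale]
  | succ n =>
    rw [coeff_succ_X_mul, coeff_mk]
    simp [evalNegHom, coeff_rescale, coeff_one, coeff_exp, pow_succ, div_eq_mul_inv]

theorem toddSeries_mul : toddSeries * (1 - evalNegHom (exp ℂ)) = X := by
  rw [← X_mul_inv_toddSeries, toddSeries, mul_left_comm, PowerSeries.inv_mul_cancel, mul_one]
  simp

theorem constantCoeff_toddSeries : constantCoeff toddSeries = 1 := by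
  simp [toddSeries]

/-- Multiplying the generating identity of the Bernoulli numbers by e^{-X} gives the equation Q(1 -
e^{-X}) = X, and 1 - e^{-X} can be cancelled. -/
theorem toddSeries_eq_bernoulli : toddSeries = bernoulli'PowerSeries ℂ := by
  have hne : (1 - evalNegHom (exp ℂ)) ≠ 0 := fun h => by
    have := toddSeries_mul
    rw [h, mul_zero] at this
    exact X_ne_zero this.symm
  refine mul_right_cancel₀ hne ?_
  rw [toddSeries_mul]
  have h := bernoulli'PowerSeries_mul_exp_sub_one ℂ
  have hE := exp_mul_exp_neg_eq_one (A := ℂ)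
  have h2 := congrArg (· * evalNegHom (exp ℂ)) h
  simp only [mul_assoc, sub_mul, hE, one_mul, mul_one] at h2
  exact h2.symm

theorem derivative_evalNegHom_exp :
    d⁄dX ℂ (evalNegHom (exp ℂ)) = -evalNegHom (exp ℂ) := by
  ext n
  simp only [coeff_derivative, evalNegHom, coeff_rescale, coeff_exp, map_neg]
  have h : ((n + 1).factorial : ℂ) = (n + 1) * n.factorial := by
    rw [Nat.factorial_succ]; push_cast; ring
  have h1 : (n + 1 : ℂ) ≠ 0 := Nat.cast_add_one_ne_zero n
  have h2 : (n.factorial : ℂ) ≠ 0 := by exact_mod_cast n.factorial_ne_zero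
  simp only [map_div₀, map_one, map_natCast, h]
  field_simp
  ring

/-- Differentiate Q(1 - e^{-X}) = X and eliminate the exponential by the same equation: X Q' = Q(1 +
X - Q), then divide by Q. -/
theorem X_mul_derivative_log_toddSeries :
    X * d⁄dX ℂ (logSeries toddSeries) = 1 + X - toddSeries := by
  have hQ : toddSeries ≠ 0 := fun h => by
    have := constantCoeff_toddSeries
    simp [h] at this
  have h1 := toddSeries_mul
  have h2 := congrArg (d⁄dX ℂ) h1
  simp only [Derivation.leibniz, smul_eq_mul, map_sub, derivative_evalNegHom_exp,
    derivative_X, Derivation.map_one_eq_zero] at h2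
  have h3 := derivative_logSeries_mul constantCoeff_toddSeries
  refine mul_right_cancel₀ hQ ?_
  linear_combination X * h3 + toddSeries * h2 +
    (-(d⁄dX ℂ toddSeries) + toddSeries) * h1

theorem coeff_log_toddSeries (n : ℕ) :
    coeff (n + 1) (logSeries toddSeries) * (n + 1) =
      (if n = 0 then 1 else 0) - (bernoulli' (n + 1) : ℂ) / (n + 1).factorial := by
  have h := congrArg (coeff (n + 1)) X_mul_derivative_log_toddSeries
  rw [coeff_succ_X_mul, coeff_derivative, toddSeries_eq_bernoulli] at h
  rw [← toddSeries_eq_bernoulli] at h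
  rw [h, toddSeries_eq_bernoulli]
  simp [bernoulli'PowerSeries, coeff_one, coeff_X]

/-- In degree 1 the coefficient of log Q is 1 - 1/2, which the term x/2 cancels. In odd degrees at
least 3 the Bernoulli numbers vanish. -/
theorem coeff_logTd_eq_zero {n : ℕ} (hn : n = 0 ∨ Odd n) :
    coeff n (logSeries toddSeries - C (1 / 2 : ℂ) * X) = 0 := by
  rcases hn with rfl | hn
  · have := constantCoeff_logSeries constantCoeff_toddSeries
    simpa using this
  · obtain ⟨k, rfl⟩ : ∃ k, n = k + 1 := ⟨n - 1, by have := hn.pos; omega⟩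
    have h := coeff_log_toddSeries k
    have hk : (k + 1 : ℂ) ≠ 0 := Nat.cast_add_one_ne_zero k
    rw [map_sub, coeff_C_mul, coeff_X]
    rcases Nat.eq_zero_or_pos k with rfl | hk0
    · rw [if_pos rfl, bernoulli'_one] at h
      norm_num at h ⊢
      rw [h]
      norm_num
    · rw [if_neg hk0.ne', bernoulli'_eq_zero_of_odd hn (by omega)] at h
      rw [if_neg (by omega), mul_zero, sub_zero]
      refine (mul_eq_zero.1 (h.trans ?_)).resolve_right hk
      simp

/-- With n = 2(k + 1), both sides equal -B_n/n: the left by the logarithmic derivative, the right by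
Euler's formula for ζ(n). -/
theorem coeff_logTd_even (k : ℕ) :
    coeff (2 * (k + 1)) (logSeries toddSeries - C (1 / 2 : ℂ) * X) *
        ((2 * (k + 1)).factorial : ℂ) =
      2 * ((2 * (k + 1) - 1).factorial : ℂ) / (2 * (Real.pi : ℂ) * Complex.I) ^ (2 * (k + 1)) *
        riemannZeta (2 * ((k : ℂ) + 1)) := by
  have h := coeff_log_toddSeries (2 * k + 1)
  rw [if_neg (by omega)] at h
  have hz := riemannZeta_two_mul_nat (k := k + 1) (by omega)
  push_cast at hz
  rw [hz, map_sub, coeff_C_mul, coeff_X, if_neg (by omega), mul_zero, sub_zero]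
  have hb : bernoulli (2 * (k + 1)) = bernoulli' (2 * (k + 1)) :=
    bernoulli_eq_bernoulli'_of_ne_one (by omega)
  rw [hb]
  have e1 : 2 * k + 1 + 1 = 2 * (k + 1) := by ring
  have e2 : 2 * (k + 1) - 1 = 2 * k + 1 := by omega
  rw [e1] at h
  rw [e2]
  have hf : ((2 * (k + 1)).factorial : ℂ) = (2 * k + 1 + 1) * (2 * k + 1).factorial := by
    rw [← e1, Nat.factorial_succ]; push_cast; ring
  have h1 : (2 * k + 1 + 1 : ℂ) ≠ 0 := by
    exact_mod_cast Nat.succ_ne_zero (2 * k + 1)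
  have h2 : ((2 * k + 1).factorial : ℂ) ≠ 0 := by exact_mod_cast (2 * k + 1).factorial_ne_zero
  have h3 : (Real.pi : ℂ) ≠ 0 := by exact_mod_cast Real.pi_ne_zero
  have hI : Complex.I ^ (2 * (k + 1)) = (-1) ^ (k + 1) := by
    rw [pow_mul, Complex.I_sq]
  have hs0 : ((-1 : ℂ) ^ (k + 1)) ≠ 0 := pow_ne_zero _ (by norm_num)
  push_cast at h
  rw [zero_sub] at h
  have h4 : (2 : ℂ) ^ (2 * (k + 1)) = 2 ^ (2 * k + 1) * 2 := by
    rw [← e1, pow_succ]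
  have h5 : ((2 : ℂ) ^ (2 * k + 1)) ≠ 0 := pow_ne_zero _ two_ne_zero
  have h6 : ((Real.pi : ℂ) ^ (2 * (k + 1))) ≠ 0 := pow_ne_zero _ h3
  have h7 : ((2 * (k + 1)).factorial : ℂ) ≠ 0 := by exact_mod_cast (2 * (k + 1)).factorial_ne_zero
  rw [mul_pow, mul_pow, hI, h4, pow_succ (-1 : ℂ) (k + 1)]
  have h8 : 2 * ((2 * k + 1).factorial : ℂ) /
      (2 ^ (2 * k + 1) * 2 * (Real.pi : ℂ) ^ (2 * (k + 1)) * (-1) ^ (k + 1)) *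
      ((-1) ^ (k + 1) * -1 * 2 ^ (2 * k + 1) * (Real.pi : ℂ) ^ (2 * (k + 1)) *
        (bernoulli' (2 * (k + 1)) : ℂ) / ((2 * (k + 1)).factorial : ℂ)) =
      ((2 * k + 1).factorial : ℂ) *
        -((bernoulli' (2 * (k + 1)) : ℂ) / ((2 * (k + 1)).factorial : ℂ)) := by
    field_simp
  rw [h8, ← h, hf]
  ring

theorem X_mul_inv_aHatSeries :
    X * (PowerSeries.mk fun n => if Even n then (1 / 2 : ℂ) ^ n / ((n + 1).factorial : ℂ) else 0) =
      rescale (1 / 2 : ℂ) (exp ℂ) - rescale (-1 / 2 : ℂ) (exp ℂ) := by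
  ext n
  cases n with
  | zero =>
    rw [coeff_zero_X_mul]
    simp [-coeff_zero_eq_constantCoeff, coeff_rescale]
  | succ n =>
    rw [coeff_succ_X_mul, coeff_mk, map_sub, coeff_rescale, coeff_rescale, coeff_exp]
    have h : (-1 / 2 : ℂ) ^ (n + 1) = (-1) ^ (n + 1) * (1 / 2) ^ (n + 1) := by
      rw [← mul_pow]; norm_num
    rw [h]
    simp only [map_div₀, map_one, map_natCast]
    split_ifs with he
    · rw [he.add_one.neg_one_pow]
      ring
    · rw [(Nat.not_even_iff_odd.1 he).add_one.neg_one_pow]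
      ring

/-- This is e^{x/2}(1 - e^{-x}) = e^{x/2} - e^{-x/2} at the level of the inverse series. -/
theorem aHatSeries_mul_exp : aHatSeries * rescale (1 / 2 : ℂ) (exp ℂ) = toddSeries := by
  have hS : (PowerSeries.mk fun n => if Even n then (1 / 2 : ℂ) ^ n / ((n + 1).factorial : ℂ)
      else 0) = rescale (1 / 2 : ℂ) (exp ℂ) *
        (PowerSeries.mk fun n => (-1 : ℂ) ^ n / ((n + 1).factorial : ℂ)) := by
    refine mul_left_cancel₀ (X_ne_zero (R := ℂ)) ?_
    rw [X_mul_inv_aHatSeries, mul_left_comm, X_mul_inv_toddSeries, mul_sub, mul_one, evalNegHom,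
      exp_mul_exp_eq_exp_add]
    norm_num
  have h1 : aHatSeries * (PowerSeries.mk fun n => if Even n then
      (1 / 2 : ℂ) ^ n / ((n + 1).factorial : ℂ) else 0) = 1 := by
    rw [aHatSeries, PowerSeries.inv_mul_cancel]
    simp
  have h2 : toddSeries * (PowerSeries.mk fun n => (-1 : ℂ) ^ n / ((n + 1).factorial : ℂ)) = 1 := by
    rw [toddSeries, PowerSeries.inv_mul_cancel]
    simp
  rw [hS] at h1
  linear_combination toddSeries * h1 - (aHatSeries * rescale (1 / 2 : ℂ) (exp ℂ)) * h2

theorem constantCoeff_aHatSeries : constantCoeff aHatSeries = 1 := by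
  simp [aHatSeries]

theorem derivative_rescale_exp (a : ℂ) :
    d⁄dX ℂ (rescale a (exp ℂ)) = C a * rescale a (exp ℂ) := by
  ext n
  simp only [coeff_derivative, coeff_rescale, coeff_exp, coeff_C_mul]
  have h : ((n + 1).factorial : ℂ) = (n + 1) * n.factorial := by
    rw [Nat.factorial_succ]; push_cast; ring
  have h1 : (n + 1 : ℂ) ≠ 0 := Nat.cast_add_one_ne_zero n
  have h2 : (n.factorial : ℂ) ≠ 0 := by exact_mod_cast n.factorial_ne_zero
  simp only [map_div₀, map_one, map_natCast, h]
  field_simp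
  ring

/-- `log Q(x) - x/2 = log P(x)`. -/
theorem log_toddSeries_sub : logSeries toddSeries - C (1 / 2 : ℂ) * X = logSeries aHatSeries := by
  have hP0 : aHatSeries ≠ 0 := fun h => by
    have := constantCoeff_aHatSeries
    simp [h] at this
  have hQ0 : toddSeries ≠ 0 := fun h => by
    have := constantCoeff_toddSeries
    simp [h] at this
  refine derivative.ext ?_ ?_
  · have hQ := derivative_logSeries_mul constantCoeff_toddSeries
    have hP := derivative_logSeries_mul constantCoeff_aHatSeries
    have h := congrArg (d⁄dX ℂ) aHatSeries_mul_exp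
    rw [Derivation.leibniz, derivative_rescale_exp, smul_eq_mul, smul_eq_mul] at h
    have hX : d⁄dX ℂ (C (1 / 2 : ℂ) * X) = C (1 / 2 : ℂ) := by
      rw [Derivation.leibniz]
      simp
    rw [map_sub, hX]
    refine mul_right_cancel₀ hQ0 ?_
    linear_combination hQ - h - rescale (1 / 2 : ℂ) (exp ℂ) * hP +
      (C (1 / 2 : ℂ) + d⁄dX ℂ (logSeries aHatSeries)) * aHatSeries_mul_exp
  · rw [map_sub, constantCoeff_logSeries constantCoeff_toddSeries,
      constantCoeff_logSeries constantCoeff_aHatSeries]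
    simp

end

end ChernSimons

/-! ### The one-loop sum on harmonic fields and its identification with the characteristic class -/

namespace ChernSimons

set_option linter.unusedSectionVars false

noncomputable section

open GSeries MeasureTheory

variable {R : Type*} [Ring R] [Algebra ℂ R] {gr : ℤ → Submodule ℂ R} [GradedAlgebra gr] {r : ℕ}
  {B : CDGA gr} {I : TwoSidedIdeal R} {deg : Fin r → ℤ}

namespace CurvedLInfinity

/-! ### Additive characteristic classes by weight -/

theorem formWeight_superTrace [GradedComm gr] (g : CurvedLInfinity B I deg) (n : ℕ) :
    WtHom (formWeight (Fin r)) n (superTrace (g.atiyahMatrix ^ n)) := by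
  have hpow : ∀ i j, WtHom (formWeight (Fin r)) n ((g.atiyahMatrix ^ n) i j) := by
    induction n with
    | zero =>
      intro i j
      rw [pow_zero, Matrix.one_apply]
      split_ifs
      · exact WtHom.one _
      · exact WtHom.zero _ _
    | succ n ih =>
      intro i j
      rw [pow_succ, Matrix.mul_apply]
      refine WtHom.sum fun k _ => ?_
      push_cast
      exact (ih i k).mul (g.formWeight_atiyahMatrix k j)
  exact WtHom.sum fun i _ => (hpow i i).smul _

theorem formWeight_ch [GradedComm gr] (g : CurvedLInfinity B I deg) (n : ℕ) :
    WtHom (formWeight (Fin r)) n (g.ch n) :=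
  (g.formWeight_superTrace n).smul _

/-- ch_k contains exactly k differentials, so at a given monomial at most one term of the formal sum
is non-zero. -/
theorem coeff_additiveClass [GradedComm gr] (g : CurvedLInfinity B I deg) (f : PowerSeries ℂ)
    {n : ℕ} {q : Fin 2 ×ₗ Fin r →₀ ℕ} (hq : wt (formWeight (Fin r)) q = n) :
    (g.additiveClass f).coeff q =
      ((PowerSeries.coeff n f * (n.factorial : ℂ)) • g.ch n).coeff q := by
  by_cases hadm : Admissible (formDeg (ceDeg deg)) q
  · rw [additiveClass, formalSum, coeff_ofFun _ hadm]
    refine finsum_eq_single _ n fun k hk => ?_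
    rw [coeff_smul, (g.formWeight_ch k).coeff_eq_zero, smul_zero]
    rw [hq]
    exact_mod_cast hk.symm
  · rw [GSeries.coeff_eq_zero _ _ hadm, GSeries.coeff_eq_zero _ _ hadm]

theorem wt_formWeight_nonneg {σ : Type*} [Fintype σ] (q : Fin 2 ×ₗ σ →₀ ℕ) :
    0 ≤ wt (formWeight σ) q :=
  Finset.sum_nonneg fun _ _ => mul_nonneg (Int.natCast_nonneg _) (Int.natCast_nonneg _)

/-- Instead of pulling back an infinite sum, the n-th term is subtracted: the difference has no
monomial of form weight n, and the pullback preserves form weight. -/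
theorem coeff_pullbackForm_additiveClass [GradedComm gr] (g : CurvedLInfinity B I deg)
    (f : PowerSeries ℂ) {n : ℕ} {m : Fin 2 ×ₗ (Fin 2 ×ₗ Fin r) →₀ ℕ}
    (hm : wt (formWeight (Fin 2 ×ₗ Fin r)) m = n) :
    (pullbackForm (g.additiveClass f)).coeff m =
      (PowerSeries.coeff n f * (n.factorial : ℂ)) • (pullbackForm (g.ch n)).coeff m := by
  have h0 : (pullbackForm (g.additiveClass f -
      (PowerSeries.coeff n f * (n.factorial : ℂ)) • g.ch n)).coeff m = 0 := by
    refine coeff_eval_eq_zero (ω := formWeight (Fin r)) (ω' := formWeight (Fin 2 ×ₗ Fin r))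
      pullbackForm_isSubst.fil (fun s => WtHom.X _ _) fun q hq => ?_
    rw [hm] at hq
    rw [sub_eq_add_neg, coeff_add, coeff_neg, g.coeff_additiveClass f hq, add_neg_cancel]
  have h1 : pullbackForm (g.additiveClass f -
      (PowerSeries.coeff n f * (n.factorial : ℂ)) • g.ch n) =
      pullbackForm (g.additiveClass f) -
        (PowerSeries.coeff n f * (n.factorial : ℂ)) • pullbackForm (g.ch n) := by
    simp only [pullbackForm]
    rw [eval_sub pullbackForm_isSubst, eval_smul pullbackForm_isSubst.fil]
  rw [h1, sub_eq_add_neg, coeff_add, coeff_neg, add_neg_eq_zero] at h0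
  rw [h0, coeff_smul]

/-- The defining series has only terms of positive even degree, which n = 2(k + 1) enumerates. -/
theorem formalSum_ch_eq_logTdClass (g : CurvedLInfinity B I deg) :
    (formalSum fun k : ℕ =>
        (2 * ((2 * (k + 1) - 1).factorial : ℂ) /
            (2 * (Real.pi : ℂ) * Complex.I) ^ (2 * (k + 1)) *
          riemannZeta (2 * ((k : ℂ) + 1))) • g.ch (2 * (k + 1))) = g.logTdClass := by
  have hinj : Function.Injective fun k : ℕ => 2 * (k + 1) := fun a b h => by
    simp only at h
    omega
  refine ext_adm fun m hm => ?_
  rw [logTdClass, additiveClass, formalSum, formalSum, coeff_ofFun _ hm, coeff_ofFun _ hm]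
  set F : ℕ → R := fun k => ((PowerSeries.coeff k (logSeries toddSeries -
    PowerSeries.C (1 / 2 : ℂ) * PowerSeries.X) * (k.factorial : ℂ)) • g.ch k).coeff m with hF
  have hsupp : Function.support F ⊆ Set.range fun k : ℕ => 2 * (k + 1) := fun n hn => by
    by_contra hr
    refine hn ?_
    have h : n = 0 ∨ Odd n := by
      by_contra hcon
      rw [not_or, Nat.not_odd_iff_even] at hcon
      obtain ⟨j, hj⟩ := hcon.2
      exact hr ⟨j - 1, by simp only; omega⟩
    rw [hF]
    simp only
    rw [coeff_logTd_eq_zero h, zero_mul, zero_smul, coeff_zero]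
  have h := finsum_mem_range (f := F) hinj
  rw [finsum_mem_def, Set.indicator_eq_self.2 hsupp] at h
  rw [h]
  refine finsum_congr fun k => ?_
  simp only [hF]
  rw [coeff_logTd_even]

/-! ### The one-loop weights on harmonic fields -/

/-- The factors on the left are the 1/n from counting labelled cycles, the limit of the cyclic
integral, and the normalization of dz at each vertex; the length of the circle cancels between the
last two. -/
theorem one_loop_coefficient {len : ℝ} (hlen : 0 < len) (j : ℕ) :
    1 / ((2 * (j + 1) : ℕ) : ℂ) * 2 * riemannZeta ((2 * (j + 1) : ℕ) : ℂ) *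
        ((len : ℂ) * Complex.I / (2 * Real.pi)) ^ (2 * (j + 1)) *
        (-(1 / (2 * (Real.pi : ℂ) * Complex.I * len))) ^ (2 * (j + 1)) =
      PowerSeries.coeff (2 * (j + 1)) (logSeries toddSeries -
          PowerSeries.C (1 / 2 : ℂ) * PowerSeries.X) * ((2 * (j + 1)).factorial : ℂ) *
        (1 / (((2 * (j + 1)).factorial : ℂ) *
          (-(2 * (Real.pi : ℂ) * Complex.I)) ^ (2 * (j + 1)))) := by
  have h1 : (len : ℂ) ≠ 0 := by exact_mod_cast hlen.ne'
  have h2 : (Real.pi : ℂ) ≠ 0 := by exact_mod_cast Real.pi_ne_zero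
  have h3 := Complex.I_ne_zero
  have h4 : ((2 * (j + 1) - 1).factorial : ℂ) ≠ 0 := by
    exact_mod_cast (2 * (j + 1) - 1).factorial_ne_zero
  have h5 : ((2 * (j + 1) : ℕ) : ℂ) ≠ 0 := by exact_mod_cast (by omega : 2 * (j + 1) ≠ 0)
  have h6 : ((2 * (j + 1)).factorial : ℂ) =
      ((2 * (j + 1) : ℕ) : ℂ) * ((2 * (j + 1) - 1).factorial : ℂ) := by
    exact_mod_cast (Nat.mul_factorial_pred (by omega : 2 * (j + 1) ≠ 0)).symm
  have h7 : riemannZeta ((2 * (j + 1) : ℕ) : ℂ) = riemannZeta (2 * ((j : ℂ) + 1)) := by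
    push_cast
    rfl
  have h8 : ((len : ℂ) * Complex.I / (2 * Real.pi)) ^ (2 * (j + 1)) *
      (-(1 / (2 * (Real.pi : ℂ) * Complex.I * len))) ^ (2 * (j + 1)) =
      1 / (2 * (Real.pi : ℂ) * Complex.I) ^ (2 * (j + 1)) *
        (1 / (-(2 * (Real.pi : ℂ) * Complex.I)) ^ (2 * (j + 1))) := by
    -- The bases on the two sides differ by a sign, so their squares are compared.
    rw [← one_div_pow, ← one_div_pow, ← mul_pow, ← mul_pow, pow_mul, pow_mul]
    congr 1
    field_simp
    exact Complex.I_pow_four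
  rw [coeff_logTd_even, mul_assoc _ (_ ^ _) (_ ^ _), h8, h6, h7]
  field_simp

/-- Harmonic fields do not depend on the position, so the contraction is constant in the integration
variables and may be evaluated at any configuration `x₀`. -/
theorem weight_harmonicField (g : CurvedLInfinity B I deg) (len ε L : ℝ) {n : ℕ}
    (γ : LabelledGraph n) (m : Fin 2 ×ₗ (Fin 2 ×ₗ Fin r) →₀ ℕ) (l : R →ₗ[ℂ] ℂ) (x₀ : Fin n → ℝ) :
    g.weight len ε L γ (harmonicField gr deg len) m l =
      (∫ x, ∏ e, propagator len ε L (x (γ e).1 - x (γ e).2) ∂boxMeasure len n) *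
        l (((g.contraction γ).eval fun p =>
          harmonicField gr deg len (ofLex p).2 (x₀ (ofLex p).1)).coeff m) := by
  rw [weight, volume_restrict_box, ← integral_mul_const]
  congr 1
  funext x
  rw [weightIntegrand, coeff_smul, map_smul, smul_eq_mul]
  rfl

/-- Two edges with a common head kill the contraction. Otherwise the heads are in bijection with the
vertices, some vertex is no tail, and the integral of propagators vanishes. -/
theorem weight_eq_zero (g : CurvedLInfinity B I deg) {len ε L : ℝ} (hlen : 0 < len) (hε : 0 < ε)
    (hL : ε ≤ L) {n : ℕ} {γ : LabelledGraph n}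
    (hγ : ¬ ((Function.Bijective fun e => (γ e).1) ∧ Function.Bijective fun e => (γ e).2))
    (m : Fin 2 ×ₗ (Fin 2 ×ₗ Fin r) →₀ ℕ) (l : R →ₗ[ℂ] ℂ) :
    g.weight len ε L γ (harmonicField gr deg len) m l = 0 := by
  rw [g.weight_harmonicField len ε L γ m l fun _ => 0]
  by_cases h2 : Function.Injective fun e => (γ e).2
  · have h2' : Function.Bijective fun e => (γ e).2 := Finite.injective_iff_bijective.1 h2
    have h1 : ¬ Function.Surjective fun e => (γ e).1 := fun h =>
      hγ ⟨Finite.surjective_iff_bijective.1 h, h2'⟩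
    simp only [propagator_eq_fourierSum hlen hε hL]
    rw [integral_prod_edges_eq_zero hlen (summable_propCoeff hlen hε (hε.trans_le hL))
      (propCoeff_zero _ _ _) h2' h1, zero_mul]
  · have h0 : ((0 : GSeries gr (multiDeg deg n)).eval fun p =>
        harmonicField gr deg len (ofLex p).2 0) = 0 :=
      eval_zero (multiHarmonic_isSubst len fun _ => 0).fil
    rw [g.contraction_eq_zero h2, h0, coeff_zero, map_zero, mul_zero]

theorem weight_of_cycle [GradedComm gr] (g : CurvedLInfinity B I deg) {len ε L : ℝ}
    (hlen : 0 < len) (hε : 0 < ε) (hL : ε ≤ L) {n : ℕ} {γ : LabelledGraph n}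
    (hc : γ.IsConnected) (h1 : Function.Bijective fun e => (γ e).1)
    (h2 : Function.Bijective fun e => (γ e).2)
    (m : Fin 2 ×ₗ (Fin 2 ×ₗ Fin r) →₀ ℕ) (l : R →ₗ[ℂ] ℂ) :
    g.weight len ε L γ (harmonicField gr deg len) m l =
      cycleSum len ε L n * ((-(1 / (2 * (Real.pi : ℂ) * Complex.I * len))) ^ n *
        l ((pullbackForm (superTrace (g.atiyahMatrix ^ n))).coeff m)) := by
  cases n with
  | zero => exact absurd hc (LabelledGraph.not_isConnected_zero γ)
  | succ n =>
    obtain ⟨t, h, rfl⟩ := LabelledGraph.exists_eq_ofPerms h1 h2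
    obtain ⟨v, vs, hl, hγ⟩ := LabelledGraph.exists_cyclic_list (t := t)
      ((LabelledGraph.isConnected_ofPerms_iff t h).1 hc)
    rw [g.weight_harmonicField len ε L _ m l fun _ => 0]
    simp only [propagator_eq_fourierSum hlen hε hL]
    rw [integral_prod_edges_of_perm hlen (summable_propCoeff hlen hε (hε.trans_le hL)) hl hγ,
      eval_contraction_eq_of_perm g hl hγ len fun _ => 0, coeff_smul, map_smul, smul_eq_mul,
      cycleSum]

-- All cycles with n vertices have the same weight, and n!(n-1)!/n!² = 1/n.
open Classical in
theorem sum_weight_connected [GradedComm gr] (g : CurvedLInfinity B I deg) {len ε L : ℝ}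
    (hlen : 0 < len) (hε : 0 < ε) (hL : ε ≤ L) (n : ℕ)
    (m : Fin 2 ×ₗ (Fin 2 ×ₗ Fin r) →₀ ℕ) (l : R →ₗ[ℂ] ℂ) :
    (1 / ((n.factorial : ℂ) * (n.factorial : ℂ))) *
      ∑ γ ∈ Finset.univ.filter fun γ : LabelledGraph n => γ.IsConnected,
        g.weight len ε L γ (harmonicField gr deg len) m l =
      1 / (n : ℂ) * (cycleSum len ε L n *
        ((-(1 / (2 * (Real.pi : ℂ) * Complex.I * len))) ^ n *
          l ((pullbackForm (superTrace (g.atiyahMatrix ^ n))).coeff m))) := by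
  set A : ℂ := cycleSum len ε L n * ((-(1 / (2 * (Real.pi : ℂ) * Complex.I * len))) ^ n *
    l ((pullbackForm (superTrace (g.atiyahMatrix ^ n))).coeff m)) with hA
  have hsum : ∑ γ ∈ Finset.univ.filter fun γ : LabelledGraph n => γ.IsConnected,
      g.weight len ε L γ (harmonicField gr deg len) m l =
      ((Finset.univ.filter fun γ : LabelledGraph n => γ.IsConnected ∧
        (Function.Bijective fun e => (γ e).1) ∧ Function.Bijective fun e => (γ e).2).card : ℂ) *
        A := by
    rw [← nsmul_eq_mul, ← Finset.sum_const, ← Finset.filter_filter]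
    conv_rhs => rw [Finset.sum_filter]
    refine Finset.sum_congr rfl fun γ hγ => ?_
    have hc : γ.IsConnected := (Finset.mem_filter.1 hγ).2
    split_ifs with h
    · exact g.weight_of_cycle hlen hε hL hc h.1 h.2 m l
    · exact g.weight_eq_zero hlen hε hL h m l
  rw [hsum]
  rcases lt_or_ge n 2 with hn | hn
  -- The count of cycles requires n ≥ 2. For n = 0 no graph is connected, and the one-vertex loop
  -- vanishes by oddness of the propagator.
  · interval_cases n
    · have h0 : (Finset.univ.filter fun γ : LabelledGraph 0 => γ.IsConnected ∧
          (Function.Bijective fun e => (γ e).1) ∧ Function.Bijective fun e => (γ e).2).card = 0 :=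
        Finset.card_eq_zero.2 (Finset.filter_eq_empty_iff.2 fun γ _ h =>
          LabelledGraph.not_isConnected_zero γ h.1)
      rw [h0]
      simp
    · have : A = 0 := by
        rw [hA, cycleSum_eq_zero_of_odd len ε L odd_one, zero_mul]
      rw [this]
      simp
  · rw [LabelledGraph.card_connected_bijective hn, ← mul_assoc]
    congr 1
    obtain ⟨k, rfl⟩ : ∃ k, n = k + 1 := ⟨n - 1, by omega⟩
    rw [Nat.add_sub_cancel, Nat.factorial_succ]
    have h1 : (k.factorial : ℂ) ≠ 0 := by exact_mod_cast k.factorial_ne_zero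
    have h2 : (k + 1 : ℂ) ≠ 0 := Nat.cast_add_one_ne_zero k
    push_cast
    field_simp

/-- Tr(At^k) contains exactly k differentials, so among all numbers of vertices only the form weight
of `m` contributes. -/
theorem oneLoop_harmonicField [GradedComm gr] (g : CurvedLInfinity B I deg) {len ε L : ℝ}
    (hlen : 0 < len) (hε : 0 < ε) (hL : ε ≤ L) {n : ℕ}
    {m : Fin 2 ×ₗ (Fin 2 ×ₗ Fin r) →₀ ℕ} (hm : wt (formWeight (Fin 2 ×ₗ Fin r)) m = n)
    (l : R →ₗ[ℂ] ℂ) :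
    g.oneLoop len ε L (harmonicField gr deg len) m l =
      1 / (n : ℂ) * (cycleSum len ε L n *
        ((-(1 / (2 * (Real.pi : ℂ) * Complex.I * len))) ^ n *
          l ((pullbackForm (superTrace (g.atiyahMatrix ^ n))).coeff m))) := by
  unfold oneLoop
  simp only [g.sum_weight_connected hlen hε hL]
  refine tsum_eq_single n fun k hk => ?_
  rw [(formWeight_pullbackForm (g.formWeight_superTrace k)).coeff_eq_zero, map_zero, mul_zero,
    mul_zero, mul_zero]
  rw [hm]
  exact_mod_cast hk.symm

theorem isOneLoopInfinity_logTdClass [GradedComm gr] (g : CurvedLInfinity B I deg) {len : ℝ}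
    (hlen : 0 < len) :
    g.IsOneLoopInfinity len (harmonicField gr deg len) (pullbackForm g.logTdClass) := by
  intro m l
  obtain ⟨n, hn⟩ := Int.eq_ofNat_of_zero_le (wt_formWeight_nonneg m)
  -- The closed formula is available for 0 < ε ≤ L, which holds eventually as ε tends to 0 from the
  -- right.
  have hloop : ∀ L : ℝ, 0 < L → ∀ᶠ ε in nhdsWithin 0 (Set.Ioi 0),
      1 / (n : ℂ) * (cycleSum len ε L n *
        ((-(1 / (2 * (Real.pi : ℂ) * Complex.I * len))) ^ n *
          l ((pullbackForm (superTrace (g.atiyahMatrix ^ n))).coeff m))) =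
        g.oneLoop len ε L (harmonicField gr deg len) m l := fun L hL => by
    filter_upwards [Ioc_mem_nhdsGT hL] with ε hε
    exact (g.oneLoop_harmonicField hlen hε.1 hε.2 hn l).symm
  rw [logTdClass, g.coeff_pullbackForm_additiveClass _ hn, map_smul, smul_eq_mul]
  by_cases h : n = 0 ∨ Odd n
  · refine ⟨fun _ => 0, fun L hL => ?_, ?_⟩
    · refine Filter.Tendsto.congr' (hloop L hL) ?_
      -- For n = 0 the factor 1/n is 0 by convention; for odd n the cyclic sum vanishes before any
      -- limit is taken.
      rcases h with rfl | h
      · simp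
      · simp [cycleSum_eq_zero_of_odd len _ _ h]
    · rw [coeff_logTd_eq_zero h, zero_mul, zero_mul]
      exact tendsto_const_nhds
  · rw [not_or, Nat.not_odd_iff_even] at h
    have hn1 : 1 < n := by
      obtain ⟨j, hj⟩ := h.2
      have := h.1
      omega
    refine ⟨fun L => 1 / (n : ℂ) * (cycleSum len 0 L n *
        ((-(1 / (2 * (Real.pi : ℂ) * Complex.I * len))) ^ n *
          l ((pullbackForm (superTrace (g.atiyahMatrix ^ n))).coeff m))), fun L hL => ?_, ?_⟩
    · exact Filter.Tendsto.congr' (hloop L hL)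
        (((tendsto_cycleSum_zero hlen hL.le hn1).mul_const _).const_mul _)
    · refine (((tendsto_cycleSum_atTop hlen hn1).mul_const _).const_mul _).trans_eq ?_
      have hch : pullbackForm (g.ch n) =
          (1 / ((n.factorial : ℂ) * (-(2 * (Real.pi : ℂ) * Complex.I)) ^ n)) •
            pullbackForm (superTrace (g.atiyahMatrix ^ n)) :=
        eval_smul pullbackForm_isSubst.fil _ _
      rw [tsum_cycle_limit len hn1 h.2, hch, coeff_smul, map_smul, smul_eq_mul]
      congr 1
      simp only [← mul_assoc]
      congr 1
      obtain ⟨j, rfl⟩ : ∃ j, n = 2 * (j + 1) := by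
        obtain ⟨i, hi⟩ := h.2
        exact ⟨i - 1, by omega⟩
      exact one_loop_coefficient hlen j

end CurvedLInfinity

end

end ChernSimons
theorem mainTheorem4 {R : Type*} [Ring R] [Algebra ℂ R] (gr : ℤ → Submodule ℂ R)
    [GradedAlgebra gr] (B : ChernSimons.CDGA gr) (I : TwoSidedIdeal R)
    (hI : ∃ N : ℕ, ∀ f : Fin N → R, (∀ k, f k ∈ I) → (List.ofFn f).prod = 0)
    {r : ℕ} (deg : Fin r → ℤ) (g : ChernSimons.CurvedLInfinity B I deg)
    (len : ℝ) (hlen : 0 < len) :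
    g.IsOneLoopInfinity len (ChernSimons.harmonicField gr deg len)
      (ChernSimons.pullbackForm (ChernSimons.GSeries.formalSum fun k : ℕ =>
        (2 * ((2 * (k + 1) - 1).factorial : ℂ) /
            (2 * (Real.pi : ℂ) * Complex.I) ^ (2 * (k + 1)) *
          riemannZeta (2 * ((k : ℂ) + 1))) • g.ch (2 * (k + 1)))) ∧
    (ChernSimons.GSeries.formalSum fun k : ℕ =>
        (2 * ((2 * (k + 1) - 1).factorial : ℂ) /
            (2 * (Real.pi : ℂ) * Complex.I) ^ (2 * (k + 1)) *
          riemannZeta (2 * ((k : ℂ) + 1))) • g.ch (2 * (k + 1))) = g.logTdClass ∧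
    g.logTdClass = g.logAHatClass := by
  have : ChernSimons.GradedComm gr := ⟨B.comm⟩
  refine ⟨?_, g.formalSum_ch_eq_logTdClass, ?_⟩
  · rw [g.formalSum_ch_eq_logTdClass]
    exact g.isOneLoopInfinity_logTdClass hlen
  · rw [ChernSimons.CurvedLInfinity.logTdClass, ChernSimons.CurvedLInfinity.logAHatClass,
      ChernSimons.log_toddSeries_sub]
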